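/- Let $\mathbb T$ be the circle group. For an abelian compact Lie group $A$ write $A^*=\mathrm{Hom}(A,\mathbb T)$ for its group of (continuous) characters, with trivial character $\epsilon$. A character $V\colon A\to\mathbb T$ is called \emph{split} if it has a section (a continuous homomorphism $s\colon \mathbb T\to A$ with $V\circ s=\mathrm{id}$). A \emph{torus} is a group isomorphic to $\mathbb T^n$ for some $n\ge 0$. An \emph{$Ab$-algebra} is a contravariant functor from abelian compact Lie groups and continuous homomorphisms to commutative rings. \textbf{Equivariant formal group laws.} An $A$-equivariant formal group law $F=(k,R,\Delta,\theta,y(\epsilon))$ consists of a commutative ring $k$, a complete (Hausdorff) commutative topological $k$-algebra $R$, a continuous $k$-algebra map $\Delta\colon R\to R\hat\otimes_k R$, $k$-algebra maps $\theta(V)\colon R\to k$ for $V\in A^*$, and an element $y(\epsilon)\in R$, such that: $\Delta$ is cocommutative, coassociative and counital for $\theta(\epsilon)$; $(\theta(V)\hat\otimes\theta(W))\circ\Delta=\theta(VW)$ for all $V,W\in A^*$; the topology on $R$ is the linear topology generated by the finite products of the ideals $\ker\theta(V)$; and $y(\epsilon)$ is regular (a non-zero-divisor) and generates $\ker\theta(\epsilon)$.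 Morphisms are pairs of ring maps $k\to k'$, $R\to R'$ preserving all the structure. The Euler class of $V\in A^*$ is $e_V=\theta(V)(y(\epsilon))\in k$. For a continuous homomorphism $\alpha\colon B\to A$ and a $B$-equivariant formal group law $F$, the pushforward $\alpha_*F$ is the $A$-equivariant formal group law over the same ground ring whose algebra $R_\alpha$ is the completion of $R$ at the finite products of the ideals $\ker\theta(V\circ\alpha)$, $V\in A^*$, with the induced comultiplication, augmentations $\theta(V\circ\alpha)$, and orientation. \textbf{The global Lazard ring.} Let $L_A$ be the ground ring of the initial $A$-equivariant formal group law. For $\alpha\colon B\to A$ let $\alpha^*\colon L_A\to L_B$ be the map of ground rings underlying the unique morphism from the initial $A$-equivariant formal group law to the pushforward along $\alpha$ of the initial $B$-equivariant one. The \emph{global Lazard ring} is the resulting $Ab$-algebra $\mathbf L\colon A\mapsto L_A$. Its universal Euler class is $e_\tau\in L_{\mathbb T}$, where $\tau=\mathrm{id}_{\mathbb T}$. \textbf{Global group laws.} A \emph{global group law} is a contravariant functor $X$ from tori to commutative rings with a class $e\in X(\mathbb T)$ (the coordinate) such that for every torus $A$ and every split character $V\colon A\to\mathbb T$ the sequence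 \[0\to X(A)\xrightarrow{\;V^*(e)\cdot\;}X(A)\xrightarrow{\;\mathrm{res}\;}X(\ker V)\to 0\] is exact. Morphisms are natural transformations preserving the coordinates. A global group law is extended to an $Ab$-algebra by left Kan extension. \textbf{Theorem.} For every abelian compact Lie group $A$ there is an initial $A$-equivariant formal group law, so that the global Lazard ring $\mathbf L$ exists, and there is an initial global group law $(\widetilde{\mathbf L},e)$, which admits a left Kan extension to an $Ab$-algebra, again written $\widetilde{\mathbf L}$. There is an isomorphism of $Ab$-algebras $\mathbf L\cong\widetilde{\mathbf L}$ sending the universal Euler class $e_\tau\in L_{\mathbb T}$ to the universal coordinate $e\in\widetilde{\mathbf L}(\mathbb T)$. Hence $(\mathbf L,e_\tau)$ is the universal global group law: the restriction of $\mathbf L$ to tori with the class $e_\tau$ is an initial global group law, and $\mathbf L$ is the left Kan extension of this restriction. In particular, if $A$ is a torus and $V\colon A\to\mathbb T$ is a split character, then the Euler class $e_V\in L_A$ is regular (a non-zero-divisor). -/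

import Mathlib

open CategoryTheory Opposite
open scoped TensorProduct Manifold ContDiff

universe u

noncomputable section

/-! ### Abelian compact Lie groups, characters and tori -/

/-- Abelian compact Lie groups: compact Hausdorff abelian topological groups whose topology
underlies a finite-dimensional real (smooth) Lie group structure. -/
structure AbCompactLieGroup : Type 1 where
  carrier : Type
  [commGroup : CommGroup carrier]
  [topologicalSpace : TopologicalSpace carrier]
  [isTopologicalGroup : IsTopologicalGroup carrier]
  [compactSpace : CompactSpace carrier]
  [t2Space : T2Space carrier]
  isLieGroup : ∃ (E : Type) (_ : NormedAddCommGroup E) (_ : NormedSpace ℝ E)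
    (_ : FiniteDimensional ℝ E) (_ : ChartedSpace E carrier), LieGroup 𝓘(ℝ, E) ∞ carrier

namespace AbCompactLieGroup

instance : CoeSort AbCompactLieGroup Type := ⟨carrier⟩

attribute [instance] commGroup topologicalSpace isTopologicalGroup compactSpace t2Space

/-- Morphisms are the continuous homomorphisms (these are automatically smooth). -/
instance : Category AbCompactLieGroup where
  Hom A B := A →ₜ* B
  id A := ContinuousMonoidHom.id A
  comp f g := ContinuousMonoidHom.comp g f

/-- A continuous homomorphism, regarded as a morphism of the category. -/
def ofHom {A B : AbCompactLieGroup} (f : A →ₜ* B) : A ⟶ B := f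

/-- The circle group `𝕋`. -/
def circle : AbCompactLieGroup where
  carrier := Circle
  isLieGroup := ⟨EuclideanSpace ℝ (Fin 1), inferInstance, inferInstance, inferInstance,
    inferInstance, LieGroup.of_le (n := ω) le_top⟩

/-- The character group `A^* = Hom(A, 𝕋)`, written multiplicatively. -/
abbrev Char (A : AbCompactLieGroup) : Type := A →ₜ* Circle

/-- The homomorphism `α^* : A^* → B^*` of restriction along `α : B → A`. -/
def charMap {B A : AbCompactLieGroup} (α : B →ₜ* A) : A.Char →* B.Char where
  toFun V := V.comp α
  map_one' := rfl
  map_mul' _ _ := rfl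

/-- The tautological character `τ` of the circle. -/
def tau : circle.Char := ContinuousMonoidHom.id Circle

/-- A character is split if it has a section. -/
def IsSplit {A : AbCompactLieGroup} (V : A.Char) : Prop :=
  ∃ s : Circle →ₜ* A, ∀ z, V (s z) = z

/-- Tori: the groups isomorphic to `𝕋^n` for some `n`. -/
def IsTorus : ObjectProperty AbCompactLieGroup :=
  fun A => ∃ n : ℕ, Nonempty (A ≃ₜ* (Fin n → Circle))

theorem isTorus_circle : IsTorus circle :=
  ⟨1, ⟨{ toFun := fun z _ => z
         invFun := fun f => f 0
         left_inv := fun _ => rfl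
         right_inv := fun f => funext fun i => congrArg f (Subsingleton.elim 0 i)
         map_mul' := fun _ _ => rfl
         continuous_toFun := continuous_pi fun _ => continuous_id
         continuous_invFun := continuous_apply 0 }⟩⟩

end AbCompactLieGroup

open AbCompactLieGroup

/-- The full subcategory of tori. -/
abbrev Torus : Type 1 := IsTorus.FullSubcategory

/-- The circle as a torus. -/
def circleTorus : Torus := ⟨circle, isTorus_circle⟩

/-- The inclusion of tori into all abelian compact Lie groups, on opposite categories. -/
abbrev torusInclusion : Torusᵒᵖ ⥤ AbCompactLieGroupᵒᵖ := (ObjectProperty.ι IsTorus).op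

/-! ### Global group laws -/

/-- The restriction map `f^* : X(B) → X(A)` along a homomorphism of tori `f : A → B`. -/
def torusRes (X : Torusᵒᵖ ⥤ CommRingCat.{u}) {A B : Torus} (f : A.obj →ₜ* B.obj) :
    X.obj (op B) →+* X.obj (op A) :=
  (X.map (ObjectProperty.homMk (ofHom f)).op).hom

/-- `e ∈ X(𝕋)` is a coordinate, i.e. `(X, e)` is a global group law: for every torus `A` and every
split character `V : A → 𝕋`, the sequence
`0 → X(A) → X(A) → X(ker V) → 0` is exact, where the first map is multiplication by `e_V = V^* e`
and the second is restriction. The inclusion of the kernel (which is a torus) is represented by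
an arbitrary injective homomorphism `i : K → A` from a torus with image the kernel of `V`. -/
def IsCoordinate (X : Torusᵒᵖ ⥤ CommRingCat.{u}) (e : X.obj (op circleTorus)) : Prop :=
  ∀ (A K : Torus) (V : A.obj.Char) (i : K.obj →ₜ* A.obj), IsSplit V →
    Function.Injective i → (∀ a, V a = 1 ↔ a ∈ Set.range i) →
      Function.Injective (fun x : X.obj (op A) => torusRes X (B := circleTorus) V e * x) ∧
      Function.Exact (fun x : X.obj (op A) => torusRes X (B := circleTorus) V e * x)
        (torusRes X i) ∧
      Function.Surjective (torusRes X i)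

/-- `(X, e)` is the universal (initial) global group law; morphisms of global group laws are the
natural transformations that preserve the coordinates. -/
def IsUniversalGlobalGroupLaw (X : Torusᵒᵖ ⥤ CommRingCat.{u}) (e : X.obj (op circleTorus)) :
    Prop :=
  IsCoordinate X e ∧
    ∀ (Y : Torusᵒᵖ ⥤ CommRingCat.{u}) (e' : Y.obj (op circleTorus)), IsCoordinate Y e' →
      ∃! f : X ⟶ Y, (f.app (op circleTorus)).hom e = e'

/-! ### Linear topologies and completions

Here `k` is a (discrete) commutative ring, `R` a `k`-algebra and `θ` a family of `k`-algebra maps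
`R → k`. The linear topology on `R` generated by the finite products of the kernels of the `θ V` is
handled through its open ideals. -/

/-- The tensor product of two commutative `k`-algebras. -/
abbrev AlgTensor (k S T : Type u) [CommRing k] [CommRing S] [CommRing T] [Algebra k S]
    [Algebra k T] : Type u := S ⊗[k] T

section Completion

variable {Γ Γ' : Type} {k k' R R' : Type u} [CommRing k] [CommRing k'] [CommRing R] [CommRing R']
  [Algebra k R] [Algebra k' R']

/-- The ideals that are open for the topology generated by the finite products of the kernels of
the augmentations `θ V`. -/
def openIdeals (θ : Γ → R →ₐ[k] k) : Set (Ideal R) :=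
  {I | ∃ s : Multiset Γ, (s.map fun V => RingHom.ker (θ V)).prod ≤ I}

theorem ker_mem_openIdeals (θ : Γ → R →ₐ[k] k) (V : Γ) : RingHom.ker (θ V) ∈ openIdeals θ :=
  ⟨{V}, by simp⟩

/-- A ring map compatible with the augmentations is continuous. -/
theorem comap_mem_openIdeals {θ : Γ → R →ₐ[k] k} {θ' : Γ' → R' →ₐ[k'] k'} (f : R →+* R')
    (φ : Γ' → Γ) (h : ∀ V x, θ (φ V) x = 0 → θ' V (f x) = 0) {I : Ideal R'}
    (hI : I ∈ openIdeals θ') : I.comap f ∈ openIdeals θ := by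
  obtain ⟨s, hs⟩ := hI
  refine ⟨s.map φ, ?_⟩
  rw [← Ideal.map_le_iff_le_comap]
  refine le_trans ?_ hs
  clear hs
  induction s using Multiset.induction_on with
  | empty => simp
  | cons V s ih =>
    simp only [Multiset.map_cons, Multiset.prod_cons, Ideal.map_mul]
    refine Ideal.mul_mono (Ideal.map_le_iff_le_comap.2 fun x hx => ?_) ih
    exact h V x hx

variable (k)

/-- The completion `lim R/I` along a family `O` of ideals. -/
def idealCompletion (O : Set (Ideal R)) : Subalgebra k (∀ I : O, R ⧸ I.1) where
  carrier := {x | ∀ (I J : O) (h : I.1 ≤ J.1), Ideal.Quotient.factorₐ k h (x I) = x J}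
  mul_mem' := fun ha hb I J h => by simp only [Pi.mul_apply, map_mul, ha I J h, hb I J h]
  add_mem' := fun ha hb I J h => by simp only [Pi.add_apply, map_add, ha I J h, hb I J h]
  algebraMap_mem' := fun _ _ _ _ => rfl

/-- The canonical map `R → lim R/I`. -/
def toIdealCompletion (O : Set (Ideal R)) : R →ₐ[k] idealCompletion k O where
  toFun x := ⟨fun I => Ideal.Quotient.mk I.1 x, fun _ _ _ => rfl⟩
  map_one' := rfl
  map_mul' _ _ := rfl
  map_zero' := rfl
  map_add' _ _ := rfl
  commutes' _ := rfl

/-- The completed tensor product `R ⊗̂ R = lim (R/I) ⊗[k] (R/J)`, the limit being over all pairs of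
ideals `I, J` in `O` (the open ideals of `R`). -/
def completedTensor (O : Set (Ideal R)) :
    Subalgebra k (∀ p : O × O, AlgTensor k (R ⧸ p.1.1) (R ⧸ p.2.1)) where
  carrier := {x | ∀ (p q : O × O) (h₁ : p.1.1 ≤ q.1.1) (h₂ : p.2.1 ≤ q.2.1),
    Algebra.TensorProduct.map (Ideal.Quotient.factorₐ k h₁) (Ideal.Quotient.factorₐ k h₂) (x p)
      = x q}
  mul_mem' := fun ha hb p q h₁ h₂ => by
    simp only [Pi.mul_apply, map_mul, ha p q h₁ h₂, hb p q h₁ h₂]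
  add_mem' := fun ha hb p q h₁ h₂ => by
    simp only [Pi.add_apply, map_add, ha p q h₁ h₂, hb p q h₁ h₂]
  algebraMap_mem' := fun r p q h₁ h₂ => by
    simp only [Pi.algebraMap_apply, AlgHom.commutes]

/-- The projection `R ⊗̂ R → (R/I) ⊗[k] (R/J)`. -/
def completedTensorProj {O : Set (Ideal R)} (I J : O) :
    completedTensor k O →ₐ[k] AlgTensor k (R ⧸ I.1) (R ⧸ J.1) :=
  (Pi.evalAlgHom k (fun p : O × O => AlgTensor k (R ⧸ p.1.1) (R ⧸ p.2.1)) (I, J)).comp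
    (completedTensor k O).val

end Completion

/-! ### Equivariant formal group laws -/

/-- A formal group law over `k`, equivariant for the abelian compact Lie group with character
group `Γ` (the definition depends on the group only through its characters; the trivial character
is `1`). The topology on `R` is the one generated by finite products of kernels of the maps `θ V`;
`Δ` is a continuous `k`-algebra map to `R ⊗̂ R`, and identities in completed tensor products are
stated componentwise, for all open ideals. -/
structure EquivariantFGL (Γ : Type) [CommGroup Γ] (k : Type u) [CommRing k] : Type (u + 1) where
  R : Type u
  [commRing : CommRing R]
  [algebra : Algebra k R]
  /-- the augmentations, i.e. the components of `R → k^Γ` -/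
  θ : Γ → R →ₐ[k] k
  /-- the comultiplication -/
  Δ : R →ₐ[k] completedTensor k (openIdeals θ)
  /-- the orientation `y(ε)` -/
  y : R
  /-- `R` is complete (and separated) -/
  complete : Function.Bijective (toIdealCompletion k (openIdeals θ))
  /-- `Δ` is continuous for the inverse limit topology on `R ⊗̂ R` -/
  continuous_comul : ∀ I J : openIdeals θ,
    RingHom.ker ((completedTensorProj k I J).comp Δ) ∈ openIdeals θ
  /-- cocommutativity -/
  cocomm : ∀ (I J : openIdeals θ) (x : R),
    Algebra.TensorProduct.comm k _ _ (completedTensorProj k I J (Δ x)) =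
      completedTensorProj k J I (Δ x)
  /-- coassociativity `(Δ ⊗̂ id) ∘ Δ = (id ⊗̂ Δ) ∘ Δ`, in `(R/I) ⊗ (R/J) ⊗ (R/K)` for all open
  ideals `I, J, K`; the `(I, J)`-component of `Δ` factors over `R` modulo its (open) kernel. -/
  coassoc : ∀ (I J K : openIdeals θ) (x : R),
    Algebra.TensorProduct.assoc k k k _ _ _
      (Algebra.TensorProduct.map
        (Ideal.kerLiftAlg ((completedTensorProj k I J).comp Δ)) (AlgHom.id k (R ⧸ K.1))
        (completedTensorProj k ⟨_, continuous_comul I J⟩ K (Δ x))) =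
      Algebra.TensorProduct.map
        (AlgHom.id k (R ⧸ I.1)) (Ideal.kerLiftAlg ((completedTensorProj k J K).comp Δ))
        (completedTensorProj k I ⟨_, continuous_comul J K⟩ (Δ x))
  /-- counitality `(θ(ε) ⊗̂ id) ∘ Δ = id`, in `R/I` for all open ideals `I` -/
  counit : ∀ (I : openIdeals θ) (x : R),
    Algebra.TensorProduct.productMap
      ((Algebra.ofId k (R ⧸ I.1)).comp (Ideal.kerLiftAlg (θ 1))) (AlgHom.id k (R ⧸ I.1))
      (completedTensorProj k ⟨_, ker_mem_openIdeals θ 1⟩ I (Δ x)) = Ideal.Quotient.mk I.1 x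
  /-- `θ` is compatible with the coproduct: `(θ(V) ⊗̂ θ(W)) ∘ Δ = θ(VW)` -/
  aug_comul : ∀ (V W : Γ) (x : R),
    Algebra.TensorProduct.productMap (Ideal.kerLiftAlg (θ V)) (Ideal.kerLiftAlg (θ W))
      (completedTensorProj k ⟨_, ker_mem_openIdeals θ V⟩ ⟨_, ker_mem_openIdeals θ W⟩ (Δ x)) =
      θ (V * W) x
  /-- the orientation is regular -/
  regular : y ∈ nonZeroDivisors R
  /-- the orientation generates the augmentation ideal -/
  ker_aug : RingHom.ker (θ 1) = Ideal.span {y}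

namespace EquivariantFGL

attribute [instance] commRing algebra

variable {Γ Γ' : Type} [CommGroup Γ] [CommGroup Γ']
variable {k k' : Type u} [CommRing k] [CommRing k']

/-- The component `R → (R/I) ⊗ (R/J)` of the comultiplication. -/
def comul (F : EquivariantFGL Γ k) (I J : openIdeals F.θ) :
    F.R →ₐ[k] AlgTensor k (F.R ⧸ I.1) (F.R ⧸ J.1) :=
  (completedTensorProj k I J).comp F.Δ

/-- The Euler class `e_V = θ(V)(y(ε)) ∈ k`. -/
def euler (F : EquivariantFGL Γ k) (V : Γ) : k := F.θ V F.y

/-- Morphisms of equivariant formal group laws (for a fixed group, with varying ground ring): pairs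
of ring maps `k → k'` and `R → R'` preserving all the structure. Continuity is automatic. -/
structure Hom (F : EquivariantFGL Γ k) (F' : EquivariantFGL Γ k') where
  base : k →+* k'
  toRingHom : F.R →+* F'.R
  map_algebraMap : toRingHom.comp (algebraMap k F.R) = (algebraMap k' F'.R).comp base
  map_aug : ∀ V x, F'.θ V (toRingHom x) = base (F.θ V x)
  map_orientation : toRingHom F.y = F'.y
  /-- `Δ' ∘ f = (f ⊗̂ f) ∘ Δ` -/
  map_comul : ∀ (I J : openIdeals F'.θ) (x : F.R),
    have c (I : openIdeals F'.θ) : I.1.comap toRingHom ∈ openIdeals F.θ :=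
      comap_mem_openIdeals toRingHom id
        (fun V _ hx => by rw [map_aug]; exact (congrArg base hx).trans (map_zero base)) I.2
    have a (I : openIdeals F'.θ) :
        (Ideal.quotientMap I.1 toRingHom le_rfl).comp
          (algebraMap k (F.R ⧸ I.1.comap toRingHom)) = (algebraMap k' (F'.R ⧸ I.1)).comp base :=
      RingHom.ext fun r => congrArg (Ideal.Quotient.mk I.1) (DFunLike.congr_fun map_algebraMap r)
    F'.comul I J (toRingHom x) =
      Algebra.TensorProduct.mapRingHom base (Ideal.quotientMap I.1 toRingHom le_rfl)
        (Ideal.quotientMap J.1 toRingHom le_rfl) (a I) (a J)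
        (F.comul ⟨_, c I⟩ ⟨_, c J⟩ x)

/-- `F` is the universal equivariant formal group law (for the given group), i.e. the initial
object. Its ground ring is the equivariant Lazard ring. -/
def IsUniversal (F : EquivariantFGL Γ k) : Prop :=
  ∀ (k' : Type u) [CommRing k'] (F' : EquivariantFGL Γ k'), Nonempty (Unique (F.Hom F'))

/-- `Pushforward φ F G` exhibits `G` as the pushforward `α_* F` of `F` along a homomorphism `α` of
groups that is given on characters by `φ = α^*`. It has the same ground ring; its algebra is the
completion of `R` at finite products of kernels of the augmentations `θ (φ V)`; the augmentations
are induced by the `θ (φ V)`; the orientation is the image of the orientation of `F`; and the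
comultiplication is the completion of the comultiplication of `F`, i.e. agrees with
it on the (dense) image of `R`. -/
structure Pushforward (φ : Γ' →* Γ) (F : EquivariantFGL Γ k) (G : EquivariantFGL Γ' k) where
  equiv : idealCompletion k (openIdeals fun V => F.θ (φ V)) ≃ₐ[k] G.R
  aug_eq : ∀ (V : Γ') (x : idealCompletion k (openIdeals fun V => F.θ (φ V))),
    G.θ V (equiv x) = Ideal.kerLiftAlg (F.θ (φ V))
      (x.1 ⟨RingHom.ker (F.θ (φ V)), ker_mem_openIdeals (fun V => F.θ (φ V)) V⟩)
  orientation_eq : G.y = equiv (toIdealCompletion k _ F.y)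
  comul_eq : ∀ (I J : openIdeals G.θ) (x : F.R),
    let f : F.R →ₐ[k] G.R := equiv.toAlgHom.comp (toIdealCompletion k _)
    have c (I : openIdeals G.θ) : I.1.comap f.toRingHom ∈ openIdeals F.θ :=
      comap_mem_openIdeals f.toRingHom φ (fun V _ hx => (aug_eq V _).trans hx) I.2
    G.comul I J (f x) =
      Algebra.TensorProduct.map (Ideal.quotientMapₐ I.1 f le_rfl) (Ideal.quotientMapₐ J.1 f le_rfl)
        (F.comul ⟨_, c I⟩ ⟨_, c J⟩ x)

end EquivariantFGL

/-! ### The global Lazard ring -/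

/-- The global Lazard ring `A ↦ L_A`, for a choice of universal `A`-equivariant formal group
laws: `L_A` is the ground ring of the universal `A`-equivariant formal group law, and for
`α : B → A` the map `α^* : L_A → L_B` is the one that underlies the unique morphism from the
universal `A`-equivariant formal group law to the pushforward along `α` of the universal
`B`-equivariant one. -/
structure GlobalLazardRing : Type (u + 1) where
  L : AbCompactLieGroupᵒᵖ ⥤ CommRingCat.{u}
  fgl : ∀ A : AbCompactLieGroup, EquivariantFGL A.Char (L.obj (op A))
  isUniversal : ∀ A, (fgl A).IsUniversal
  map_eq : ∀ {B A : AbCompactLieGroup} (α : B →ₜ* A),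
    ∃ G : EquivariantFGL A.Char (L.obj (op B)),
      Nonempty (EquivariantFGL.Pushforward (charMap α) (fgl B) G) ∧
      ∃ h : (fgl A).Hom G, h.base = (L.map (ofHom α).op).hom

namespace GlobalLazardRing

/-- The Euler class `e_V ∈ L_A` of a character `V` of `A`. -/
def euler (𝓛 : GlobalLazardRing.{u}) {A : AbCompactLieGroup} (V : A.Char) : 𝓛.L.obj (op A) :=
  (𝓛.fgl A).euler V

/-- The universal Euler class `e = e_τ ∈ L_𝕋`. -/
def e (𝓛 : GlobalLazardRing.{u}) : 𝓛.L.obj (op circle) := 𝓛.euler tau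

end GlobalLazardRing

end

open CategoryTheory Opposite
open scoped TensorProduct Manifold ContDiff

universe v w

noncomputable section

open AbCompactLieGroup

/-! ### Lifting characters -/

section Lift

variable {G : Type*} [CommGroup G] [TopologicalSpace G] {E : Type*} [NormedAddCommGroup E]
  [NormedSpace ℝ E]

/-! The argument replaces comultiplications by functors of points. For an equivariant formal group
law `F` over `k`, with algebra `R`, the ring homomorphisms `R → K` over `k → K` with open kernel
form a commutative monoid, naturally in `K`, and the augmentations are a homomorphic image of the
character group in it. Conversely such a natural monoid structure gives back the comultiplication
(`EquivariantFGL.points`, `EquivariantFGL.ofPoints`). Points are automatically invertible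
(`PointMonoid.exists_inverse`), so translations exist, and every `ker θ(V)` is generated by a
regular element, a translate of `y`. This gives the pushforwards.

From formal group laws to global group laws: to a torus `T` assign the natural functions on
homomorphisms from `T^*` to the points of `F`. Division by `y`, applied to a universal point, shows
that this is a global group law (`isCoordinate_pointCoordinate`).

From global group laws to formal group laws: given `X`, a torus `B` and a surjection `φ` from `B^*`
to a character group, take as ground ring `X(B)` modulo the Euler classes of the characters in the
kernel of `φ`, and as algebra the completion of the corresponding quotient of `X(B × 𝕋)` along the
graphs of the characters of `B`. Modulo products of Euler classes of graphs, `X(C × 𝕋)` is the base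
change of `X(B × 𝕋)` to `X(C)` for every torus `C` over `B` (`existsUnique_torus_lift`). Hence
finitely many points can be realized simultaneously by characters of one torus over `B`, and points
are multiplied by multiplying these characters (`LawQuotient.mul_pt`).

An initial global group law exists: in the product of all global group laws take the families that
are values of formal expressions in Euler classes, ring operations, restrictions and divisions by
Euler classes; there is only a set of expressions. The second construction applied to it yields the
universal equivariant law (`LawQuotient.isUniversal_law`). Morphisms to `F` come from initiality,
evaluated in the natural functions on the points of `F`; they are unique because evaluations of the
initial global group law are unique.

Therefore `L_A` is the initial global group law at `T` modulo the `e_V` with `V` trivial on `A`,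
whenever `A → T` is a homomorphism to a torus that is surjective on characters. Such a `T` exists
because character groups are finitely generated. If `A = T`, only `e_1 = 0` is killed, so both sides
agree on tori. For general `A`, the presentation says exactly that `L` is the left Kan extension of
its restriction to tori, since a character that is trivial on `A` factors there through the trivial
torus, where the Euler class vanishes. Regularity of `e_V` then follows from the exactness axiom. -/

theorem exists_charLift {j : E → G} (hj : Continuous j) (hj0 : j 0 = 1) (V : G →ₜ* Circle) :
    ∃ g : C(E, ℝ), g 0 = 0 ∧ ∀ x, Circle.exp (g x) = V (j x) := by
  obtain ⟨g, ⟨h0, h⟩, -⟩ := Circle.isCoveringMap_exp.existsUnique_continuousMap_lifts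
    (⟨fun x => V (j x), (map_continuous V).comp hj⟩ : C(E, Circle)) 0 0 (by simp [hj0])
  exact ⟨g, h0, fun x => congrFun h x⟩

/-- The continuous logarithm of a character along a parametrization. -/
def charLift {j : E → G} (hj : Continuous j) (hj0 : j 0 = 1) (V : G →ₜ* Circle) : C(E, ℝ) :=
  (exists_charLift hj hj0 V).choose

variable {j : E → G} (hj : Continuous j) (hj0 : j 0 = 1)

theorem charLift_zero (V : G →ₜ* Circle) : charLift hj hj0 V 0 = 0 :=
  (exists_charLift hj hj0 V).choose_spec.1

theorem exp_charLift (V : G →ₜ* Circle) (x : E) : Circle.exp (charLift hj hj0 V x) = V (j x) :=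
  (exists_charLift hj hj0 V).choose_spec.2 x

/-- Both sides are continuous lifts of the same map through the covering `Circle.exp` and agree at
`0`; `E` is connected, so they coincide. The same uniqueness principle is used for all logarithms
below. -/
theorem charLift_mul (V W : G →ₜ* Circle) (x : E) :
    charLift hj hj0 (V * W) x = charLift hj hj0 V x + charLift hj hj0 W x := by
  refine congrFun (Circle.isCoveringMap_exp.eq_of_comp_eq
    (g₁ := charLift hj hj0 (V * W)) (g₂ := fun x => charLift hj hj0 V x + charLift hj hj0 W x)
    (map_continuous _) (by fun_prop) (funext fun x => ?_) 0 (by simp [charLift_zero])) x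
  simp [exp_charLift, Circle.exp_add]

end Lift

/-! ### Characters of the circle -/

/-- Continuous endomorphisms of the circle are powers. -/
theorem Circle.exists_eq_zpow (V : Circle →ₜ* Circle) : ∃ n : ℤ, ∀ z, V z = z ^ n := by
  have hc : Continuous (Circle.exp : ℝ → Circle) := Circle.exp.continuous
  set g := charLift hc Circle.exp_zero V
  have hg : ∀ x, Circle.exp (g x) = V (Circle.exp x) := exp_charLift hc Circle.exp_zero V
  have hg0 : g 0 = 0 := charLift_zero hc Circle.exp_zero V
  have hadd : ∀ x y, g (x + y) = g x + g y := fun x y => by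
    refine congrFun (Circle.isCoveringMap_exp.eq_of_comp_eq
      (g₁ := fun y => g (x + y)) (g₂ := fun y => g x + g y) (by fun_prop) (by fun_prop)
      (funext fun y => ?_) 0 (by simp [hg0])) y
    simp [hg, Circle.exp_add]
  let l := AddMonoidHom.toRealLinearMap ⟨⟨g, hg0⟩, hadd⟩ (map_continuous g)
  have hl : ∀ x, g x = x * g 1 := fun x => by
    have : l (x • (1 : ℝ)) = x • l 1 := map_smul l x 1
    rwa [smul_eq_mul, mul_one, smul_eq_mul] at this
  -- The exponent is the winding number: the linear lift `g` sends the period `2π` into `2πℤ`.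
  obtain ⟨n, hn⟩ := Circle.exp_eq_one.1
    ((hg (2 * Real.pi)).trans (by rw [Circle.exp_two_pi, map_one]))
  rw [hl, mul_comm] at hn
  have hn1 : g 1 = n := mul_right_cancel₀ (by positivity) hn
  refine ⟨n, fun z => ?_⟩
  obtain ⟨x, rfl⟩ : ∃ x, Circle.exp x = z := ⟨_, Circle.exp_arg z⟩
  rw [← hg, hl, hn1, mul_comm]
  rw [← zsmul_eq_mul, Circle.exp_zsmul]

/-! ### Finite generation of character groups -/

section FG

variable {G : Type*} [CommGroup G] {E : Type*} [NormedAddCommGroup E]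

/-- The functions on the unit ball that behave like logarithms of characters, for the
parametrization `j` of a neighbourhood of the identity. -/
def localCharacters (j : E → G) (ε : ℝ) :
    Submodule ℝ (BoundedContinuousFunction (Metric.closedBall (0 : E) 1) ℝ) where
  carrier := {ψ | ∀ x x' v : Metric.closedBall (0 : E) 1, ‖v.1‖ < ε →
    j x * j v = j x' → ψ x' = ψ x + ψ v}
  zero_mem' := by simp
  add_mem' h h' x x' v hv e := by
    simp only [BoundedContinuousFunction.coe_add, Pi.add_apply, h x x' v hv e, h' x x' v hv e]
    ring
  smul_mem' c ψ h x x' v hv e := by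
    simp only [BoundedContinuousFunction.coe_smul, h x x' v hv e, smul_add]

variable {j : E → G} {ε : ℝ}

theorem isClosed_localCharacters :
    IsClosed (SetLike.coe (localCharacters j ε)) := by
  have : SetLike.coe (localCharacters j ε) =
      ⋂ (x : Metric.closedBall (0 : E) 1) (x' : Metric.closedBall (0 : E) 1)
        (v : Metric.closedBall (0 : E) 1) (_ : ‖v.1‖ < ε) (_ : j x * j v = j x'),
        {ψ | ψ x' = ψ x + ψ v} := by
    ext ψ
    simp [localCharacters]
  rw [this]
  refine isClosed_iInter fun x => isClosed_iInter fun x' => isClosed_iInter fun v =>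
    isClosed_iInter fun _ => isClosed_iInter fun _ => isClosed_eq ?_ ?_
  · exact continuous_eval_const x'
  · exact (continuous_eval_const x).add (continuous_eval_const v)

/-- While the powers `v, v², …, v^N` stay in the parametrized ball, additivity gives `ψ(v^N) = N
ψ(v)`. A function bounded by `1` is then at most `1 / N` at `v`, which is the estimate behind
equicontinuity. -/
theorem localCharacters_pow {ψ : BoundedContinuousFunction (Metric.closedBall (0 : E) 1) ℝ}
    (hψ : ψ ∈ localCharacters j ε) (hj0 : j 0 = 1) (hε : 0 < ε)
    {N : ℕ} {v : Metric.closedBall (0 : E) 1} (hv : ‖v.1‖ < ε)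
    (h : ∀ i ≤ N, ∃ w : Metric.closedBall (0 : E) 1, j w = j v ^ i) :
    ∃ w, ψ w = N * ψ v := by
  suffices H : ∀ i ≤ N, ∃ w : Metric.closedBall (0 : E) 1, j w = j v ^ i ∧ ψ w = i * ψ v by
    obtain ⟨w, -, hw⟩ := H N le_rfl
    exact ⟨w, hw⟩
  intro i
  induction i with
  | zero =>
    intro _
    let o : Metric.closedBall (0 : E) 1 := ⟨0, by simp⟩
    -- Additivity for `1 * 1 = 1` reads `ψ(0) = ψ(0) + ψ(0)`.
    have := hψ o o o (by simpa [o] using hε) (by simp [o, hj0])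
    exact ⟨o, by simp [o, hj0], by simpa using this⟩
  | succ i ih =>
    intro hi
    obtain ⟨w, hw, hw'⟩ := ih (by omega)
    obtain ⟨w', hw''⟩ := h (i + 1) hi
    refine ⟨w', hw'', ?_⟩
    rw [hψ w w' v hv (by rw [hw, hw'', pow_succ]), hw']
    push_cast
    ring

/-- By Riesz it suffices that the closed unit ball is compact. It is closed and bounded, and it is
equicontinuous because approximate logarithms that are bounded by `1` are uniformly small near the
identity; Arzelà–Ascoli applies. -/
theorem finiteDimensional_localCharacters [TopologicalSpace G] [IsTopologicalGroup G]
    [NormedSpace ℝ E] [FiniteDimensional ℝ E] (hj : Topology.IsOpenEmbedding j)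
    (hj0 : j 0 = 1) (hε : 0 < ε) (hε1 : ε ≤ 1) :
    FiniteDimensional ℝ (localCharacters j ε) := by
  have : CompactSpace (Metric.closedBall (0 : E) 1) :=
    isCompact_iff_compactSpace.1 (isCompact_closedBall 0 1)
  refine FiniteDimensional.of_isCompact_closedBall ℝ 
    (V := localCharacters j ε) (r := 1) one_pos (c := 0) ?_
  rw [Subtype.isCompact_iff]
  set A : Set (BoundedContinuousFunction (Metric.closedBall (0 : E) 1) ℝ) :=
    Subtype.val '' Metric.closedBall (0 : localCharacters j ε) 1
  have hA : A = (localCharacters j ε : Set _) ∩ Metric.closedBall 0 1 := by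
    ext ψ
    simp [A, and_comm]
  have hA' : ∀ ψ ∈ A, ψ ∈ localCharacters j ε ∧ ‖ψ‖ ≤ 1 := fun ψ hψ => by
    rw [hA] at hψ
    exact ⟨hψ.1, by simpa using hψ.2⟩
  refine BoundedContinuousFunction.arzela_ascoli₂ (Metric.closedBall 0 1)
    (isCompact_closedBall 0 1) A (hA ▸ isClosed_localCharacters.inter Metric.isClosed_closedBall)
    (fun ψ x hψ => ?_) fun x₀ => ?_
  · rw [mem_closedBall_zero_iff]
    exact (ψ.norm_coe_le_norm x).trans (hA' ψ hψ).2
  · rw [Metric.equicontinuousAt_iff_right]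
    intro δ hδ
    obtain ⟨N, hN⟩ := exists_nat_gt (1 / δ)
    have hN0 : (0 : ℝ) < N := (by positivity : (0 : ℝ) < 1 / δ).trans hN
    have hU : j '' Metric.ball 0 ε ∈ nhds (1 : G) :=
      (hj.isOpenMap _ Metric.isOpen_ball).mem_nhds ⟨0, by simpa using hε, hj0⟩
    -- For `x` near `x₀` the first `N` powers of `(j x₀)⁻¹ * j x` remain in the chart. With `N > 1 /
    -- δ` this makes `|ψ x - ψ x₀| < δ` for all `ψ` in the unit ball at once.
    have hW : ∀ᶠ w in nhds (1 : G), ∀ i ∈ Finset.range (N + 1), w ^ i ∈ j '' Metric.ball 0 ε := by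
      rw [Filter.eventually_all_finset]
      intro i _
      exact (continuous_pow i).continuousAt (by simpa using hU)
    have hW' : ∀ᶠ w in nhds (1 : G), w ∈ j '' Metric.ball 0 ε := hU
    have hcont : Filter.Tendsto (fun x : Metric.closedBall (0 : E) 1 => (j x₀)⁻¹ * j x)
        (nhds x₀) (nhds 1) := by
      have : Continuous fun x : Metric.closedBall (0 : E) 1 => (j x₀)⁻¹ * j x :=
        continuous_const.mul (hj.continuous.comp continuous_subtype_val)
      simpa using this.tendsto x₀
    filter_upwards [hcont.eventually hW, hcont.eventually hW'] with x hx hx' ψ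
    obtain ⟨v, hv, hjv⟩ := hx'
    rw [mem_ball_zero_iff] at hv
    let v' : Metric.closedBall (0 : E) 1 := ⟨v, by simpa using (hv.trans_le hε1).le⟩
    have h1 : ψ.1 x = ψ.1 x₀ + ψ.1 v' :=
      (hA' ψ.1 ψ.2).1 x₀ x v' hv (by simp [v', hjv])
    obtain ⟨w, hw⟩ := localCharacters_pow (hA' ψ.1 ψ.2).1 hj0 hε (N := N) (v := v') hv
      fun i hi => by
        obtain ⟨w, hw, hw'⟩ := hx i (Finset.mem_range.2 (by omega))
        rw [mem_ball_zero_iff] at hw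
        exact ⟨⟨w, by simpa using (hw.trans_le hε1).le⟩, by rw [hw', ← hjv]⟩
    have h2 : |(N : ℝ) * ψ.1 v'| ≤ 1 := by
      rw [← hw]
      exact (ψ.1.norm_coe_le_norm w).trans (hA' ψ.1 ψ.2).2
    rw [h1, dist_self_add_right, Real.norm_eq_abs]
    rw [abs_mul, Nat.abs_cast] at h2
    rw [div_lt_iff₀ hδ] at hN
    by_contra! hcon
    have : (N : ℝ) * δ ≤ N * |ψ.1 v'| := by gcongr
    linarith

end FG

section FG

variable {G : Type*} [CommGroup G] [TopologicalSpace G] [IsTopologicalGroup G]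
  {E : Type*} [NormedAddCommGroup E] [NormedSpace ℝ E] {j : E → G} {ε : ℝ}

/-- On the convex set of pairs `(x, v)`, both `g(j⁻¹(j x * j v))` and `g x + g v` lift the value of
the character at `j x * j v`, and they agree at `(0, 0)`. Thus logarithms of characters lie in
`localCharacters`. -/
theorem charLift_mul_param (hj : Topology.IsOpenEmbedding j) (hj0 : j 0 = 1) (hε : 0 < ε)
    (hU : ∀ x ∈ Metric.closedBall (0 : E) 1, ∀ v ∈ Metric.ball (0 : E) ε,
      j x * j v ∈ Set.range j) (V : G →ₜ* Circle) {x v x' : E} (hx : ‖x‖ ≤ 1) (hv : ‖v‖ < ε)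
    (h : j x * j v = j x') :
    charLift hj.continuous hj0 V x' =
      charLift hj.continuous hj0 V x + charLift hj.continuous hj0 V v := by
  set g := charLift hj.continuous hj0 V
  let s : Set (E × E) := Metric.closedBall 0 1 ×ˢ Metric.ball 0 ε
  let ι := (hj.toOpenPartialHomeomorph j).symm
  have hι : ∀ x, ι (j x) = x := fun x =>
    (hj.toOpenPartialHomeomorph j).left_inv (by simp)
  have hs : IsPreconnected s :=
    ((convex_closedBall (0 : E) 1).prod (convex_ball (0 : E) ε)).isPreconnected
  have hc : ContinuousOn (fun p : E × E => g (ι (j p.1 * j p.2))) s := by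
    refine (map_continuous g).comp_continuousOn (ContinuousOn.comp (t := Set.range j) ?_ ?_ ?_)
    · simpa using (hj.toOpenPartialHomeomorph j).continuousOn_symm
    · have := hj.continuous
      fun_prop
    · rintro ⟨x, v⟩ ⟨hx, hv⟩
      exact hU x hx v hv
  have := Circle.isCoveringMap_exp.eqOn_of_comp_eqOn hs hc
    (g₂ := fun p : E × E => g p.1 + g p.2) (by fun_prop) (by
      rintro ⟨x, v⟩ ⟨hx, hv⟩
      obtain ⟨x', hx'⟩ := hU x hx v hv
      simp only [Function.comp_apply, ← hx', hι, Circle.exp_add]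
      simp only [g, exp_charLift, hx', map_mul]) (a := (0, 0)) (by simpa [s] using hε)
      (by
        have : ι 1 = 0 := by rw [← hj0, hι]
        have h0 : g 0 = 0 := charLift_zero hj.continuous hj0 V
        simp [hj0, this, h0])
  have := this (x := (x, v)) ⟨by simpa using hx, by simpa using hv⟩
  simpa only [h, hι] using this

/-- A connected-component argument: a character whose logarithm is uniformly small near the
identity is trivial on the subgroup generated by a neighbourhood of the identity. -/
theorem exists_bound_eq_one [CompactSpace G] {N : Type*} (nrm : N → ℝ) (χ : N → G →ₜ* Circle)
    {K : Set G} (hK : K ∈ nhds (1 : G))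
    (hχ : ∀ V, ∀ a ∈ K, ∃ t : ℝ, |t| ≤ nrm V ∧ Circle.exp t = χ V a) :
    ∃ δ > 0, ∀ V, nrm V < δ → ∀ a ∈ Subgroup.closure K, χ V a = 1 := by
  have hnn : ∀ V, 0 ≤ nrm V := fun V =>
    let ⟨t, ht, _⟩ := hχ V 1 (mem_of_mem_nhds hK)
    (abs_nonneg t).trans ht
  -- The property asks for logarithms on `s` bounded by a constant times `nrm V`, with a constant
  -- independent of the character. It passes to products and inverses, hence holds at each point of
  -- the generated subgroup; translating `K` extends it to neighbourhoods, and compactness makes it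
  -- global.
  let p : Set G → Prop := fun s => ∃ C : ℝ, ∀ V, ∀ a ∈ s, ∃ t : ℝ, |t| ≤ C * nrm V ∧
    Circle.exp t = χ V a
  have hopen : IsOpen (Subgroup.closure K : Set G) :=
    Subgroup.isOpen_of_mem_nhds _ (g := 1) (Filter.mem_of_superset hK Subgroup.subset_closure)
  have hcpt : IsCompact (Subgroup.closure K : Set G) :=
    (Subgroup.isClosed_of_isOpen _ hopen).isCompact
  have hpt : ∀ a ∈ Subgroup.closure K, p {a} := by
    intro a ha
    induction ha using Subgroup.closure_induction with
    | mem a ha => exact ⟨1, by rintro V _ rfl; simpa using hχ V _ ha⟩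
    | one => exact ⟨0, by rintro V _ rfl; exact ⟨0, by simp⟩⟩
    | mul a b _ _ iha ihb =>
      obtain ⟨C, hC⟩ := iha
      obtain ⟨D, hD⟩ := ihb
      refine ⟨C + D, ?_⟩
      rintro V _ rfl
      obtain ⟨t, ht, ht'⟩ := hC V a rfl
      obtain ⟨s, hs, hs'⟩ := hD V b rfl
      refine ⟨t + s, ?_, by rw [Circle.exp_add, ht', hs', map_mul]⟩
      calc |t + s| ≤ |t| + |s| := abs_add_le _ _
        _ ≤ _ := by rw [add_mul]; exact add_le_add ht hs
    | inv a _ iha =>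
      obtain ⟨C, hC⟩ := iha
      refine ⟨C, ?_⟩
      rintro V _ rfl
      obtain ⟨t, ht, ht'⟩ := hC V a rfl
      exact ⟨-t, by rwa [abs_neg], by rw [Circle.exp_neg, ht', map_inv]⟩
  have hp : p (Subgroup.closure K : Set G) := by
    refine hcpt.induction_on (p := p) ⟨0, by simp⟩ ?_ ?_ ?_
    · rintro s t hst ⟨C, hC⟩
      exact ⟨C, fun V a ha => hC V a (hst ha)⟩
    · rintro s t ⟨C, hC⟩ ⟨D, hD⟩
      refine ⟨max C D, fun V a ha => ?_⟩
      rcases ha with ha | ha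
      · obtain ⟨t, ht, ht'⟩ := hC V a ha
        exact ⟨t, ht.trans (mul_le_mul_of_nonneg_right (le_max_left _ _) (hnn V)), ht'⟩
      · obtain ⟨t, ht, ht'⟩ := hD V a ha
        exact ⟨t, ht.trans (mul_le_mul_of_nonneg_right (le_max_right _ _) (hnn V)), ht'⟩
    · intro a ha
      refine ⟨{b | a⁻¹ * b ∈ K}, mem_nhdsWithin_of_mem_nhds ?_, ?_⟩
      · exact (continuous_const_mul a⁻¹).continuousAt (by simpa using hK)
      · obtain ⟨C, hC⟩ := hpt a ha
        refine ⟨C + 1, fun V b hb => ?_⟩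
        obtain ⟨t, ht, ht'⟩ := hC V a rfl
        obtain ⟨s, hs, hs'⟩ := hχ V _ hb
        refine ⟨t + s, ?_, by rw [Circle.exp_add, ht', hs', ← map_mul, mul_inv_cancel_left]⟩
        calc |t + s| ≤ |t| + |s| := abs_add_le _ _
          _ ≤ _ := by rw [add_mul, one_mul]; exact add_le_add ht hs
  obtain ⟨C, hC⟩ := hp
  -- With this bound all powers of `χ V a` have logarithms smaller than `π / 2`. An element of the
  -- circle whose powers all stay in that arc is trivial.
  refine ⟨Real.pi / 2 / (|C| + 1), by positivity, fun V hV a ha => ?_⟩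
  refine Circle.eq_one_of_forall_pow_mem_centeredArc_pi_div_two fun n _ => ?_
  obtain ⟨t, ht, ht'⟩ := hC V (a ^ n) (pow_mem ha n)
  refine ⟨t, ?_, by rw [ht', map_pow]⟩
  rw [lt_div_iff₀ (by positivity)] at hV
  calc |t| ≤ C * nrm V := ht
    _ ≤ nrm V * (|C| + 1) := by nlinarith [hnn V, le_abs_self C]
    _ < _ := hV

/-- The characters that are trivial on an open subgroup of a compact group are finite in number. -/
theorem finite_characters_eq_one [CompactSpace G] (H : Subgroup G) (hH : IsOpen (H : Set G)) :
    {V : G →ₜ* Circle | ∀ a ∈ H, V a = 1}.Finite := by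
  have := H.quotient_finite_of_isOpen hH
  have : DiscreteTopology (G ⧸ H) := QuotientGroup.discreteTopology hH
  have : Finite (PontryaginDual (G ⧸ H)) := inferInstance
  let f : PontryaginDual (G ⧸ H) → (G →ₜ* Circle) := fun V =>
    { toMonoidHom := (V : G ⧸ H →* Circle).comp (QuotientGroup.mk' H)
      continuous_toFun := (map_continuous V).comp continuous_quot_mk }
  refine (Set.finite_range f).subset fun V hV => ?_
  refine ⟨{ toMonoidHom := QuotientGroup.lift H V.toMonoidHom hV
            continuous_toFun := continuous_of_discreteTopology }, ?_⟩
  rfl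

/-- The image is a discrete subgroup of a finite-dimensional real vector space, hence finitely
generated, and the kernel is finite. -/
theorem finite_of_map_discrete {M H : Type*} [AddCommGroup M] [NormedAddCommGroup H]
    [NormedSpace ℝ H] [FiniteDimensional ℝ H] (Φ : M →+ H) {δ : ℝ} (hδ : 0 < δ)
    (h : ∀ x, ‖Φ x‖ < δ → Φ x = 0) (hfin : {x | Φ x = 0}.Finite) : Module.Finite ℤ M := by
  let Ψ : M →ₗ[ℤ] H := Φ.toIntLinearMap
  have hdisc : DiscreteTopology (LinearMap.range Ψ) := by
    refine discreteTopology_of_isOpen_singleton_zero ?_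
    rw [Metric.isOpen_singleton_iff]
    refine ⟨δ, hδ, ?_⟩
    rintro ⟨_, x, rfl⟩ hx
    have hx' : ‖Ψ x‖ < δ := by simpa [dist_eq_norm] using hx
    exact Subtype.ext (h x hx')
  have hrange : (LinearMap.range Ψ).FG := (Module.Finite.iff_fg).1 inferInstance
  refine ⟨Submodule.fg_of_fg_map_of_fg_inf_ker Ψ ?_ ?_⟩
  · rwa [Submodule.map_top]
  · rw [top_inf_eq]
    have : Finite (LinearMap.ker Ψ) := hfin
    exact (Module.Finite.iff_fg).1 inferInstance

/-- The character group of a compact abelian Lie group is finitely generated. -/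
theorem finite_characters [CompactSpace G] [FiniteDimensional ℝ E]
    (hj : Topology.IsOpenEmbedding j) (hj0 : j 0 = 1) :
    Module.Finite ℤ (Additive (G →ₜ* Circle)) := by
  -- By compactness the image of the closed unit ball can be multiplied by a fixed neighbourhood of
  -- `1` without leaving the chart. This fixes the radius `ε`.
  obtain ⟨U, hU, hKU⟩ := compact_open_separated_mul_right
    ((isCompact_closedBall (0 : E) 1).image hj.continuous) hj.isOpen_range
    (Set.image_subset_range j _)
  obtain ⟨ε', hε', hU'⟩ := Metric.mem_nhds_iff.1
    (hj.continuous.continuousAt (x := 0) (hj0 ▸ hU))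
  set ε := min ε' 1
  have hε : 0 < ε := lt_min hε' one_pos
  have hU'' : ∀ x ∈ Metric.closedBall (0 : E) 1, ∀ v ∈ Metric.ball (0 : E) ε,
      j x * j v ∈ Set.range j := fun x hx v hv =>
    hKU (Set.mul_mem_mul ⟨x, hx, rfl⟩ (hU' (Metric.ball_subset_ball (min_le_left _ _) hv)))
  have : CompactSpace (Metric.closedBall (0 : E) 1) :=
    isCompact_iff_compactSpace.1 (isCompact_closedBall 0 1)
  have := finiteDimensional_localCharacters hj hj0 hε (min_le_right _ _)
  let lift (V : G →ₜ* Circle) : localCharacters j ε :=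
    ⟨BoundedContinuousFunction.mkOfCompact
      ((charLift hj.continuous hj0 V).restrict (Metric.closedBall 0 1)),
      fun x x' v hv h => charLift_mul_param hj hj0 hε hU'' V (mem_closedBall_zero_iff.1 x.2) hv h⟩
  let Φ : Additive (G →ₜ* Circle) →+ localCharacters j ε :=
    AddMonoidHom.mk' (fun V => lift V.toMul) fun V W => by
      ext x
      exact charLift_mul hj.continuous hj0 V.toMul W.toMul x
  have hK : j '' Metric.closedBall 0 1 ∈ nhds (1 : G) :=
    Filter.mem_of_superset ((hj.isOpenMap _ Metric.isOpen_ball).mem_nhds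
      ⟨0, Metric.mem_ball_self one_pos, hj0⟩) (Set.image_mono Metric.ball_subset_closedBall)
  obtain ⟨δ, hδ, hδ'⟩ := exists_bound_eq_one (fun V => ‖lift V‖) id hK (by
    rintro V _ ⟨x, hx, rfl⟩
    exact ⟨charLift hj.continuous hj0 V x, (lift V).1.norm_coe_le_norm ⟨x, hx⟩,
      exp_charLift hj.continuous hj0 V x⟩)
  -- A character that is trivial near the identity has logarithm identically `0`, since both lift
  -- `1` and vanish at `0`. Hence small logarithms are zero, and the image of `Φ` is discrete.
  have hzero : ∀ V, (∀ a ∈ Subgroup.closure (j '' Metric.closedBall 0 1), V a = 1) →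
      lift V = 0 := fun V hV => by
    ext x
    refine Circle.isCoveringMap_exp.eqOn_of_comp_eqOn (s := Metric.closedBall (0 : E) 1)
      (convex_closedBall (0 : E) 1).isPreconnected (g₁ := charLift hj.continuous hj0 V)
      (g₂ := fun _ => 0) (map_continuous _).continuousOn continuousOn_const (fun x hx => ?_)
      (a := 0) (by simp) (charLift_zero hj.continuous hj0 V) x.2
    simp only [Function.comp_apply, exp_charLift, Circle.exp_zero]
    exact hV _ (Subgroup.subset_closure ⟨x, hx, rfl⟩)
  refine finite_of_map_discrete (H := localCharacters j ε) Φ hδ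
    (fun V hV => hzero V.toMul (hδ' V.toMul hV)) ?_
  have hopen : IsOpen (Subgroup.closure (j '' Metric.closedBall 0 1) : Set G) :=
    Subgroup.isOpen_of_mem_nhds _ (g := 1) (Filter.mem_of_superset hK Subgroup.subset_closure)
  refine (finite_characters_eq_one _ hopen).subset fun V hV => hδ' V ?_
  have h0 : (lift V).1 = 0 := congrArg Subtype.val hV
  have h1 : ‖lift V‖ = ‖(lift V).1‖ := rfl
  rwa [h1, h0, norm_zero]

end FG

namespace AbCompactLieGroup

/-- `univBall` reparametrizes a ball of the chart at `1` by the whole model space, which provides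
the globally defined open embedding `j` required by `finite_characters`. -/
theorem finite_char (A : AbCompactLieGroup) : Module.Finite ℤ (Additive A.Char) := by
  obtain ⟨E, _, _, _, _, _⟩ := A.isLieGroup
  let c := chartAt E (1 : A)
  obtain ⟨r, hr, hr'⟩ := Metric.mem_nhds_iff.1
    (c.open_target.mem_nhds (c.map_source (mem_chart_source E (1 : A))))
  let b := OpenPartialHomeomorph.univBall (c 1) r
  have hb : b.target = Metric.ball (c 1) r := OpenPartialHomeomorph.univBall_target _ hr
  have hb' : b.source = Set.univ := OpenPartialHomeomorph.univBall_source _ _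
  have hj : Topology.IsOpenEmbedding (b.trans c.symm) :=
    (b.trans c.symm).isOpenEmbedding (by
      rw [OpenPartialHomeomorph.trans_source, hb', Set.univ_inter, Set.eq_univ_iff_forall]
      exact fun x => hr' (hb ▸ b.map_source (hb' ▸ Set.mem_univ x)))
  refine finite_characters hj ?_
  rw [OpenPartialHomeomorph.coe_trans, Function.comp_apply,
    OpenPartialHomeomorph.univBall_apply_zero]
  exact c.left_inv (mem_chart_source E (1 : A))

/-- The character group of an abelian compact Lie group is finitely generated. -/
theorem exists_char_generators (A : AbCompactLieGroup) :
    ∃ (n : ℕ) (V : Fin n → A.Char), Subgroup.closure (Set.range V) = ⊤ := by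
  have := A.finite_char
  obtain ⟨n, s, hs⟩ := Module.Finite.exists_fin (R := ℤ) (M := Additive A.Char)
  refine ⟨n, fun i => (s i).toMul, ?_⟩
  rw [eq_top_iff]
  intro V _
  have hV : Additive.ofMul V ∈ Submodule.span ℤ (Set.range s) := hs ▸ Submodule.mem_top
  refine Submodule.span_induction (p := fun x _ => x.toMul ∈ Subgroup.closure
    (Set.range fun i => (s i).toMul)) ?_ (one_mem _) (fun x y _ _ hx hy => mul_mem hx hy)
    (fun a x _ hx => zpow_mem hx a) hV
  rintro _ ⟨i, rfl⟩
  exact Subgroup.subset_closure ⟨i, rfl⟩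

end AbCompactLieGroup

/-! ### Products of tori -/

section ProdEquiv

variable {G G' H H' K : Type*} [Monoid G] [Monoid G'] [Monoid H] [Monoid H'] [Monoid K]
  [TopologicalSpace G] [TopologicalSpace G'] [TopologicalSpace H] [TopologicalSpace H']
  [TopologicalSpace K]

/-- The product of two isomorphisms. -/
def ContinuousMulEquiv.prodEquiv (e : G ≃ₜ* G') (f : H ≃ₜ* H') : G × H ≃ₜ* G' × H' where
  __ := MulEquiv.prodCongr e.toMulEquiv f.toMulEquiv
  continuous_toFun := e.continuous.prodMap f.continuous
  continuous_invFun := e.symm.continuous.prodMap f.symm.continuous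

variable (G H K) in
/-- Associativity of products. -/
def ContinuousMulEquiv.assocEquiv : (G × H) × K ≃ₜ* G × H × K where
  __ := MulEquiv.prodAssoc
  continuous_toFun := (Homeomorph.prodAssoc G H K).continuous
  continuous_invFun := (Homeomorph.prodAssoc G H K).symm.continuous

variable (G H) in
/-- The product with the trivial group. -/
def ContinuousMulEquiv.prodUniqueEquiv [Unique H] : G ≃ₜ* G × H where
  toFun a := (a, 1)
  invFun p := p.1
  left_inv _ := rfl
  right_inv _ := Prod.ext rfl (Subsingleton.elim _ _)
  map_mul' _ _ := Prod.ext rfl (Subsingleton.elim _ _)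
  continuous_toFun := continuous_id.prodMk continuous_const
  continuous_invFun := continuous_fst

/-- Splitting off a factor of a finite power. -/
def ContinuousMulEquiv.finSuccEquiv (n : ℕ) : (Fin (n + 1) → G) ≃ₜ* (Fin n → G) × G where
  toFun f := (fun i => f i.succ, f 0)
  invFun p := Fin.cons p.2 p.1
  left_inv f := Fin.cons_self_tail f
  right_inv _ := rfl
  map_mul' _ _ := rfl
  continuous_toFun := by fun_prop
  continuous_invFun := continuous_pi fun i => by
    refine Fin.cases ?_ (fun i => ?_) i
    · simpa using continuous_snd
    · exact (continuous_apply i).comp continuous_fst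

end ProdEquiv

namespace AbCompactLieGroup

/-- The product of two abelian compact Lie groups. -/
abbrev prod (A B : AbCompactLieGroup) : AbCompactLieGroup where
  carrier := A × B
  isLieGroup := by
    obtain ⟨E, _, _, _, _, _⟩ := A.isLieGroup
    obtain ⟨E', _, _, _, _, _⟩ := B.isLieGroup
    refine ⟨E × E', inferInstance, inferInstance, inferInstance, prodChartedSpace E A E' B, ?_⟩
    rw [modelWithCornersSelf_prod]
    exact inferInstanceAs (LieGroup (𝓘(ℝ, E).prod 𝓘(ℝ, E')) ∞ (A × B))

/-- The trivial group. -/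
abbrev unit : AbCompactLieGroup where
  carrier := PUnit
  isLieGroup := by
    let _ : ChartedSpace (Fin 0 → ℝ) PUnit := ChartedSpace.ofDiscreteTopology
    refine ⟨Fin 0 → ℝ, inferInstance, inferInstance, inferInstance, inferInstance, ?_⟩
    have : IsManifold 𝓘(ℝ, Fin 0 → ℝ) ∞ PUnit := IsManifold.of_discreteTopology _
    exact { contMDiff_mul := contMDiff_of_subsingleton, contMDiff_inv := contMDiff_of_subsingleton }

theorem nonempty_pi_prod_equiv (n m : ℕ) :
    Nonempty ((Fin n → Circle) × (Fin m → Circle) ≃ₜ* (Fin (n + m) → Circle)) := by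
  induction m with
  | zero => exact ⟨(ContinuousMulEquiv.prodUniqueEquiv _ _).symm⟩
  | succ m ih =>
    obtain ⟨e⟩ := ih
    exact ⟨((ContinuousMulEquiv.refl _).prodEquiv (ContinuousMulEquiv.finSuccEquiv m)).trans
      ((ContinuousMulEquiv.assocEquiv _ _ _).symm.trans ((e.prodEquiv (.refl Circle)).trans
        (ContinuousMulEquiv.finSuccEquiv (n + m)).symm))⟩

theorem IsTorus.prod {A B : AbCompactLieGroup} (hA : IsTorus A) (hB : IsTorus B) :
    IsTorus (A.prod B) := by
  obtain ⟨n, ⟨e⟩⟩ := hA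
  obtain ⟨m, ⟨f⟩⟩ := hB
  obtain ⟨g⟩ := nonempty_pi_prod_equiv n m
  exact ⟨n + m, ⟨(e.prodEquiv f).trans g⟩⟩

theorem isTorus_unit : IsTorus unit :=
  ⟨0, ⟨{ toFun := fun _ i => i.elim0
         invFun := fun _ => PUnit.unit
         left_inv := fun _ => rfl
         right_inv := fun _ => funext fun i => i.elim0
         map_mul' := fun _ _ => funext fun i => i.elim0
         continuous_toFun := continuous_pi fun i => i.elim0
         continuous_invFun := continuous_const }⟩⟩

end AbCompactLieGroup

namespace Torus

/-- The trivial torus. -/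
def unit : Torus := ⟨AbCompactLieGroup.unit, isTorus_unit⟩

/-- The product of two tori. -/
def prod (A B : Torus) : Torus := ⟨A.obj.prod B.obj, A.property.prod B.property⟩

instance (A : Torus) : Unique (A.obj →ₜ* unit.obj) where
  default := 1
  uniq _ := ContinuousMonoidHom.ext fun _ => rfl

instance (A : Torus) : Subsingleton (unit.obj →ₜ* A.obj) where
  allEq f g := ContinuousMonoidHom.ext fun _ => (map_one f).trans (map_one g).symm

/-- The first projection. -/
def fst (A B : Torus) : (A.prod B).obj →ₜ* A.obj := ContinuousMonoidHom.fst A.obj B.obj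

/-- The second projection. -/
def snd (A B : Torus) : (A.prod B).obj →ₜ* B.obj := ContinuousMonoidHom.snd A.obj B.obj

/-- The homomorphism to a product with given components. -/
def lift {A B C : Torus} (f : C.obj →ₜ* A.obj) (g : C.obj →ₜ* B.obj) : C.obj →ₜ* (A.prod B).obj :=
  ContinuousMonoidHom.prod f g

section

variable {A B C D : Torus}

@[simp]
theorem fst_comp_lift (f : C.obj →ₜ* A.obj) (g : C.obj →ₜ* B.obj) :
    (fst A B).comp (lift f g) = f := rfl

@[simp]
theorem snd_comp_lift (f : C.obj →ₜ* A.obj) (g : C.obj →ₜ* B.obj) :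
    (snd A B).comp (lift f g) = g := rfl

theorem hom_ext {f g : C.obj →ₜ* (A.prod B).obj} (h₁ : (fst A B).comp f = (fst A B).comp g)
    (h₂ : (snd A B).comp f = (snd A B).comp g) : f = g :=
  (congrArg₂ lift h₁ h₂ : lift _ _ = lift _ _)

end

/-- The standard tori. -/
def std : ℕ → Torus
  | 0 => unit
  | n + 1 => (std n).prod circleTorus

theorem nonempty_equiv_std_pi (n : ℕ) : Nonempty ((Fin n → Circle) ≃ₜ* (std n).obj) := by
  induction n with
  | zero =>
    exact ⟨{ toFun := fun _ => PUnit.unit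
             invFun := fun _ i => i.elim0
             left_inv := fun _ => funext fun i => i.elim0
             right_inv := fun _ => rfl
             map_mul' := fun _ _ => rfl
             continuous_toFun := continuous_const
             continuous_invFun := continuous_pi fun i => i.elim0 }⟩
  | succ n ih =>
    obtain ⟨e⟩ := ih
    exact ⟨(ContinuousMulEquiv.finSuccEquiv n).trans (e.prodEquiv (.refl Circle))⟩

theorem exists_equiv_std (A : Torus) : ∃ n, Nonempty (A.obj ≃ₜ* (std n).obj) := by
  obtain ⟨n, ⟨e⟩⟩ := A.property
  obtain ⟨f⟩ := nonempty_equiv_std_pi n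
  exact ⟨n, ⟨e.trans f⟩⟩

/-- Induction over tori. -/
theorem induction {P : Torus → Prop} (unit : P unit)
    (prod : ∀ A : Torus, P A → P (A.prod circleTorus))
    (equiv : ∀ (A B : Torus), (A.obj ≃ₜ* B.obj) → P A → P B) (A : Torus) : P A := by
  obtain ⟨n, ⟨e⟩⟩ := A.exists_equiv_std
  refine equiv (std n) A e.symm ?_
  induction n generalizing A with
  | zero => exact unit
  | succ n ih => exact prod _ (ih (std n) (ContinuousMulEquiv.refl _))

end Torus

/-! ### Characters and maps to tori -/

/-- Evaluation of characters at a point. -/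
def charEval {G : Type*} [Monoid G] [TopologicalSpace G] (a : G) : (G →ₜ* Circle) →* Circle where
  toFun V := V a
  map_one' := rfl
  map_mul' _ _ := rfl

theorem char_zpow_apply {G : Type*} [Monoid G] [TopologicalSpace G] (V : G →ₜ* Circle) (n : ℤ)
    (a : G) : (V ^ n) a = V a ^ n :=
  map_zpow (charEval a) V n

namespace Circle

theorem char_eq_zpow (V : Circle →ₜ* Circle) : ∃ n : ℤ, V = ContinuousMonoidHom.id Circle ^ n := by
  obtain ⟨n, hn⟩ := Circle.exists_eq_zpow V
  refine ⟨n, ?_⟩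
  ext z
  rw [char_zpow_apply, hn]
  rfl

theorem charHom_ext {G : Type*} [Group G] {φ ψ : (Circle →ₜ* Circle) →* G}
    (h : φ (ContinuousMonoidHom.id Circle) = ψ (ContinuousMonoidHom.id Circle)) : φ = ψ := by
  ext V
  obtain ⟨n, rfl⟩ := char_eq_zpow V
  rw [map_zpow, map_zpow, h]

theorem zpow_injective :
    Function.Injective fun n : ℤ => ContinuousMonoidHom.id Circle ^ n := fun n m h => by
  have hx : ∀ x : ℝ, (n : ℝ) * x = m * x := congrFun (Circle.isCoveringMap_exp.eq_of_comp_eq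
    (g₁ := fun x : ℝ => (n : ℝ) * x) (g₂ := fun x : ℝ => (m : ℝ) * x) (by fun_prop) (by fun_prop)
    (funext fun x => by
      have := DFunLike.congr_fun h (Circle.exp x)
      dsimp only at this
      rw [char_zpow_apply, char_zpow_apply] at this
      simpa using this) 0 (by simp))
  simpa using hx 1

/-- By `char_eq_zpow` and `zpow_injective` the character group of the circle is infinite cyclic on
the tautological character, so the value on this generator is arbitrary. -/
theorem exists_charHom {G : Type*} [Group G] (g : G) :
    ∃ φ : (Circle →ₜ* Circle) →* G, φ (ContinuousMonoidHom.id Circle) = g := by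
  choose d hd using char_eq_zpow
  refine ⟨MonoidHom.mk' (fun V => g ^ d V) fun V W => ?_, ?_⟩
  · rw [← zpow_add]
    congr 1
    refine zpow_injective ?_
    dsimp only
    rw [← hd, zpow_add, ← hd, ← hd]
  · change g ^ d _ = g
    conv_rhs => rw [← zpow_one g]
    congr 1
    refine zpow_injective ?_
    dsimp only
    rw [← hd, zpow_one]

end Circle

namespace AbCompactLieGroup

theorem exists_torus_mem_range_charMap (A : AbCompactLieGroup) (l : List A.Char) :
    ∃ (B : Torus) (α : A →ₜ* B.obj), ∀ V ∈ l, V ∈ (charMap α).range := by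
  induction l with
  | nil => exact ⟨Torus.unit, 1, by simp⟩
  | cons W l ih =>
    obtain ⟨B, α, h⟩ := ih
    refine ⟨B.prod circleTorus, ContinuousMonoidHom.prod α W, fun V hV => ?_⟩
    rcases List.mem_cons.1 hV with rfl | hV
    · exact ⟨Torus.snd B circleTorus, rfl⟩
    · obtain ⟨V', rfl⟩ := h V hV
      exact ⟨V'.comp (Torus.fst B circleTorus), rfl⟩

/-- Every abelian compact Lie group has a homomorphism to a torus along which all characters
extend. -/
theorem exists_torus_charMap_surjective (A : AbCompactLieGroup) :
    ∃ (B : Torus) (α : A →ₜ* B.obj), Function.Surjective (charMap α) := by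
  obtain ⟨n, V, hV⟩ := A.exists_char_generators
  obtain ⟨B, α, h⟩ := A.exists_torus_mem_range_charMap (List.ofFn V)
  refine ⟨B, α, MonoidHom.range_eq_top.1 (top_le_iff.1 ?_)⟩
  rw [← hV, Subgroup.closure_le]
  rintro _ ⟨i, rfl⟩
  exact h _ (List.mem_ofFn.2 ⟨i, rfl⟩)

/-- A homomorphism to `𝕋^n` is a tuple of characters, and each of them extends along `α`. This is
what makes the Kan extension independent of the chosen torus. -/
theorem exists_comp_eq {A : AbCompactLieGroup} {B C : Torus} {α : A →ₜ* B.obj}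
    (hα : Function.Surjective (charMap α)) (δ : A →ₜ* C.obj) :
    ∃ δ' : B.obj →ₜ* C.obj, δ'.comp α = δ := by
  obtain ⟨n, ⟨e⟩⟩ := C.property
  choose V hV using fun i : Fin n => hα
    { toFun := fun a => e (δ a) i
      map_one' := by simp
      map_mul' := fun a b => by simp
      continuous_toFun := (continuous_apply i).comp (e.continuous.comp (map_continuous δ)) }
  refine ⟨{ toFun := fun b => e.symm fun i => V i b
            map_one' := by rw [← map_one e.symm]; congr 1; ext i; simp
            map_mul' := fun a b => by
              rw [← map_mul]
              congr 1
              ext i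
              simp
            continuous_toFun :=
              e.symm.continuous.comp (continuous_pi fun i => map_continuous (V i)) }, ?_⟩
  ext a
  change e.symm (fun i => V i (α a)) = δ a
  rw [ContinuousMulEquiv.symm_apply_eq]
  ext i
  exact congrArg Subtype.val (DFunLike.congr_fun (hV i) a)

end AbCompactLieGroup

/-! ### Pairing a monoid ring with functions -/

section Pairing

variable {M M' K : Type*} [CommRing K]

/-- The pairing of an element of the monoid ring `ℤ[M]` with a function on `M`. -/
def monoidPairing (f : M → K) : MonoidAlgebra ℤ M →+ K :=
  MonoidAlgebra.liftNC (Int.castAddHom K) f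

@[simp]
theorem monoidPairing_single (f : M → K) (g : M) (n : ℤ) :
    monoidPairing f (MonoidAlgebra.single g n) = n * f g := by
  simp [monoidPairing]

theorem monoidPairing_mapDomain (f : M' → K) (φ : M → M') (v : MonoidAlgebra ℤ M) :
    monoidPairing f (MonoidAlgebra.mapDomain φ v) = monoidPairing (f ∘ φ) v := by
  induction v using MonoidAlgebra.induction_linear with
  | zero => simp
  | add v w hv hw => simp [MonoidAlgebra.mapDomain_add, hv, hw]
  | single g n => simp [MonoidAlgebra.mapDomain_single]

theorem monoidPairing_eq_sum (f : M → K) (v : MonoidAlgebra ℤ M) :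
    monoidPairing f v = ∑ g ∈ v.coeff.support, (v.coeff g : K) * f g := by
  simp only [monoidPairing, MonoidAlgebra.liftNC]
  rfl

variable [CommMonoid M]

/-- A set of functions on a monoid for which `f (g * h)` is, on finite sets, a finite sum of
products of functions from the set in the separate variables. -/
def IsSplitting (X : Set (M → K)) : Prop :=
  ∀ f ∈ X, ∀ S S' : Finset M, ∃ l : List ((M → K) × (M → K)),
    (∀ p ∈ l, p.1 ∈ X ∧ p.2 ∈ X) ∧
      ∀ g ∈ S, ∀ h ∈ S', f (g * h) = (l.map fun p => p.1 g * p.2 h).sum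

theorem monoidPairing_mul (f : M → K) (v w : MonoidAlgebra ℤ M) :
    monoidPairing f (v * w) = ∑ g ∈ v.coeff.support, ∑ h ∈ w.coeff.support,
      (v.coeff g : K) * (w.coeff h : K) * f (g * h) := by
  rw [MonoidAlgebra.mul_def, Finsupp.sum, map_sum]
  refine Finset.sum_congr rfl fun g _ => ?_
  rw [Finsupp.sum, map_sum]
  refine Finset.sum_congr rfl fun h _ => ?_
  simp

/-- Expanding `f (g * h)` as a finite sum of separated products over the supports of `v` and `w`
turns the pairing with `v * w` into a sum of products of pairings with `v` and with `w`. -/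
theorem IsSplitting.pairing_mul_mem {X : Set (M → K)} (hX : IsSplitting X)
    {v w : MonoidAlgebra ℤ M} {𝔞 𝔟 : Ideal K} (hv : ∀ f ∈ X, monoidPairing f v ∈ 𝔞)
    (hw : ∀ f ∈ X, monoidPairing f w ∈ 𝔟) {f : M → K} (hf : f ∈ X) :
    monoidPairing f (v * w) ∈ 𝔞 * 𝔟 := by
  obtain ⟨l, hl, hl'⟩ := hX f hf v.coeff.support w.coeff.support
  have : monoidPairing f (v * w) =
      (l.map fun p => monoidPairing p.1 v * monoidPairing p.2 w).sum := by
    rw [monoidPairing_mul]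
    rw [Finset.sum_congr rfl fun g hg => Finset.sum_congr rfl fun h hh => by
      rw [hl' g hg h hh]]
    clear hl hl'
    induction l with
    | nil => simp
    | cons p l ih =>
      simp only [List.map_cons, List.sum_cons, mul_add, Finset.sum_add_distrib, ih]
      congr 1
      rw [monoidPairing_eq_sum, monoidPairing_eq_sum, Finset.sum_mul_sum]
      exact Finset.sum_congr rfl fun g _ => Finset.sum_congr rfl fun h _ => by ring
  rw [this]
  refine list_sum_mem fun z hz => ?_
  obtain ⟨p, hp, rfl⟩ := List.mem_map.1 hz
  exact Ideal.mul_mem_mul (hv _ (hl p hp).1) (hw _ (hl p hp).2)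

/-- The pairing with an external product of functions. -/
theorem monoidPairing_inl_mul_inr (f f' : M → K) (v w : MonoidAlgebra ℤ M) :
    monoidPairing (fun p : M × M => f p.1 * f' p.2)
      (MonoidAlgebra.mapDomainRingHom ℤ (MonoidHom.inl M M) v *
        MonoidAlgebra.mapDomainRingHom ℤ (MonoidHom.inr M M) w) =
      monoidPairing f v * monoidPairing f' w := by
  induction v using MonoidAlgebra.induction_linear with
  | zero => simp
  | add v v' hv hv' => simp only [map_add, add_mul, hv, hv']
  | single g n =>
    induction w using MonoidAlgebra.induction_linear with
    | zero => simp
    | add v v' hv hv' => simp only [map_add, mul_add, hv, hv']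
    | single h m =>
      simp [MonoidAlgebra.mapDomainRingHom_apply, MonoidAlgebra.mapDomain_single,
        MonoidAlgebra.single_mul_single]
      ring

/-- The elements of the monoid ring pairing to zero with all functions of a splitting set form an
ideal. -/
def IsSplitting.annihilator {X : Set (M → K)} (hX : IsSplitting X) : Ideal (MonoidAlgebra ℤ M) where
  carrier := {v | ∀ f ∈ X, monoidPairing f v = 0}
  add_mem' := fun ha hb f hf => by rw [map_add, ha f hf, hb f hf, add_zero]
  zero_mem' := fun f _ => map_zero _
  smul_mem' := fun c v hv f hf => by
    -- The product estimate with the ideals `⊤` and `⊥` gives closure under multiplication.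
    have := hX.pairing_mul_mem (v := c) (w := v) (𝔞 := ⊤) (𝔟 := ⊥) (fun _ _ => trivial)
      (fun f hf => by simpa using hv f hf) hf
    simpa using this

/-- External products of functions of a splitting set form a splitting set. -/
theorem IsSplitting.prod {X : Set (M → K)} (hX : IsSplitting X) :
    IsSplitting {F : M × M → K | ∃ f ∈ X, ∃ f' ∈ X, F = fun p => f p.1 * f' p.2} := by
  classical
  rintro _ ⟨f, hf, f', hf', rfl⟩ S S'
  obtain ⟨l, hl, h⟩ := hX f hf (S.image Prod.fst) (S'.image Prod.fst)
  obtain ⟨l', hl', h'⟩ := hX f' hf' (S.image Prod.snd) (S'.image Prod.snd)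
  refine ⟨(l.product l').map fun q =>
    (fun p => q.1.1 p.1 * q.2.1 p.2, fun p => q.1.2 p.1 * q.2.2 p.2), ?_, ?_⟩
  · intro p hp
    obtain ⟨q, hq, rfl⟩ := List.mem_map.1 hp
    obtain ⟨h₁, h₂⟩ := List.mem_product.1 hq
    exact ⟨⟨_, (hl _ h₁).1, _, (hl' _ h₂).1, rfl⟩, ⟨_, (hl _ h₁).2, _, (hl' _ h₂).2, rfl⟩⟩
  · intro g hg g' hg'
    simp only [Prod.fst_mul, Prod.snd_mul]
    rw [h _ (Finset.mem_image_of_mem _ hg) _ (Finset.mem_image_of_mem _ hg'),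
      h' _ (Finset.mem_image_of_mem _ hg) _ (Finset.mem_image_of_mem _ hg')]
    clear h h' hl hl' hf hf'
    induction l with
    | nil => simp [List.product]
    | cons p l ih =>
      simp only [List.product, List.flatMap_cons, List.map_append, List.sum_append, List.map_map,
        Function.comp_def, List.map_cons, List.sum_cons, add_mul] at ih ⊢
      rw [ih, ← List.sum_map_mul_left]
      congr 2
      exact List.map_congr_left fun q _ => by ring

end Pairing

/-! ### Units and products of sums of ideals. -/

/-- If `∏ (a - c) = 0` for units `c`, then `a` is a unit. -/
theorem isUnit_of_prod_sub_eq_zero {Q : Type*} [CommRing Q] {a : Q} (s : Multiset Q)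
    (hs : ∀ c ∈ s, IsUnit c) (h : (s.map fun c => a - c).prod = 0) : IsUnit a := by
  -- Modulo `a` the product `∏ (a - c)` is `∏ (-c)`, which is a unit; if the former vanishes, then
  -- `a` divides a unit.
  have key : a ∣ (s.map fun c => a - c).prod - (s.map fun c => -c).prod := by
    clear hs h
    induction s using Multiset.induction_on with
    | empty => simp
    | cons c s ih =>
      obtain ⟨d, hd⟩ := ih
      refine ⟨(s.map fun c => a - c).prod - c * d, ?_⟩
      simp only [Multiset.map_cons, Multiset.prod_cons]
      linear_combination (-c) * hd
  rw [h, zero_sub, dvd_neg] at key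
  refine isUnit_of_dvd_unit key ?_
  clear key h
  induction s using Multiset.induction_on with
  | empty => simp
  | cons c s ih =>
    simp only [Multiset.map_cons, Multiset.prod_cons]
    exact (hs c (by simp)).neg.mul (ih fun c hc => hs c (by simp [hc]))

theorem Ideal.sup_mul_sup_le {K : Type*} [CommRing K] (𝔞 𝔟 𝔠 : Ideal K) :
    (𝔞 ⊔ 𝔟) * (𝔞 ⊔ 𝔠) ≤ 𝔞 ⊔ 𝔟 * 𝔠 := by
  rw [Ideal.sup_mul, Ideal.mul_sup 𝔟]
  have h₁ : 𝔞 * (𝔞 ⊔ 𝔠) ≤ 𝔞 := Ideal.mul_le_left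
  have h₂ : 𝔟 * 𝔞 ≤ 𝔞 := Ideal.mul_le_right
  exact sup_le (h₁.trans le_sup_left) (sup_le (h₂.trans le_sup_left) le_sup_right)

/-- `∏ (𝔞 i + 𝔟 j) ≤ ∏ 𝔞 i + ∏ 𝔟 j`. -/
theorem Ideal.prod_product_sup_le {K ι ι' : Type*} [CommRing K] (s : Multiset ι) (t : Multiset ι')
    (𝔞 : ι → Ideal K) (𝔟 : ι' → Ideal K) :
    ((s ×ˢ t).map fun p => 𝔞 p.1 ⊔ 𝔟 p.2).prod ≤ (s.map 𝔞).prod ⊔ (t.map 𝔟).prod := by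
  induction s using Multiset.induction_on with
  | empty => simp
  | cons i s ih =>
    simp only [Multiset.cons_product, Multiset.map_add, Multiset.prod_add, Multiset.map_map,
      Multiset.map_cons, Multiset.prod_cons, Function.comp_def]
    have h1 : (t.map fun j => 𝔞 i ⊔ 𝔟 j).prod ≤ 𝔞 i ⊔ (t.map 𝔟).prod := by
      clear ih
      induction t using Multiset.induction_on with
      | empty => simp
      | cons j t ih =>
        simp only [Multiset.map_cons, Multiset.prod_cons]
        refine (Ideal.mul_mono le_rfl ih).trans ?_
        exact Ideal.sup_mul_sup_le _ _ _
    rw [sup_comm] at h1 ih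
    refine (Ideal.mul_mono h1 ih).trans ?_
    rw [sup_comm (𝔞 i * _)]
    exact Ideal.sup_mul_sup_le _ _ _

/-! ### Ring homomorphisms out of tensor products -/

section TensorLift

variable {k S T K : Type*} [CommRing k] [CommRing S] [CommRing T] [CommRing K] [Algebra k S]
  [Algebra k T]

/-- The ring homomorphism `S ⊗[k] T → K` with given restrictions to `S` and `T`. -/
def tensorLift (f : S →+* K) (g : T →+* K)
    (h : f.comp (algebraMap k S) = g.comp (algebraMap k T)) : S ⊗[k] T →+* K :=
  letI : Algebra k K := (f.comp (algebraMap k S)).toAlgebra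
  (Algebra.TensorProduct.productMap (R := k) (⟨f, fun _ => rfl⟩ : S →ₐ[k] K)
    ⟨g, fun r => (DFunLike.congr_fun h r).symm⟩).toRingHom

@[simp]
theorem tensorLift_tmul (f : S →+* K) (g : T →+* K)
    (h : f.comp (algebraMap k S) = g.comp (algebraMap k T)) (s : S) (t : T) :
    tensorLift f g h (s ⊗ₜ t) = f s * g t := by
  let _ : Algebra k K := (f.comp (algebraMap k S)).toAlgebra
  exact Algebra.TensorProduct.productMap_apply_tmul (R := k) (⟨f, fun _ => rfl⟩ : S →ₐ[k] K)
    ⟨g, fun r => (DFunLike.congr_fun h r).symm⟩ s t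

theorem tensorHom_ext {f g : S ⊗[k] T →+* K} (h₁ : ∀ s, f (s ⊗ₜ 1) = g (s ⊗ₜ 1))
    (h₂ : ∀ t, f (1 ⊗ₜ t) = g (1 ⊗ₜ t)) : f = g := by
  refine RingHom.ext fun x => ?_
  induction x using TensorProduct.induction_on with
  | zero => simp
  | add x y hx hy => rw [map_add, map_add, hx, hy]
  | tmul s t =>
    have : (s ⊗ₜ[k] t : S ⊗[k] T) = (s ⊗ₜ 1) * (1 ⊗ₜ t) := by simp
    rw [this, map_mul, map_mul, h₁, h₂]

end TensorLift

/-! ### Open ideals -/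

section Open

variable {Γ : Type} {k R : Type u} [CommRing k] [CommRing R] [Algebra k R] {θ : Γ → R →ₐ[k] k}

theorem openIdeals_mono {I J : Ideal R} (hI : I ∈ openIdeals θ) (h : I ≤ J) :
    J ∈ openIdeals θ :=
  let ⟨s, hs⟩ := hI
  ⟨s, hs.trans h⟩

theorem openIdeals_mul {I J : Ideal R} (hI : I ∈ openIdeals θ) (hJ : J ∈ openIdeals θ) :
    I * J ∈ openIdeals θ := by
  obtain ⟨s, hs⟩ := hI
  obtain ⟨t, ht⟩ := hJ
  exact ⟨s + t, by rw [Multiset.map_add, Multiset.prod_add]; exact Ideal.mul_mono hs ht⟩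

theorem openIdeals_inf {I J : Ideal R} (hI : I ∈ openIdeals θ) (hJ : J ∈ openIdeals θ) :
    I ⊓ J ∈ openIdeals θ :=
  openIdeals_mono (openIdeals_mul hI hJ) Ideal.mul_le_inf

theorem top_mem_openIdeals : (⊤ : Ideal R) ∈ openIdeals θ := ⟨0, le_top⟩

theorem openIdeals_finset_inf {ι : Type*} (S : Finset ι) (I : ι → Ideal R)
    (h : ∀ i ∈ S, I i ∈ openIdeals θ) : S.inf I ∈ openIdeals θ := by
  classical
  induction S using Finset.induction_on with
  | empty => simpa using top_mem_openIdeals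
  | insert i S _ ih =>
    rw [Finset.inf_insert]
    exact openIdeals_inf (h _ (by simp)) (ih fun j hj => h j (by simp [hj]))

end Open

/-! ### Points -/

section Points

variable {Γ : Type} {k R : Type u} [CommRing k] [CommRing R] [Algebra k R]

/-- The continuous points, with values in a `k`-algebra `b : k → K`, of the formal scheme
defined by `R` with the topology given by the augmentations `θ`. -/
structure Pt (θ : Γ → R →ₐ[k] k) {K : Type u} [CommRing K] (b : k →+* K) where
  hom : R →+* K
  comm : hom.comp (algebraMap k R) = b
  isOpen : RingHom.ker hom ∈ openIdeals θ

namespace Pt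

variable {θ : Γ → R →ₐ[k] k} {K K' : Type u} [CommRing K] [CommRing K'] {b : k →+* K}

@[ext]
theorem ext {g h : Pt θ b} (H : ∀ x, g.hom x = h.hom x) : g = h := by
  cases g; cases h
  congr
  exact RingHom.ext H

theorem comm_apply (g : Pt θ b) (r : k) : g.hom (algebraMap k R r) = b r :=
  DFunLike.congr_fun g.comm r

/-- The image of a point under a change of rings. -/
def map (j : K →+* K') (g : Pt θ b) : Pt θ (j.comp b) where
  hom := j.comp g.hom
  comm := by rw [RingHom.comp_assoc, g.comm]
  isOpen := openIdeals_mono g.isOpen fun x hx => by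
    rw [RingHom.mem_ker] at hx ⊢
    rw [RingHom.comp_apply, hx, map_zero]

@[simp]
theorem map_hom_apply (j : K →+* K') (g : Pt θ b) (x : R) : (g.map j).hom x = j (g.hom x) := rfl

/-- The point given by an augmentation. -/
def aug (θ : Γ → R →ₐ[k] k) (V : Γ) (b : k →+* K) : Pt θ b where
  hom := b.comp (θ V).toRingHom
  comm := by
    ext r
    simp
  isOpen := openIdeals_mono (ker_mem_openIdeals θ V) fun x hx => by
    rw [RingHom.mem_ker] at hx ⊢
    rw [RingHom.comp_apply]
    exact (congrArg b hx).trans (map_zero b)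

@[simp]
theorem aug_hom_apply (V : Γ) (x : R) : (aug θ V b).hom x = b (θ V x) := rfl

/-- The universal point modulo an open ideal. -/
def univ (I : openIdeals θ) : Pt θ (algebraMap k (R ⧸ I.1)) where
  hom := Ideal.Quotient.mk I.1
  comm := rfl
  isOpen := by rw [Ideal.mk_ker]; exact I.2

@[simp]
theorem univ_hom_apply (I : openIdeals θ) (x : R) :
    (univ I).hom x = Ideal.Quotient.mk I.1 x := rfl

/-- The first universal point of `(R/I) ⊗ (R/J)`. -/
def left (I J : openIdeals θ) : Pt θ (algebraMap k (AlgTensor k (R ⧸ I.1) (R ⧸ J.1))) where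
  hom := Algebra.TensorProduct.includeLeftRingHom.comp (Ideal.Quotient.mk I.1)
  comm := rfl
  isOpen := openIdeals_mono I.2 fun x hx => by
    rw [RingHom.mem_ker, RingHom.comp_apply, Ideal.Quotient.eq_zero_iff_mem.2 hx, map_zero]

/-- The second universal point of `(R/I) ⊗ (R/J)`. -/
def right (I J : openIdeals θ) : Pt θ (algebraMap k (AlgTensor k (R ⧸ I.1) (R ⧸ J.1))) where
  hom := (Algebra.TensorProduct.includeRight (R := k) (A := R ⧸ I.1) (B := R ⧸ J.1)).toRingHom.comp
    (Ideal.Quotient.mk J.1)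
  comm := by
    ext r
    exact (Algebra.TensorProduct.includeRight (R := k) (A := R ⧸ I.1) (B := R ⧸ J.1)).commutes r
  isOpen := openIdeals_mono J.2 fun x hx => by
    rw [RingHom.mem_ker, RingHom.comp_apply, Ideal.Quotient.eq_zero_iff_mem.2 hx, map_zero]

@[simp]
theorem left_hom_apply (I J : openIdeals θ) (x : R) :
    (left I J).hom x = Ideal.Quotient.mk I.1 x ⊗ₜ 1 := rfl

@[simp]
theorem right_hom_apply (I J : openIdeals θ) (x : R) :
    (right I J).hom x = 1 ⊗ₜ Ideal.Quotient.mk J.1 x := rfl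

/-- The factorization of a point over an open ideal contained in its kernel. -/
def desc (g : Pt θ b) (I : Ideal R) (hI : I ≤ RingHom.ker g.hom) : R ⧸ I →+* K :=
  Ideal.Quotient.lift I g.hom fun _ hx => hI hx

@[simp]
theorem desc_mk (g : Pt θ b) (I : Ideal R) (hI : I ≤ RingHom.ker g.hom) (x : R) :
    g.desc I hI (Ideal.Quotient.mk I x) = g.hom x := rfl

theorem desc_comp_algebraMap (g : Pt θ b) (I : Ideal R) (hI : I ≤ RingHom.ker g.hom) :
    (g.desc I hI).comp (algebraMap k (R ⧸ I)) = b := by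
  ext r
  exact g.comm_apply r

/-- The homomorphism `(R/I) ⊗ (R/J) → K` defined by two points. -/
def desc₂ (g h : Pt θ b) (I J : Ideal R) (hI : I ≤ RingHom.ker g.hom)
    (hJ : J ≤ RingHom.ker h.hom) : (R ⧸ I) ⊗[k] (R ⧸ J) →+* K :=
  tensorLift (g.desc I hI) (h.desc J hJ)
    (by rw [desc_comp_algebraMap, desc_comp_algebraMap])

@[simp]
theorem desc₂_tmul (g h : Pt θ b) (I J : Ideal R) (hI : I ≤ RingHom.ker g.hom)
    (hJ : J ≤ RingHom.ker h.hom) (x y : R) :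
    g.desc₂ h I J hI hJ (Ideal.Quotient.mk I x ⊗ₜ Ideal.Quotient.mk J y) = g.hom x * h.hom y := by
  rw [desc₂, tensorLift_tmul, desc_mk, desc_mk]

theorem desc₂_comp_algebraMap (g h : Pt θ b) (I J : Ideal R) (hI : I ≤ RingHom.ker g.hom)
    (hJ : J ≤ RingHom.ker h.hom) :
    (g.desc₂ h I J hI hJ).comp (algebraMap k _) = b := by
  ext r
  have : algebraMap k ((R ⧸ I) ⊗[k] (R ⧸ J)) r =
    Ideal.Quotient.mk I (algebraMap k R r) ⊗ₜ Ideal.Quotient.mk J 1 := rfl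
  rw [RingHom.comp_apply, this, desc₂_tmul, map_one, mul_one, comm_apply]

end Pt

/-- A commutative monoid structure on points, natural in the ring of values. -/
structure PointMonoid [CommGroup Γ] (θ : Γ → R →ₐ[k] k) where
  mul : ∀ {K : Type u} [CommRing K] {b : k →+* K}, Pt θ b → Pt θ b → Pt θ b
  map_mul : ∀ {K K' : Type u} [CommRing K] [CommRing K'] (j : K →+* K') {b : k →+* K}
    (g h : Pt θ b), (mul g h).map j = mul (g.map j) (h.map j)
  mul_comm : ∀ {K : Type u} [CommRing K] {b : k →+* K} (g h : Pt θ b), mul g h = mul h g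
  mul_assoc : ∀ {K : Type u} [CommRing K] {b : k →+* K} (g h l : Pt θ b),
    mul (mul g h) l = mul g (mul h l)
  one_mul : ∀ {K : Type u} [CommRing K] {b : k →+* K} (g : Pt θ b), mul (Pt.aug θ 1 b) g = g
  aug_mul : ∀ {K : Type u} [CommRing K] {b : k →+* K} (V W : Γ),
    mul (Pt.aug θ V b) (Pt.aug θ W b) = Pt.aug θ (V * W) b

namespace PointMonoid

variable [CommGroup Γ] {θ : Γ → R →ₐ[k] k} (m : PointMonoid θ) {K K' : Type u} [CommRing K]
  [CommRing K'] {b : k →+* K}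

/-- The points, as a commutative monoid. -/
abbrev commMonoid (b : k →+* K) : CommMonoid (Pt θ b) where
  mul := m.mul
  one := Pt.aug θ 1 b
  mul_assoc := m.mul_assoc
  one_mul := m.one_mul
  mul_one g := (m.mul_comm _ _).trans (m.one_mul g)
  mul_comm := m.mul_comm

/-- Naturality of products, in unbundled form. -/
theorem mul_hom_of_map {b' : k →+* K'} {g h : Pt θ b} {g' h' : Pt θ b'} (j : K' →+* K)
    (hg : ∀ x, j (g'.hom x) = g.hom x) (hh : ∀ x, j (h'.hom x) = h.hom x) (x : R) :
    (m.mul g h).hom x = j ((m.mul g' h').hom x) := by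
  have e : j.comp b' = b := by
    ext r
    rw [RingHom.comp_apply, ← g'.comm_apply, hg, g.comm_apply]
  subst e
  obtain rfl : g'.map j = g := Pt.ext hg
  obtain rfl : h'.map j = h := Pt.ext hh
  rw [← m.map_mul]
  rfl

/-- Products of points are computed by the universal case. -/
theorem mul_hom_apply (g h : Pt θ b) (I J : openIdeals θ) (hI : I.1 ≤ RingHom.ker g.hom)
    (hJ : J.1 ≤ RingHom.ker h.hom) (x : R) :
    (m.mul g h).hom x =
      g.desc₂ h I.1 J.1 hI hJ ((m.mul (Pt.left I J) (Pt.right I J)).hom x) := by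
  refine m.mul_hom_of_map _ (fun x => ?_) (fun x => ?_) x
  · rw [Pt.left_hom_apply, ← map_one (Ideal.Quotient.mk J.1), Pt.desc₂_tmul, map_one, mul_one]
  · rw [Pt.right_hom_apply, ← map_one (Ideal.Quotient.mk I.1), Pt.desc₂_tmul, map_one, _root_.one_mul]

/-- On finite sets of points, the value of a function at a product is a finite sum of products of
values of functions at the factors. -/
theorem exists_mul_hom_eq_sum (S S' : Finset (Pt θ b)) (x : R) :
    ∃ l : List (R × R), ∀ g ∈ S, ∀ h ∈ S',
      (m.mul g h).hom x = (l.map fun p => g.hom p.1 * h.hom p.2).sum := by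
  -- Intersecting the finitely many kernels leaves an open ideal, so a single element of `(R/I) ⊗
  -- (R/J)` computes all products of a point of `S` with a point of `S'`.
  let I : openIdeals θ := ⟨S.inf fun g => RingHom.ker g.hom,
    openIdeals_finset_inf _ _ fun g _ => g.isOpen⟩
  let J : openIdeals θ := ⟨S'.inf fun g => RingHom.ker g.hom,
    openIdeals_finset_inf _ _ fun g _ => g.isOpen⟩
  have key : ∀ z : AlgTensor k (R ⧸ I.1) (R ⧸ J.1), ∃ l : List (R × R),
      z = (l.map fun p => Ideal.Quotient.mk I.1 p.1 ⊗ₜ[k] Ideal.Quotient.mk J.1 p.2).sum := by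
    intro z
    induction z using TensorProduct.induction_on with
    | zero => exact ⟨[], by simp⟩
    | add x y hx hy =>
      obtain ⟨l, rfl⟩ := hx
      obtain ⟨l', rfl⟩ := hy
      exact ⟨l ++ l', by simp⟩
    | tmul x y =>
      obtain ⟨x, rfl⟩ := Ideal.Quotient.mk_surjective x
      obtain ⟨y, rfl⟩ := Ideal.Quotient.mk_surjective y
      exact ⟨[(x, y)], by simp⟩
  obtain ⟨l, hl⟩ := key ((m.mul (Pt.left I J) (Pt.right I J)).hom x)
  refine ⟨l, fun g hg h hh => ?_⟩
  rw [m.mul_hom_apply g h I J (Finset.inf_le hg) (Finset.inf_le hh), hl, map_list_sum, List.map_map]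
  exact congrArg List.sum (List.map_congr_left fun p _ => by simp)

/-- The functions on the monoid of points defined by elements of `R`. -/
def functions (θ : Γ → R →ₐ[k] k) (b : k →+* K) : Set (Pt θ b → K) :=
  Set.range fun (x : R) (g : Pt θ b) => g.hom x

theorem isSplitting_functions (b : k →+* K) :
    letI := m.commMonoid b
    IsSplitting (functions θ b) := by
  rintro _ ⟨x, rfl⟩ S S'
  obtain ⟨l, hl⟩ := m.exists_mul_hom_eq_sum S S' x
  refine ⟨l.map fun p => (fun g => g.hom p.1, fun g => g.hom p.2), ?_, ?_⟩
  · intro p hp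
    obtain ⟨q, _, rfl⟩ := List.mem_map.1 hp
    exact ⟨⟨_, rfl⟩, ⟨_, rfl⟩⟩
  · intro g hg h hh
    rw [List.map_map]
    exact hl g hg h hh

/-- In the monoid ring of points modulo the functionals that vanish on all functions, the
augmentations are units, with inverses given by inverse characters. If the kernel of `g` contains `∏
ker θ(V)`, then `∏ (g - θ(V)) = 0` there, because `g - θ(V)` takes values in the ideal generated by
`g(ker θ(V))`. Hence `g` is a unit as well. -/
theorem exists_inverse_functional (g : Pt θ b) :
    letI := m.commMonoid b
    ∃ v : MonoidAlgebra ℤ (Pt θ b),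
      MonoidAlgebra.single g 1 * v - 1 ∈ (m.isSplitting_functions b).annihilator := by
  let _ := m.commMonoid b
  set N := (m.isSplitting_functions b).annihilator
  obtain ⟨s, hs⟩ := g.isOpen
  have hu : IsUnit (Ideal.Quotient.mk N (MonoidAlgebra.single g 1)) := by
    refine isUnit_of_prod_sub_eq_zero
      (s.map fun V => Ideal.Quotient.mk N (MonoidAlgebra.single (Pt.aug θ V b) 1)) ?_ ?_
    · intro c hc
      obtain ⟨V, _, rfl⟩ := Multiset.mem_map.1 hc
      refine IsUnit.of_mul_eq_one
        (Ideal.Quotient.mk N (MonoidAlgebra.single (Pt.aug θ V⁻¹ b) 1)) ?_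
      rw [← _root_.map_mul, MonoidAlgebra.single_mul_single]
      have : Pt.aug θ V b * Pt.aug θ V⁻¹ b = 1 := (m.aug_mul _ _).trans (by rw [mul_inv_cancel]; rfl)
      rw [this, _root_.mul_one]
      exact map_one _
    · have : ∀ t : Multiset Γ, ∀ f ∈ functions θ b, monoidPairing f (t.map fun V =>
          MonoidAlgebra.single g 1 - MonoidAlgebra.single (Pt.aug θ V b) 1).prod ∈
            (t.map fun V => RingHom.ker (θ V)).prod.map g.hom := by
        intro t
        induction t using Multiset.induction_on with
        | empty => simp [Ideal.one_eq_top, Ideal.map_top]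
        | cons V t ih =>
          intro f hf
          simp only [Multiset.map_cons, Multiset.prod_cons, Ideal.map_mul]
          refine (m.isSplitting_functions b).pairing_mul_mem ?_ ih hf
          rintro _ ⟨x, rfl⟩
          -- The difference of the values of `g` and of the augmentation `V` at `x` is the value of
          -- `g` at this element of `ker θ(V)`.
          have : x - algebraMap k R (θ V x) ∈ RingHom.ker (θ V) := by
            simp [RingHom.mem_ker]
          simpa [g.comm_apply] using Ideal.mem_map_of_mem g.hom this
      rw [Multiset.map_map]
      simp only [Function.comp_def, ← map_sub]
      rw [← Function.comp_def (Ideal.Quotient.mk N), ← Multiset.map_map, ← map_multiset_prod,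
        Ideal.Quotient.eq_zero_iff_mem]
      intro f hf
      have h₀ := this s f hf
      rwa [(Ideal.map_eq_bot_iff_le_ker _).2 hs] at h₀
  obtain ⟨w, hw⟩ := hu.exists_right_inv
  obtain ⟨v, rfl⟩ := Ideal.Quotient.mk_surjective w
  refine ⟨v, ?_⟩
  rw [← Ideal.Quotient.eq_zero_iff_mem, map_sub, _root_.map_mul, hw, map_one, sub_self]

/-- Points are invertible. -/
theorem exists_inverse (g : Pt θ b) : ∃ h : Pt θ b, m.mul g h = Pt.aug θ 1 b := by
  classical
  let _ := m.commMonoid b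
  let ev : R → Pt θ b → K := fun x g => g.hom x
  have hX := m.isSplitting_functions b
  obtain ⟨v, hv⟩ := m.exists_inverse_functional g
  have hv' : ∀ x, monoidPairing (ev x) (MonoidAlgebra.single g 1 * v) = b (θ 1 x) := by
    intro x
    have := hv (ev x) ⟨x, rfl⟩
    rw [map_sub, sub_eq_zero] at this
    rw [this, MonoidAlgebra.one_def, monoidPairing_single]
    simp only [Int.cast_one, _root_.one_mul]
    rfl
  have hsum : ∀ f : Pt θ b → K, monoidPairing f (MonoidAlgebra.single g 1 * v) =
      ∑ h ∈ v.coeff.support, (v.coeff h : K) * f (g * h) := by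
    intro f
    rw [monoidPairing_mul, MonoidAlgebra.coeff_single, Finsupp.support_single _ one_ne_zero,
      Finset.sum_singleton]
    simp
  -- The functional `v` is to be shown multiplicative, i.e. grouplike: `δ v = v ⊗ v`, where the
  -- diagonal `δ` is dual to multiplication of functions. Both sides are compared in the monoid ring
  -- of pairs of points, modulo functionals vanishing on external products of functions.
  let N₂ := hX.prod.annihilator
  let q := Ideal.Quotient.mk N₂
  let δ := MonoidAlgebra.mapDomainRingHom ℤ ((MonoidHom.id (Pt θ b)).prod (MonoidHom.id _))
  let i₁ := MonoidAlgebra.mapDomainRingHom ℤ (MonoidHom.inl (Pt θ b) (Pt θ b))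
  let i₂ := MonoidAlgebra.mapDomainRingHom ℤ (MonoidHom.inr (Pt θ b) (Pt θ b))
  have hδ : ∀ w ∈ hX.annihilator, δ w ∈ N₂ := by
    rintro w hw _ ⟨_, ⟨x, rfl⟩, _, ⟨y, rfl⟩, rfl⟩
    have := hw (ev (x * y)) ⟨_, rfl⟩
    simp only [δ, MonoidAlgebra.mapDomainRingHom_apply, monoidPairing_mapDomain]
    rw [← this]
    congr 1
    exact congrArg monoidPairing (funext fun g => (_root_.map_mul g.hom x y).symm)
  have hi₁ : ∀ w ∈ hX.annihilator, i₁ w ∈ N₂ := by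
    rintro w hw _ ⟨f, hf, f', hf', rfl⟩
    have := monoidPairing_inl_mul_inr f f' w 1
    rwa [map_one, _root_.mul_one, hw f hf, zero_mul] at this
  have hi₂ : ∀ w ∈ hX.annihilator, i₂ w ∈ N₂ := by
    rintro w hw _ ⟨f, hf, f', hf', rfl⟩
    have := monoidPairing_inl_mul_inr f f' 1 w
    rwa [map_one, _root_.one_mul, hw f' hf', mul_zero] at this
  have unit_of : ∀ φ : MonoidAlgebra ℤ (Pt θ b) →+* MonoidAlgebra ℤ (Pt θ b × Pt θ b),
      (∀ w ∈ hX.annihilator, φ w ∈ N₂) → q (φ (MonoidAlgebra.single g 1)) * q (φ v) = 1 := by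
    intro φ hφ
    have := hφ _ hv
    rw [← Ideal.Quotient.eq_zero_iff_mem, map_sub, map_sub, sub_eq_zero, map_one, map_one] at this
    rw [← _root_.map_mul, ← _root_.map_mul]
    exact this
  have hg : δ (MonoidAlgebra.single g 1) =
      i₁ (MonoidAlgebra.single g 1) * i₂ (MonoidAlgebra.single g 1) := by
    simp [δ, i₁, i₂, MonoidAlgebra.mapDomainRingHom_apply, MonoidAlgebra.mapDomain_single,
      MonoidAlgebra.single_mul_single]
  -- Since `g` is grouplike, both elements are inverse to the class of `(g, g)`, so uniqueness of
  -- inverses applies.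
  have hq : q (δ v) = q (i₁ v * i₂ v) := by
    have h₀ := unit_of δ hδ
    have h₁ := unit_of i₁ hi₁
    have h₂ := unit_of i₂ hi₂
    rw [hg, _root_.map_mul] at h₀
    rw [_root_.map_mul]
    calc q (δ v) = (q (i₁ (MonoidAlgebra.single g 1)) * q (i₁ v)) *
          (q (i₂ (MonoidAlgebra.single g 1)) * q (i₂ v)) * q (δ v) := by
          rw [h₁, h₂, _root_.mul_one, _root_.one_mul]
      _ = (q (i₁ (MonoidAlgebra.single g 1)) * q (i₂ (MonoidAlgebra.single g 1)) * q (δ v)) *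
          (q (i₁ v) * q (i₂ v)) := by ring
      _ = _ := by rw [h₀, _root_.one_mul]
  have hmul : ∀ x y, monoidPairing (ev (x * y)) v =
      monoidPairing (ev x) v * monoidPairing (ev y) v := by
    intro x y
    have h := Ideal.Quotient.eq.1 hq _ ⟨ev x, ⟨x, rfl⟩, ev y, ⟨y, rfl⟩, rfl⟩
    rw [map_sub, sub_eq_zero, monoidPairing_inl_mul_inr] at h
    rw [← h]
    simp only [δ, MonoidAlgebra.mapDomainRingHom_apply, monoidPairing_mapDomain]
    congr 1
    exact congrArg monoidPairing (funext fun g => _root_.map_mul g.hom x y)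
  have hconst : ∀ r, monoidPairing (ev (algebraMap k R r)) v = b r := by
    intro r
    have h := hv' (algebraMap k R r)
    rw [AlgHom.commutes, hsum] at h
    rw [monoidPairing_eq_sum]
    simpa [ev, Pt.comm_apply] using h
  let η : R →+* K :=
    { toFun x := monoidPairing (ev x) v
      map_one' := by rw [← map_one (algebraMap k R), hconst, map_one]
      map_mul' := hmul
      map_zero' := by rw [← map_zero (algebraMap k R), hconst, map_zero]
      map_add' x y := by
        simp only [monoidPairing_eq_sum, ev, map_add, mul_add, Finset.sum_add_distrib] }
  let h : Pt θ b :=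
    { hom := η
      comm := RingHom.ext hconst
      isOpen := by
        -- The functional is a finite integral combination of points, so it vanishes on the
        -- intersection of their kernels.
        refine openIdeals_mono (openIdeals_finset_inf v.coeff.support
          (fun g => RingHom.ker g.hom) fun g _ => g.isOpen) fun x hx => ?_
        rw [RingHom.mem_ker]
        change monoidPairing (ev x) v = 0
        rw [monoidPairing_eq_sum]
        refine Finset.sum_eq_zero fun g hg => ?_
        have : g.hom x = 0 :=
          (Finset.inf_le (f := fun g : Pt θ b => RingHom.ker g.hom) hg) hx
        simp [ev, this] }
  refine ⟨h, Pt.ext fun x => ?_⟩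
  obtain ⟨l, hl⟩ := m.exists_mul_hom_eq_sum {g} (insert h v.coeff.support) x
  -- One separated expansion of `x` serves `h` and all points in the support of `v`; summing over
  -- the support replaces their values by those of `h`.
  rw [hl g (by simp) h (by simp), Pt.aug_hom_apply, ← hv' x, hsum]
  have hr : ∀ h' ∈ v.coeff.support, (v.coeff h' : K) * ev x (g * h') =
      (l.map fun p => g.hom p.1 * ((v.coeff h' : K) * h'.hom p.2)).sum := by
    intro h' hh'
    have : ev x (g * h') = _ := hl g (by simp) h' (by simp [hh'])
    rw [this, ← List.sum_map_mul_left]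
    exact congrArg List.sum (List.map_congr_left fun p _ => by ring)
  rw [Finset.sum_congr rfl hr]
  clear hr hl
  induction l with
  | nil => simp
  | cons p l ih =>
    simp only [List.map_cons, List.sum_cons, Finset.sum_add_distrib, ← Finset.mul_sum, ih]
    congr 2

end PointMonoid

end Points

section TensorLift

variable {k S T U A K : Type*} [CommRing k] [CommRing S] [CommRing T] [CommRing U] [CommRing A]
  [CommRing K] [Algebra k S] [Algebra k T] [Algebra k U] [Algebra k A]

/-- This form converts the coassociativity identity into associativity of the product of three
points; `A` stands for the quotient of `R` by the kernel of a component of the comultiplication. -/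
theorem tensorLift_assoc_map (f : S →+* K) (g : T →+* K) (h : U →+* K)
    (hfg : f.comp (algebraMap k S) = g.comp (algebraMap k T))
    (hgh : g.comp (algebraMap k T) = h.comp (algebraMap k U)) (α : A →ₐ[k] S ⊗[k] T)
    (a : A →+* K) (ha : a = (tensorLift f g hfg).comp α.toRingHom)
    (hah : a.comp (algebraMap k A) = h.comp (algebraMap k U)) {hf}
    (z : A ⊗[k] U) :
    tensorLift a h hah z = tensorLift f (tensorLift g h hgh) hf
      (Algebra.TensorProduct.assoc k k k S T U
        (Algebra.TensorProduct.map α (AlgHom.id k U) z)) := by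
  subst ha
  induction z using TensorProduct.induction_on with
  | zero => simp
  | add x y hx hy => simp only [map_add, hx, hy]
  | tmul x y =>
    rw [tensorLift_tmul, Algebra.TensorProduct.map_tmul, RingHom.comp_apply]
    change tensorLift f g hfg (α x) * h y = _
    generalize α x = w
    induction w using TensorProduct.induction_on with
    | zero => simp
    | add x y hx hy => simp only [map_add, add_mul, TensorProduct.add_tmul, hx, hy]
    | tmul s t => simp [mul_assoc]

theorem tensorLift_map_right (f : S →+* K) (g : T →+* K)
    (hfg : f.comp (algebraMap k S) = g.comp (algebraMap k T)) (α : A →ₐ[k] T)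
    (a : A →+* K) (ha : a = g.comp α.toRingHom)
    (hfa : f.comp (algebraMap k S) = a.comp (algebraMap k A)) (z : S ⊗[k] A) :
    tensorLift f g hfg (Algebra.TensorProduct.map (AlgHom.id k S) α z) =
      tensorLift f a hfa z := by
  subst ha
  induction z using TensorProduct.induction_on with
  | zero => simp
  | add x y hx hy => simp only [map_add, hx, hy]
  | tmul x y => simp

end TensorLift

/-- The point given by a homomorphism out of the quotient by an open ideal. -/
def Pt.ofAlgHom {Γ : Type} {k R : Type u} [CommRing k] [CommRing R] [Algebra k R]
    {θ : Γ → R →ₐ[k] k} {K : Type u} [CommRing K] [Algebra k K] (I : openIdeals θ)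
    (f : R ⧸ I.1 →ₐ[k] K) : Pt θ (algebraMap k K) where
  hom := f.toRingHom.comp (Ideal.Quotient.mk I.1)
  comm := f.comp_algebraMap
  isOpen := openIdeals_mono I.2 fun x hx => by
    rw [RingHom.mem_ker, RingHom.comp_apply, Ideal.Quotient.eq_zero_iff_mem.2 hx, map_zero]

theorem Pt.ker_le_ker_aug {Γ : Type} {k R : Type u} [CommRing k] [CommRing R] [Algebra k R]
    (θ : Γ → R →ₐ[k] k) (V : Γ) {K : Type u} [CommRing K] (b : k →+* K) :
    RingHom.ker (θ V) ≤ RingHom.ker (Pt.aug θ V b).hom := fun x hx => by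
  rw [RingHom.mem_ker] at hx ⊢
  rw [Pt.aug_hom_apply, hx, map_zero]

/-! ### The group of points, and products of points for a coarser topology. -/

namespace PointMonoid

variable {Γ : Type} {k R : Type u} [CommRing k] [CommRing R] [Algebra k R]
variable [CommGroup Γ] {θ : Γ → R →ₐ[k] k} (m : PointMonoid θ) {K K' : Type u} [CommRing K]
  [CommRing K'] {b : k →+* K}

/-- The points, as a commutative group. -/
abbrev commGroup (b : k →+* K) : CommGroup (Pt θ b) where
  __ := m.commMonoid b
  inv g := (m.exists_inverse g).choose
  inv_mul_cancel g := (m.mul_comm _ _).trans (m.exists_inverse g).choose_spec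

/-- If `g` and `h` are points that agree with the augmentations `V` and `W` modulo ideals `𝔞` and
`𝔟`, then `g * h` agrees with the augmentation `V * W` modulo `𝔞 + 𝔟`. -/
theorem map_ker_aug_mul_le (g h : Pt θ b) (V W : Γ) :
    (RingHom.ker (θ (V * W))).map (m.mul g h).hom ≤
      (RingHom.ker (θ V)).map g.hom ⊔ (RingHom.ker (θ W)).map h.hom := by
  set 𝔠 := (RingHom.ker (θ V)).map g.hom ⊔ (RingHom.ker (θ W)).map h.hom
  -- Modulo `𝔠` both points become augmentations, and products of augmentations are known; so the
  -- product becomes the augmentation `V * W`.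
  have agree : ∀ (g : Pt θ b) (V : Γ), (RingHom.ker (θ V)).map g.hom ≤ 𝔠 →
      g.map (Ideal.Quotient.mk 𝔠) = Pt.aug θ V _ := by
    intro g V hg
    ext x
    have hx : x - algebraMap k R (θ V x) ∈ RingHom.ker (θ V) := by simp [RingHom.mem_ker]
    have := hg (Ideal.mem_map_of_mem g.hom hx)
    rw [map_sub, g.comm_apply] at this
    exact Ideal.Quotient.eq.2 this
  have key : (m.mul g h).map (Ideal.Quotient.mk 𝔠) = Pt.aug θ (V * W) _ := by
    rw [m.map_mul, agree g V le_sup_left, agree h W le_sup_right, m.aug_mul]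
  rw [Ideal.map_le_iff_le_comap]
  intro x hx
  have := congrArg (fun p => Pt.hom p x) key
  simp only [Pt.map_hom_apply, Pt.aug_hom_apply] at this
  rw [RingHom.mem_ker] at hx
  rw [hx, map_zero] at this
  exact Ideal.mem_comap.2 (Ideal.Quotient.eq_zero_iff_mem.1 this)

/-- If `g` and `h` are continuous for the topologies generated by the families `v` and `w`, the
product is continuous for the one generated by the pairwise products `v i * w j`. For a family
closed under multiplication this makes the points of a pushforward closed under multiplication. -/
theorem prod_ker_le_ker_mul (g h : Pt θ b) {ι ι' : Type} (v : ι → Γ) (w : ι' → Γ)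
    {s : Multiset ι} {t : Multiset ι'}
    (hs : (s.map fun i => RingHom.ker (θ (v i))).prod ≤ RingHom.ker g.hom)
    (ht : (t.map fun j => RingHom.ker (θ (w j))).prod ≤ RingHom.ker h.hom) :
    ((s ×ˢ t).map fun p => RingHom.ker (θ (v p.1 * w p.2))).prod ≤
      RingHom.ker (m.mul g h).hom := by
  have map_prod : ∀ {ι : Type} (q : Multiset ι) (I : ι → Ideal R) (f : R →+* K),
      (q.map I).prod.map f = (q.map fun i => (I i).map f).prod := by
    intro ι q I f
    have := map_multiset_prod (Ideal.mapHom f) (q.map I)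
    rw [Multiset.map_map] at this
    exact this
  rw [← Ideal.map_eq_bot_iff_le_ker] at hs ht ⊢
  rw [map_prod] at hs ht ⊢
  have h₁ := Ideal.prod_product_sup_le s t (fun i => (RingHom.ker (θ (v i))).map g.hom)
    fun j => (RingHom.ker (θ (w j))).map h.hom
  rw [hs, ht, sup_bot_eq] at h₁
  exact eq_bot_iff.2 (le_trans (Multiset.prod_map_le_prod_map₀ _ _ (fun _ _ => bot_le)
    fun p _ => m.map_ker_aug_mul_le g h (v p.1) (w p.2)) h₁)

end PointMonoid

/-! ### Comultiplications and points -/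

namespace EquivariantFGL

variable {Γ : Type} [CommGroup Γ] {k : Type u} [CommRing k]

section

variable (F : EquivariantFGL Γ k) {K : Type u} [CommRing K] {b : k →+* K}

theorem map_factor_comul (I J I' J' : openIdeals F.θ) (hI : I.1 ≤ I'.1) (hJ : J.1 ≤ J'.1)
    (x : F.R) :
    Algebra.TensorProduct.map (Ideal.Quotient.factorₐ k hI) (Ideal.Quotient.factorₐ k hJ)
      (F.comul I J x) = F.comul I' J' x :=
  (F.Δ x).2 (I, J) (I', J') hI hJ

/-- Compatibility of the components of the comultiplication makes the product of points independent
of the open ideals used to compute it. -/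
theorem desc₂_comul (g h : Pt F.θ b) (I J I' J' : openIdeals F.θ) (hI : I.1 ≤ I'.1)
    (hJ : J.1 ≤ J'.1) (hg : I'.1 ≤ RingHom.ker g.hom) (hh : J'.1 ≤ RingHom.ker h.hom) (x : F.R) :
    g.desc₂ h I.1 J.1 (hI.trans hg) (hJ.trans hh) (F.comul I J x) =
      g.desc₂ h I'.1 J'.1 hg hh (F.comul I' J' x) := by
  rw [← F.map_factor_comul I J I' J' hI hJ]
  suffices H : g.desc₂ h I.1 J.1 (hI.trans hg) (hJ.trans hh) =
      (g.desc₂ h I'.1 J'.1 hg hh).comp (Algebra.TensorProduct.map (Ideal.Quotient.factorₐ k hI)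
        (Ideal.Quotient.factorₐ k hJ)).toRingHom from DFunLike.congr_fun H _
  refine tensorHom_ext (fun s => ?_) (fun s => ?_) <;>
  · obtain ⟨s, rfl⟩ := Ideal.Quotient.mk_surjective s
    simp [Pt.desc₂]

/-- The product of two points of an equivariant formal group law. -/
def pointMul (g h : Pt F.θ b) : Pt F.θ b where
  hom := (g.desc₂ h _ _ le_rfl le_rfl).comp
    (F.comul ⟨RingHom.ker g.hom, g.isOpen⟩ ⟨RingHom.ker h.hom, h.isOpen⟩).toRingHom
  comm := by
    ext r
    have := DFunLike.congr_fun (g.desc₂_comp_algebraMap h _ _ le_rfl le_rfl) r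
    rw [← this]
    exact congrArg (g.desc₂ h _ _ le_rfl le_rfl) (AlgHom.commutes _ r)
  isOpen := openIdeals_mono (F.continuous_comul ⟨RingHom.ker g.hom, g.isOpen⟩
    ⟨RingHom.ker h.hom, h.isOpen⟩) fun x hx => by
      rw [RingHom.mem_ker] at hx ⊢
      exact (congrArg (g.desc₂ h _ _ le_rfl le_rfl) hx).trans (map_zero _)

theorem pointMul_hom_apply (g h : Pt F.θ b) (I J : openIdeals F.θ) (hg : I.1 ≤ RingHom.ker g.hom)
    (hh : J.1 ≤ RingHom.ker h.hom) (x : F.R) :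
    (F.pointMul g h).hom x = g.desc₂ h I.1 J.1 hg hh (F.comul I J x) :=
  (F.desc₂_comul g h I J ⟨RingHom.ker g.hom, g.isOpen⟩ ⟨RingHom.ker h.hom, h.isOpen⟩ hg hh
    le_rfl le_rfl x).symm

/-- The group structure on the points of an equivariant formal group law. -/
def points : PointMonoid F.θ where
  mul := F.pointMul
  map_mul j b g h := by
    ext x
    rw [F.pointMul_hom_apply (g.map j) (h.map j) ⟨RingHom.ker g.hom, g.isOpen⟩
      ⟨RingHom.ker h.hom, h.isOpen⟩ (fun x hx => by
        rw [RingHom.mem_ker] at hx ⊢; rw [Pt.map_hom_apply, hx, map_zero]) (fun x hx => by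
        rw [RingHom.mem_ker] at hx ⊢; rw [Pt.map_hom_apply, hx, map_zero]),
      Pt.map_hom_apply, F.pointMul_hom_apply g h ⟨RingHom.ker g.hom, g.isOpen⟩
      ⟨RingHom.ker h.hom, h.isOpen⟩ le_rfl le_rfl, ← RingHom.comp_apply]
    refine DFunLike.congr_fun (tensorHom_ext (fun s => ?_) (fun s => ?_)) _ <;>
    · obtain ⟨s, rfl⟩ := Ideal.Quotient.mk_surjective s
      simp [Pt.desc₂]
  mul_comm g h := by
    ext x
    rw [F.pointMul_hom_apply h g ⟨RingHom.ker h.hom, h.isOpen⟩ ⟨RingHom.ker g.hom, g.isOpen⟩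
      le_rfl le_rfl, comul, AlgHom.comp_apply, ← F.cocomm]
    refine DFunLike.congr_fun (f := g.desc₂ h _ _ le_rfl le_rfl)
      (g := (h.desc₂ g _ _ le_rfl le_rfl).comp
        (Algebra.TensorProduct.comm k _ _).toAlgHom.toRingHom)
      (tensorHom_ext (fun s => ?_) (fun s => ?_)) _ <;>
    · obtain ⟨s, rfl⟩ := Ideal.Quotient.mk_surjective s
      simp [Pt.desc₂]
  mul_assoc g h l := by
    ext x
    let I : openIdeals F.θ := ⟨RingHom.ker g.hom, g.isOpen⟩
    let J : openIdeals F.θ := ⟨RingHom.ker h.hom, h.isOpen⟩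
    let K : openIdeals F.θ := ⟨RingHom.ker l.hom, l.isOpen⟩
    -- The kernels in the coassociativity axiom may be finer than those of the products of points,
    -- so the outer products are recomputed with these finer open ideals.
    have hIJ : RingHom.ker ((completedTensorProj k I J).comp F.Δ) ≤
        RingHom.ker (F.pointMul g h).hom := fun x hx => by
      rw [RingHom.mem_ker] at hx ⊢
      exact (congrArg (g.desc₂ h _ _ le_rfl le_rfl) hx).trans (map_zero _)
    have hJK : RingHom.ker ((completedTensorProj k J K).comp F.Δ) ≤
        RingHom.ker (F.pointMul h l).hom := fun x hx => by
      rw [RingHom.mem_ker] at hx ⊢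
      exact (congrArg (h.desc₂ l _ _ le_rfl le_rfl) hx).trans (map_zero _)
    rw [F.pointMul_hom_apply (F.pointMul g h) l ⟨_, F.continuous_comul I J⟩ K hIJ le_rfl,
      F.pointMul_hom_apply g (F.pointMul h l) I ⟨_, F.continuous_comul J K⟩ le_rfl hJK]
    have key := congrArg (tensorLift (g.desc I.1 le_rfl) (h.desc₂ l J.1 K.1 le_rfl le_rfl) (by
        rw [Pt.desc_comp_algebraMap, Pt.desc₂_comp_algebraMap])) (F.coassoc I J K x)
    have h₁ : (F.pointMul g h).desc _ hIJ = (g.desc₂ h I.1 J.1 le_rfl le_rfl).comp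
        (Ideal.kerLiftAlg ((completedTensorProj k I J).comp F.Δ)).toRingHom :=
      Ideal.Quotient.ringHom_ext rfl
    have h₂ : (F.pointMul h l).desc _ hJK = (h.desc₂ l J.1 K.1 le_rfl le_rfl).comp
        (Ideal.kerLiftAlg ((completedTensorProj k J K).comp F.Δ)).toRingHom :=
      Ideal.Quotient.ringHom_ext rfl
    refine Eq.trans ?_ (key.trans ?_)
    · exact tensorLift_assoc_map _ _ _ _ _ _ _ h₁ _ _
    · exact tensorLift_map_right _ _ _ _ _ h₂ _ _
  one_mul g := by
    ext x
    rename_i K _ b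
    have h₁ := Pt.ker_le_ker_aug F.θ 1 b
    rw [F.pointMul_hom_apply (Pt.aug F.θ 1 _) g ⟨_, ker_mem_openIdeals F.θ 1⟩
      ⟨RingHom.ker g.hom, g.isOpen⟩ h₁ le_rfl]
    have key := congrArg (g.desc _ le_rfl) (F.counit ⟨RingHom.ker g.hom, g.isOpen⟩ x)
    refine Eq.trans ?_ key
    refine DFunLike.congr_fun (f := (Pt.aug F.θ 1 _).desc₂ g _ _ h₁ le_rfl)
      (g := (g.desc _ le_rfl).comp (Algebra.TensorProduct.productMap
        ((Algebra.ofId k (F.R ⧸ RingHom.ker g.hom)).comp (Ideal.kerLiftAlg (F.θ 1)))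
        (AlgHom.id k (F.R ⧸ RingHom.ker g.hom))).toRingHom)
      (tensorHom_ext (fun s => ?_) (fun s => ?_)) _
    · obtain ⟨s, rfl⟩ := Ideal.Quotient.mk_surjective s
      rw [← map_one (Ideal.Quotient.mk _), Pt.desc₂_tmul, map_one, mul_one]
      simp [Algebra.ofId_apply]
      exact (g.comm_apply _).symm
    · obtain ⟨s, rfl⟩ := Ideal.Quotient.mk_surjective s
      simp [Pt.desc₂]
  aug_mul V W := by
    ext x
    rename_i K _ b
    have h₁ := fun V => Pt.ker_le_ker_aug F.θ V b
    rw [F.pointMul_hom_apply (Pt.aug F.θ V _) (Pt.aug F.θ W _) ⟨_, ker_mem_openIdeals F.θ V⟩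
      ⟨_, ker_mem_openIdeals F.θ W⟩ (h₁ V) (h₁ W), Pt.aug_hom_apply, ← F.aug_comul]
    refine DFunLike.congr_fun (f := (Pt.aug F.θ V b).desc₂ (Pt.aug F.θ W b) _ _ (h₁ V) (h₁ W))
      (g := b.comp (Algebra.TensorProduct.productMap
        (Ideal.kerLiftAlg (F.θ V)) (Ideal.kerLiftAlg (F.θ W))).toRingHom)
      (tensorHom_ext (fun s => ?_) (fun s => ?_)) _ <;>
    · obtain ⟨s, rfl⟩ := Ideal.Quotient.mk_surjective s
      simp [Pt.desc₂]

end

section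

variable {R : Type u} [CommRing R] [Algebra k R] {θ : Γ → R →ₐ[k] k}

/-- The comultiplication corresponding to a group structure on points. -/
def _root_.PointMonoid.comul (m : PointMonoid θ) : R →ₐ[k] completedTensor k (openIdeals θ) where
  toFun x := ⟨fun p => (m.mul (Pt.left p.1 p.2) (Pt.right p.1 p.2)).hom x, fun p q h₁ h₂ => by
    refine (m.mul_hom_of_map (Algebra.TensorProduct.map (Ideal.Quotient.factorₐ k h₁)
      (Ideal.Quotient.factorₐ k h₂)).toRingHom (fun x => ?_) (fun x => ?_) x).symm <;>
    simp⟩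
  map_one' := Subtype.ext (funext fun _ => map_one _)
  map_mul' _ _ := Subtype.ext (funext fun _ => map_mul _ _ _)
  map_zero' := Subtype.ext (funext fun _ => map_zero _)
  map_add' _ _ := Subtype.ext (funext fun _ => map_add _ _ _)
  commutes' r := Subtype.ext (funext fun _ => Pt.comm_apply _ r)

theorem _root_.PointMonoid.proj_comul (m : PointMonoid θ) (I J : openIdeals θ) (x : R) :
    completedTensorProj k I J (m.comul x) = (m.mul (Pt.left I J) (Pt.right I J)).hom x := rfl

/-- An equivariant formal group law is determined by the group structure on points. -/
def ofPoints (m : PointMonoid θ) (y : R)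
    (complete : Function.Bijective (toIdealCompletion k (openIdeals θ)))
    (regular : y ∈ nonZeroDivisors R) (ker_aug : RingHom.ker (θ 1) = Ideal.span {y}) :
    EquivariantFGL Γ k where
  R := R
  θ := θ
  Δ := m.comul
  y := y
  complete := complete
  continuous_comul I J := (m.mul (Pt.left I J) (Pt.right I J)).isOpen
  cocomm I J x := by
    rw [m.proj_comul, m.proj_comul, m.mul_comm (Pt.left J I)]
    refine (m.mul_hom_of_map
      (Algebra.TensorProduct.comm k (R ⧸ I.1) (R ⧸ J.1)).toRingEquiv.toRingHom
      (fun x => ?_) (fun x => ?_) x).symm <;>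
    simp
  coassoc I J K x := by
    rw [m.proj_comul, m.proj_comul]
    -- Coassociativity is associativity for the three universal points with values in `(R/I) ⊗ (R/J)
    -- ⊗ (R/K)`; the other axioms are likewise read off at universal points.
    let T := AlgTensor k (R ⧸ I.1) (AlgTensor k (R ⧸ J.1) (R ⧸ K.1))
    let iI : (R ⧸ I.1) →ₐ[k] T := Algebra.TensorProduct.includeLeft
    let iJK : (AlgTensor k (R ⧸ J.1) (R ⧸ K.1)) →ₐ[k] T := Algebra.TensorProduct.includeRight
    let g : Pt θ (algebraMap k T) := Pt.ofAlgHom I iI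
    let h : Pt θ (algebraMap k T) := Pt.ofAlgHom J (iJK.comp Algebra.TensorProduct.includeLeft)
    let l : Pt θ (algebraMap k T) := Pt.ofAlgHom K (iJK.comp Algebra.TensorProduct.includeRight)
    let as : AlgTensor k (AlgTensor k (R ⧸ I.1) (R ⧸ J.1)) (R ⧸ K.1) →+* T :=
      (Algebra.TensorProduct.assoc k k k (R ⧸ I.1) (R ⧸ J.1) (R ⧸ K.1)).toRingEquiv.toRingHom
    have e₁ : ∀ x, (m.mul g h).hom x = as ((m.mul (Pt.left I J) (Pt.right I J)).hom x ⊗ₜ 1) :=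
      fun x => m.mul_hom_of_map (as.comp Algebra.TensorProduct.includeLeftRingHom)
        (fun x => rfl) (fun x => rfl) x
    have e₂ : ∀ x, (m.mul h l).hom x = 1 ⊗ₜ (m.mul (Pt.left J K) (Pt.right J K)).hom x :=
      fun x => m.mul_hom_of_map iJK.toRingHom
        (fun x => rfl) (fun x => rfl) x
    refine Eq.trans (Eq.symm ?_) ((congrArg (fun p => Pt.hom p x) (m.mul_assoc g h l)).trans ?_)
    · refine m.mul_hom_of_map (as.comp (Algebra.TensorProduct.map
        (Ideal.kerLiftAlg ((completedTensorProj k I J).comp m.comul))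
        (AlgHom.id k (R ⧸ K.1))).toRingHom) (fun x => ?_) (fun x => ?_) x
      · exact (e₁ x).symm
      · refine (congrArg as (Algebra.TensorProduct.map_tmul _ _ _ _)).trans ?_
        rw [map_one]
        rfl
    · refine m.mul_hom_of_map (Algebra.TensorProduct.map (AlgHom.id k (R ⧸ I.1))
        (Ideal.kerLiftAlg ((completedTensorProj k J K).comp m.comul))).toRingHom
        (fun x => ?_) (fun x => ?_) x
      · exact (Algebra.TensorProduct.map_tmul _ _ _ _).trans (by rw [map_one]; rfl)
      · exact (e₂ x).symm
  counit I x := by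
    rw [m.proj_comul]
    refine Eq.trans (Eq.symm ?_) (congrArg (fun p => Pt.hom p x) (m.one_mul (Pt.univ I)))
    refine m.mul_hom_of_map (Algebra.TensorProduct.productMap
      ((Algebra.ofId k (R ⧸ I.1)).comp (Ideal.kerLiftAlg (θ 1)))
      (AlgHom.id k (R ⧸ I.1))).toRingHom (fun x => ?_) (fun x => ?_) x
    · exact (Algebra.TensorProduct.productMap_apply_tmul _ _ _ _).trans
        (by rw [map_one, mul_one]; rfl)
    · exact (Algebra.TensorProduct.productMap_apply_tmul _ _ _ _).trans
        (by rw [map_one, one_mul]; rfl)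
  aug_comul V W x := by
    rw [m.proj_comul]
    refine Eq.trans (Eq.symm ?_)
      (congrArg (fun p => Pt.hom p x) (m.aug_mul (b := RingHom.id k) V W))
    refine m.mul_hom_of_map (Algebra.TensorProduct.productMap
      (Ideal.kerLiftAlg (θ V)) (Ideal.kerLiftAlg (θ W))).toRingHom
      (fun x => ?_) (fun x => ?_) x
    · exact (Algebra.TensorProduct.productMap_apply_tmul _ _ _ _).trans
        (by rw [map_one, mul_one]; rfl)
    · exact (Algebra.TensorProduct.productMap_apply_tmul _ _ _ _).trans
        (by rw [map_one, one_mul]; rfl)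
  regular := regular
  ker_aug := ker_aug

end

end EquivariantFGL

theorem EquivariantFGL.ofPoints_pointMul {Γ : Type} [CommGroup Γ] {k : Type u} [CommRing k]
    {R : Type u} [CommRing R] [Algebra k R] {θ : Γ → R →ₐ[k] k} (m : PointMonoid θ) (y : R)
    (complete : Function.Bijective (toIdealCompletion k (openIdeals θ)))
    (regular : y ∈ nonZeroDivisors R) (ker_aug : RingHom.ker (θ 1) = Ideal.span {y})
    {K : Type u} [CommRing K] {b : k →+* K} (g h : Pt θ b) :
    (EquivariantFGL.ofPoints m y complete regular ker_aug).pointMul g h = m.mul g h :=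
  Pt.ext fun x => (m.mul_hom_apply g h ⟨_, g.isOpen⟩ ⟨_, h.isOpen⟩ le_rfl le_rfl x).symm

/-! ### Completions -/

section Completion

variable {Γ : Type} {k R : Type u} [CommRing k] [CommRing R] [Algebra k R] (θ : Γ → R →ₐ[k] k)

/-- The completion of `R` for the topology defined by the augmentations. -/
abbrev AugCompletion : Type u := idealCompletion k (openIdeals θ)

variable {θ}

namespace AugCompletion

/-- The projection to the quotient by an open ideal. -/
def proj (I : openIdeals θ) : AugCompletion θ →ₐ[k] R ⧸ I.1 :=
  (Pi.evalAlgHom k (fun I : openIdeals θ => R ⧸ I.1) I).comp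
    (idealCompletion k (openIdeals θ)).val

theorem ext {z w : AugCompletion θ} (h : ∀ I, proj I z = proj I w) : z = w :=
  Subtype.ext (funext h)

@[simp]
theorem proj_toIdealCompletion (I : openIdeals θ) (r : R) :
    proj I (toIdealCompletion k (openIdeals θ) r) = Ideal.Quotient.mk I.1 r := rfl

theorem proj_eq_mk {I J : openIdeals θ} (h : I.1 ≤ J.1) {z : AugCompletion θ} {r : R}
    (hr : proj I z = Ideal.Quotient.mk I.1 r) : proj J z = Ideal.Quotient.mk J.1 r := by
  have := z.2 I J h
  change Ideal.Quotient.factorₐ k h (proj I z) = proj J z at this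
  rw [← this, hr]
  rfl

theorem proj_eq_zero {I J : openIdeals θ} (h : I.1 ≤ J.1) {z : AugCompletion θ}
    (hz : proj I z = 0) : proj J z = 0 := by
  rw [← map_zero (Ideal.Quotient.mk _)] at hz ⊢
  exact proj_eq_mk h hz

theorem exists_proj_eq_mk (I : openIdeals θ) (z : AugCompletion θ) :
    ∃ r, proj I z = Ideal.Quotient.mk I.1 r :=
  let ⟨r, hr⟩ := Ideal.Quotient.mk_surjective (proj I z)
  ⟨r, hr.symm⟩

variable (θ) in
/-- The augmentations of the completion. -/
def aug (V : Γ) : AugCompletion θ →ₐ[k] k :=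
  (Ideal.kerLiftAlg (θ V)).comp (proj ⟨_, ker_mem_openIdeals θ V⟩)

theorem aug_eq_zero_iff {V : Γ} {z : AugCompletion θ} :
    aug θ V z = 0 ↔ proj ⟨_, ker_mem_openIdeals θ V⟩ z = 0 :=
  map_eq_zero_iff _ (Ideal.kerLiftAlg_injective (θ V))

/-- A representative modulo `I ⊓ ker θ(V)` computes both projections simultaneously, and for an
element of the kernel it lies in `ker θ(V)`. -/
theorem map_proj_ker_aug_le (I : openIdeals θ) (V : Γ) :
    (RingHom.ker (aug θ V)).map (proj I) ≤ (RingHom.ker (θ V)).map (Ideal.Quotient.mk I.1) := by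
  rw [Ideal.map_le_iff_le_comap]
  intro z hz
  rw [RingHom.mem_ker, aug_eq_zero_iff] at hz
  obtain ⟨r, hr⟩ := exists_proj_eq_mk
    ⟨I.1 ⊓ RingHom.ker (θ V), openIdeals_inf I.2 (ker_mem_openIdeals θ V)⟩ z
  rw [Ideal.mem_comap, proj_eq_mk (J := I) inf_le_left hr]
  refine Ideal.mem_map_of_mem _ ?_
  rw [proj_eq_mk (J := ⟨_, ker_mem_openIdeals θ V⟩) inf_le_right hr] at hz
  exact Ideal.Quotient.eq_zero_iff_mem.1 hz

theorem ker_proj_mem_openIdeals (I : openIdeals θ) :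
    RingHom.ker (proj I) ∈ openIdeals (aug θ) := by
  obtain ⟨s, hs⟩ := I.2
  refine ⟨s, ?_⟩
  rw [← Ideal.map_eq_bot_iff_le_ker]
  have h₁ : ∀ {S T : Type u} [CommRing S] [CommRing T] (q : Multiset (Ideal S)) (f : S →+* T),
      q.prod.map f = (q.map (Ideal.map f)).prod :=
    fun q f => map_multiset_prod (Ideal.mapHom f) q
  have h₂ := h₁ (s.map fun V => RingHom.ker (aug θ V)) (proj I).toRingHom
  have h₃ := h₁ (s.map fun V => RingHom.ker (θ V)) (Ideal.Quotient.mk I.1)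
  rw [Multiset.map_map] at h₂ h₃
  refine eq_bot_iff.2 (h₂.le.trans ((Multiset.prod_map_le_prod_map₀ _ _ (fun _ _ => bot_le)
    fun V _ => map_proj_ker_aug_le I V).trans (h₃.ge.trans ?_)))
  exact ((Ideal.map_eq_bot_iff_le_ker _).2 (hs.trans (Ideal.mk_ker (I := I.1)).ge)).le

variable {y : Γ → R} (hy : ∀ V, RingHom.ker (θ V) = Ideal.span {y V})

include hy in
theorem prod_ker_eq_span (s : Multiset Γ) :
    (s.map fun V => RingHom.ker (θ V)).prod = Ideal.span {(s.map y).prod} := by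
  induction s using Multiset.induction_on with
  | empty => simp
  | cons V s ih =>
    rw [Multiset.map_cons, Multiset.prod_cons, ih, hy, Ideal.span_singleton_mul_span_singleton,
      Multiset.map_cons, Multiset.prod_cons]

/-- The open ideal generated by a product of the chosen generators. -/
def spanProd (s : Multiset Γ) : openIdeals θ :=
  ⟨Ideal.span {(s.map y).prod}, s, (prod_ker_eq_span hy s).le⟩

theorem exists_spanProd_le (I : openIdeals θ) : ∃ s, (spanProd hy s).1 ≤ I.1 :=
  let ⟨s, hs⟩ := I.2
  ⟨s, (prod_ker_eq_span hy s).ge.trans hs⟩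

theorem spanProd_add_le_right (s t : Multiset Γ) : (spanProd hy (s + t)).1 ≤ (spanProd hy t).1 := by
  refine Ideal.span_singleton_le_span_singleton.2 ?_
  rw [Multiset.map_add, Multiset.prod_add]
  exact dvd_mul_left _ _

theorem spanProd_add_le_left (s t : Multiset Γ) : (spanProd hy (s + t)).1 ≤ (spanProd hy s).1 := by
  rw [add_comm]
  exact spanProd_add_le_right hy t s

variable (hreg : ∀ V, y V ∈ nonZeroDivisors R)

include hreg in
theorem prod_mem_nonZeroDivisors (s : Multiset Γ) : (s.map y).prod ∈ nonZeroDivisors R := by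
  induction s using Multiset.induction_on with
  | empty => simp
  | cons V s ih =>
    rw [Multiset.map_cons, Multiset.prod_cons]
    exact mul_mem (hreg V) ih

include hreg in
theorem mem_spanProd_of_mul_mem {s t : Multiset Γ} {r : R}
    (h : (s.map y).prod * r ∈ (spanProd hy (s + t)).1) : r ∈ (spanProd hy t).1 := by
  obtain ⟨c, hc⟩ := Ideal.mem_span_singleton'.1 h
  rw [Multiset.map_add, Multiset.prod_add] at hc
  refine Ideal.mem_span_singleton'.2 ⟨c, ?_⟩
  refine (mul_cancel_left_mem_nonZeroDivisors (prod_mem_nonZeroDivisors hreg s)).1 ?_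
  rw [← hc]
  ring

include hreg in
/-- Elements that vanish modulo `∏ y V` are divisible by `∏ y V`. -/
theorem exists_eq_mul_of_proj_eq_zero {s : Multiset Γ} {z : AugCompletion θ}
    (hz : proj (spanProd hy s) z = 0) :
    ∃ w, z = toIdealCompletion k (openIdeals θ) (s.map y).prod * w := by
  -- To divide by the product over `s` with precision `t`, one represents `z` modulo the product
  -- over `s + t`. Regularity makes the quotients `w t` well defined modulo the product over `t`, so
  -- they fit together.
  choose r hr using fun t => exists_proj_eq_mk (spanProd hy (s + t)) z
  have hw : ∀ t, ∃ w, r t = (s.map y).prod * w := by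
    intro t
    have := proj_eq_mk (spanProd_add_le_left hy s t) (hr t)
    rw [hz, eq_comm, Ideal.Quotient.eq_zero_iff_mem] at this
    obtain ⟨c, hc⟩ := Ideal.mem_span_singleton'.1 this
    exact ⟨c, by rw [← hc, mul_comm]⟩
  choose w hw using hw
  have compat : ∀ t t' : Multiset Γ, w t - w (t + t') ∈ (spanProd hy t).1 := by
    intro t t'
    apply mem_spanProd_of_mul_mem hy hreg (s := s)
    rw [mul_sub, ← hw, ← hw]
    have : (spanProd hy (s + (t + t'))).1 ≤ (spanProd hy (s + t)).1 := by
      rw [← add_assoc]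
      exact spanProd_add_le_left hy _ _
    have h := proj_eq_mk this (hr (t + t'))
    rw [hr t] at h
    exact Ideal.Quotient.eq.1 h
  have compat' : ∀ (t t' : Multiset Γ) (I : Ideal R), (spanProd hy t).1 ≤ I →
      (spanProd hy t').1 ≤ I → Ideal.Quotient.mk I (w t) = Ideal.Quotient.mk I (w t') := by
    intro t t' I ht ht'
    refine (Ideal.Quotient.eq.2 (ht (compat t t'))).trans ?_
    rw [add_comm]
    exact (Ideal.Quotient.eq.2 (ht' (compat t' t))).symm
  choose t ht using exists_spanProd_le hy
  refine ⟨⟨fun I => Ideal.Quotient.mk I.1 (w (t I)), fun I J h =>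
    compat' _ _ _ ((ht I).trans h) (ht J)⟩, ext fun I => ?_⟩
  rw [proj_eq_mk ((spanProd_add_le_right hy s (t I)).trans (ht I)) (hr (t I)), hw, map_mul, map_mul]
  rfl

include hy hreg in
theorem toIdealCompletion_mem_nonZeroDivisors (V : Γ) :
    toIdealCompletion k (openIdeals θ) (y V) ∈ nonZeroDivisors (AugCompletion θ) := by
  refine mem_nonZeroDivisors_iff_right.2 fun z hz => ext fun I => ?_
  obtain ⟨t, ht⟩ := exists_spanProd_le hy I
  obtain ⟨r, hr⟩ := exists_proj_eq_mk (spanProd hy ({V} + t)) z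
  rw [proj_eq_mk ((spanProd_add_le_right hy _ _).trans ht) hr, map_zero,
    Ideal.Quotient.eq_zero_iff_mem]
  refine ht (mem_spanProd_of_mul_mem hy hreg (s := {V}) ?_)
  have := congrArg (proj (spanProd hy ({V} + t))) hz
  rw [map_mul, hr, proj_toIdealCompletion, ← map_mul, map_zero, Ideal.Quotient.eq_zero_iff_mem]
    at this
  rwa [Multiset.map_singleton, Multiset.prod_singleton, mul_comm]

include hreg in
theorem ker_proj_spanProd (s : Multiset Γ) :
    RingHom.ker (proj (spanProd hy s)) =
      Ideal.span {toIdealCompletion k (openIdeals θ) (s.map y).prod} := by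
  refine le_antisymm (fun z hz => ?_) ?_
  · obtain ⟨w, rfl⟩ := exists_eq_mul_of_proj_eq_zero hy hreg hz
    exact Ideal.mul_mem_right _ _ (Ideal.mem_span_singleton_self _)
  · rw [Ideal.span_singleton_le_iff_mem, RingHom.mem_ker, proj_toIdealCompletion,
      Ideal.Quotient.eq_zero_iff_mem]
    exact Ideal.mem_span_singleton_self _

include hy hreg in
theorem ker_aug (V : Γ) :
    RingHom.ker (aug θ V) = Ideal.span {toIdealCompletion k (openIdeals θ) (y V)} := by
  have h : ({V} : Multiset Γ).map y = {y V} := Multiset.map_singleton _ _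
  have := ker_proj_spanProd hy hreg {V}
  rw [h, Multiset.prod_singleton] at this
  rw [← this]
  ext z
  rw [RingHom.mem_ker, RingHom.mem_ker, aug_eq_zero_iff]
  have h₁ : (spanProd hy {V}).1 = RingHom.ker (θ V) := by
    change Ideal.span {(Multiset.map y {V}).prod} = _
    rw [hy, h, Multiset.prod_singleton]
  exact ⟨proj_eq_zero h₁.ge, proj_eq_zero h₁.le⟩

-- Since the kernels are principal with regular generators, the kernel of a projection is generated
-- by a product of the generators, hence equals the product of the augmentation kernels. These
-- kernels are therefore cofinal among the open ideals of the completion.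
include hreg in
theorem exists_ker_proj_le (J : openIdeals (aug θ)) :
    ∃ s, RingHom.ker (proj (spanProd hy s)) ≤ J.1 := by
  obtain ⟨s, hs⟩ := J.2
  refine ⟨s, le_trans ?_ hs⟩
  rw [ker_proj_spanProd hy hreg, prod_ker_eq_span (ker_aug hy hreg), map_multiset_prod,
    Multiset.map_map]
  rfl

-- The kernels of the projections to the quotients of `R` are open, which gives separation. They are
-- also cofinal by `exists_ker_proj_le`, so the projections of a compatible family assemble to a
-- single element of the completion inducing it.
include hy hreg in
theorem complete :
    Function.Bijective (toIdealCompletion k (openIdeals (aug θ))) := by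
  constructor
  · refine (injective_iff_map_eq_zero _).2 fun z hz => ext fun I => ?_
    have := congrArg (fun w => w.1 ⟨_, ker_proj_mem_openIdeals I⟩) hz
    exact (RingHom.mem_ker).1 (Ideal.Quotient.eq_zero_iff_mem.1 this)
  · intro ξ
    choose x hx using exists_proj_eq_mk (θ := aug θ) (z := ξ)
    have compat : ∀ I J : openIdeals θ, I.1 ≤ J.1 →
        proj J (x ⟨_, ker_proj_mem_openIdeals I⟩) = proj J (x ⟨_, ker_proj_mem_openIdeals J⟩) := by
      intro I J h
      have h₁ := proj_eq_mk (I := ⟨_, ker_proj_mem_openIdeals I⟩)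
        (J := ⟨_, ker_proj_mem_openIdeals J⟩) (fun z hz => proj_eq_zero h hz) (hx _)
      rw [hx, Ideal.Quotient.eq] at h₁
      have h₂ : proj J _ = 0 := h₁
      rw [map_sub, sub_eq_zero] at h₂
      exact h₂.symm
    refine ⟨⟨fun I => proj I (x ⟨_, ker_proj_mem_openIdeals I⟩), fun I J h => ?_⟩, ext fun J => ?_⟩
    · exact ((x ⟨_, ker_proj_mem_openIdeals I⟩).2 I J h).trans (compat I J h)
    · obtain ⟨s, hs⟩ := exists_ker_proj_le hy hreg J
      have h₁ := proj_eq_mk (I := ⟨_, ker_proj_mem_openIdeals (spanProd hy s)⟩) (J := J) hs (hx _)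
      rw [h₁, proj_toIdealCompletion, Ideal.Quotient.eq]
      refine hs ?_
      rw [RingHom.mem_ker, map_sub, sub_eq_zero]
      rfl

end AugCompletion

end Completion

/-! ### Points of a completion. -/

section CompletionPoints

variable {Γ : Type} {k R : Type u} [CommRing k] [CommRing R] [Algebra k R] {θ : Γ → R →ₐ[k] k}
  {K K' : Type u} [CommRing K] [CommRing K'] {b : k →+* K}

namespace AugCompletion

/-- The extension of a point to the completion. -/
def extend (g : Pt θ b) : Pt (aug θ) b where
  hom := (g.desc _ le_rfl).comp (proj ⟨_, g.isOpen⟩).toRingHom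
  comm := RingHom.ext fun r => g.comm_apply r
  isOpen := openIdeals_mono (ker_proj_mem_openIdeals ⟨_, g.isOpen⟩) fun z hz => by
    rw [RingHom.mem_ker] at hz ⊢
    exact (congrArg (g.desc _ le_rfl) hz).trans (map_zero _)

theorem extend_hom_apply (g : Pt θ b) (I : openIdeals θ) (hI : I.1 ≤ RingHom.ker g.hom)
    (z : AugCompletion θ) : (extend g).hom z = g.desc I.1 hI (proj I z) := by
  obtain ⟨r, hr⟩ := exists_proj_eq_mk I z
  have := proj_eq_mk (J := ⟨_, g.isOpen⟩) hI hr
  rw [hr, Pt.desc_mk]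
  exact (congrArg (g.desc _ le_rfl) this).trans rfl

variable {y : Γ → R} (hy : ∀ V, RingHom.ker (θ V) = Ideal.span {y V})
  (hreg : ∀ V, y V ∈ nonZeroDivisors R)

/-- The restriction of a point of the completion. -/
def restrict (g : Pt (aug θ) b) : Pt θ b where
  hom := g.hom.comp (toIdealCompletion k (openIdeals θ)).toRingHom
  comm := g.comm
  isOpen := by
    obtain ⟨s, hs⟩ := exists_ker_proj_le hy hreg ⟨_, g.isOpen⟩
    refine openIdeals_mono (spanProd hy s).2 fun r hr => hs ?_
    rw [RingHom.mem_ker]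
    exact Ideal.Quotient.eq_zero_iff_mem.2 hr

@[simp]
theorem restrict_hom_apply (g : Pt (aug θ) b) (r : R) :
    (restrict hy hreg g).hom r = g.hom (toIdealCompletion k (openIdeals θ) r) := rfl

@[simp]
theorem extend_restrict (g : Pt (aug θ) b) : extend (restrict hy hreg g) = g := by
  ext z
  obtain ⟨s, hs⟩ := exists_ker_proj_le hy hreg ⟨_, g.isOpen⟩
  have hI : (spanProd hy s).1 ≤ RingHom.ker (restrict hy hreg g).hom := fun r hr => by
    refine hs ?_
    rw [RingHom.mem_ker]
    exact Ideal.Quotient.eq_zero_iff_mem.2 hr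
  obtain ⟨r, hr⟩ := exists_proj_eq_mk (spanProd hy s) z
  rw [extend_hom_apply _ (spanProd hy s) hI, hr, Pt.desc_mk, restrict_hom_apply, ← sub_eq_zero,
    ← map_sub]
  refine hs ?_
  rw [RingHom.mem_ker, map_sub, hr, proj_toIdealCompletion, sub_self]

/-- A point of the completion kills the kernel of some projection, hence is determined on the image
of `R`. Identities between points of the completion can thus be checked before completing. -/
theorem restrict_injective :
    Function.Injective (restrict hy hreg : Pt (aug θ) b → Pt θ b) := fun g h H => by
  rw [← extend_restrict hy hreg g, H, extend_restrict]

variable [CommGroup Γ]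

/-- The group structure on the points of the completion. -/
def pointMonoid (m : PointMonoid θ) : PointMonoid (aug θ) where
  mul g h := extend (m.mul (restrict hy hreg g) (restrict hy hreg h))
  map_mul j _ _ _ := restrict_injective hy hreg
    (m.map_mul j _ _)
  mul_comm _ _ := congrArg extend (m.mul_comm _ _)
  mul_assoc _ _ _ := congrArg extend (m.mul_assoc _ _ _)
  one_mul _ := restrict_injective hy hreg (m.one_mul _)
  aug_mul V W := restrict_injective hy hreg (m.aug_mul V W)

end AugCompletion

/-- The equivariant formal group law obtained by completion from an algebra with augmentations
whose kernels are generated by regular elements, and a group structure on points. -/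
def EquivariantFGL.ofCompletion [CommGroup Γ] {y : Γ → R}
    (hy : ∀ V, RingHom.ker (θ V) = Ideal.span {y V})
    (hreg : ∀ V, y V ∈ nonZeroDivisors R) (m : PointMonoid θ) : EquivariantFGL Γ k :=
  EquivariantFGL.ofPoints (AugCompletion.pointMonoid hy hreg m)
    (toIdealCompletion k (openIdeals θ) (y 1)) (AugCompletion.complete hy hreg)
    (AugCompletion.toIdealCompletion_mem_nonZeroDivisors hy hreg 1)
    (AugCompletion.ker_aug hy hreg 1)

end CompletionPoints

/-! ### Translations -/

namespace EquivariantFGL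

variable {Γ : Type} [CommGroup Γ] {k : Type u} [CommRing k] (F : EquivariantFGL Γ k)

theorem eq_of_mk_eq {x x' : F.R}
    (h : ∀ I : openIdeals F.θ, Ideal.Quotient.mk I.1 x = Ideal.Quotient.mk I.1 x') : x = x' :=
  F.complete.1 (Subtype.ext (funext h))

/-- A compatible family of points over the universal quotients, as an element of `R`. -/
theorem exists_mk_eq (x : ∀ I : openIdeals F.θ, F.R ⧸ I.1)
    (hx : ∀ (I J : openIdeals F.θ) (h : I.1 ≤ J.1), Ideal.Quotient.factor h (x I) = x J) :
    ∃ z, ∀ I : openIdeals F.θ, Ideal.Quotient.mk I.1 z = x I := by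
  obtain ⟨z, hz⟩ := F.complete.2 ⟨x, hx⟩
  exact ⟨z, fun I => congrArg (fun w => w.1 I) hz⟩

/-- The homomorphism `S → R` defined by a compatible family of homomorphisms `S → R/I`. -/
theorem exists_ringHom {S : Type*} [CommRing S] (f : ∀ I : openIdeals F.θ, S →+* F.R ⧸ I.1)
    (hf : ∀ (I J : openIdeals F.θ) (h : I.1 ≤ J.1), (Ideal.Quotient.factor h).comp (f I) = f J) :
    ∃ φ : S →+* F.R, ∀ (I : openIdeals F.θ) (x : S), Ideal.Quotient.mk I.1 (φ x) = f I x := by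
  choose φ hφ using fun x => F.exists_mk_eq (fun I => f I x)
    fun I J h => DFunLike.congr_fun (hf I J h) x
  refine ⟨⟨⟨⟨φ, ?_⟩, ?_⟩, ?_, ?_⟩, fun I x => hφ x I⟩
  · exact F.eq_of_mk_eq fun I => by rw [hφ, map_one, map_one]
  · exact fun x y => F.eq_of_mk_eq fun I => by rw [hφ, map_mul, map_mul, hφ, hφ]
  · exact F.eq_of_mk_eq fun I => (hφ 0 I).trans (by rw [map_zero, map_zero])
  · exact fun x y => F.eq_of_mk_eq fun I => (hφ _ I).trans (by rw [map_add, map_add, ← hφ, ← hφ])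

/-- Translation by a character. -/
theorem exists_translation (V : Γ) : ∃ l : F.R →+* F.R,
    ∀ {K : Type u} [CommRing K] {b : k →+* K} (p : Pt F.θ b) (x : F.R),
      p.hom (l x) = (F.pointMul (Pt.aug F.θ V b) p).hom x := by
  -- By naturality the translate of any point is computed from the translates of the universal
  -- points `R → R/I`. The latter are compatible, and completeness assembles them into an
  -- endomorphism of `R`.
  have key : ∀ {K : Type u} [CommRing K] {b : k →+* K} (p : Pt F.θ b) (I : openIdeals F.θ)
      (hI : I.1 ≤ RingHom.ker p.hom) (x : F.R), (F.pointMul (Pt.aug F.θ V b) p).hom x =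
        p.desc I.1 hI ((F.pointMul (Pt.aug F.θ V _) (Pt.univ I)).hom x) := by
    intro K _ b p I hI x
    refine F.points.mul_hom_of_map (p.desc I.1 hI) (fun x => ?_) (fun x => rfl) x
    exact p.comm_apply _
  obtain ⟨l, hl⟩ := F.exists_ringHom
    (fun I => (F.pointMul (Pt.aug F.θ V _) (Pt.univ I)).hom) (fun I J h => by
      ext x
      exact (key (Pt.univ J) I (h.trans (Ideal.mk_ker (I := J.1)).ge) x).symm)
  refine ⟨l, fun {K _ b} p x => ?_⟩
  rw [key p ⟨_, p.isOpen⟩ le_rfl, ← hl]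
  rfl

/-- Translation by a character. -/
def translation (V : Γ) : F.R →+* F.R := (F.exists_translation V).choose

theorem hom_translation {K : Type u} [CommRing K] {b : k →+* K} (p : Pt F.θ b) (V : Γ) (x : F.R) :
    p.hom (F.translation V x) = (F.pointMul (Pt.aug F.θ V b) p).hom x :=
  (F.exists_translation V).choose_spec p x

theorem translation_translation (V W : Γ) (x : F.R) :
    F.translation V (F.translation W x) = F.translation (W * V) x := by
  refine F.eq_of_mk_eq fun I => ?_
  have h := fun x V => F.hom_translation (Pt.univ I) V x
  simp only [Pt.univ_hom_apply] at h
  rw [h, F.hom_translation, h]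
  exact congrArg (fun p => Pt.hom p x) ((F.points.mul_assoc _ _ _).symm.trans
    (congrArg (fun p => F.pointMul p _) (F.points.aug_mul W V)))

theorem translation_one (x : F.R) : F.translation 1 x = x := by
  refine F.eq_of_mk_eq fun I => ?_
  exact (F.hom_translation (Pt.univ I) 1 x).trans
    (congrArg (fun p => Pt.hom p x) (F.points.one_mul _))

theorem aug_translation (V W : Γ) (x : F.R) : F.θ V (F.translation W x) = F.θ (W * V) x :=
  (F.hom_translation (Pt.aug F.θ V (RingHom.id k)) W x).trans
    (congrArg (fun p => Pt.hom p x) (F.points.aug_mul W V))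

/-- The generators of the kernels of the augmentations. -/
def yTranslate (V : Γ) : F.R := F.translation V⁻¹ F.y

theorem yTranslate_one : F.yTranslate 1 = F.y := by
  rw [yTranslate, inv_one, translation_one]

/-- Translation by `V` is an automorphism of the ring that carries `ker θ(V)` to `ker θ(1) = (y)`.
Regularity of `yTranslate V` follows in the same way from that of `y`. -/
theorem ker_aug_eq_span (V : Γ) : RingHom.ker (F.θ V) = Ideal.span {F.yTranslate V} := by
  ext x
  rw [RingHom.mem_ker, Ideal.mem_span_singleton']
  constructor
  · intro hx
    have : F.translation V x ∈ RingHom.ker (F.θ 1) := by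
      rw [RingHom.mem_ker, aug_translation, mul_one, hx]
    rw [F.ker_aug] at this
    obtain ⟨c, hc⟩ := Ideal.mem_span_singleton'.1 this
    refine ⟨F.translation V⁻¹ c, ?_⟩
    rw [yTranslate, ← map_mul, hc, translation_translation, mul_inv_cancel, translation_one]
  · rintro ⟨c, rfl⟩
    have : F.y ∈ RingHom.ker (F.θ 1) := by
      rw [F.ker_aug]
      exact Ideal.mem_span_singleton_self _
    rw [map_mul, yTranslate, aug_translation, inv_mul_cancel, (RingHom.mem_ker).1 this, mul_zero]

theorem yTranslate_mem_nonZeroDivisors (V : Γ) : F.yTranslate V ∈ nonZeroDivisors F.R := by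
  refine mem_nonZeroDivisors_iff_right.2 fun x hx => ?_
  have := congrArg (F.translation V) hx
  rw [map_mul, yTranslate, translation_translation, inv_mul_cancel, translation_one, map_zero] at this
  have h := mem_nonZeroDivisors_iff_right.1 F.regular _ this
  rw [← translation_one F x, ← mul_inv_cancel V, ← translation_translation, h, map_zero]

/-! ### Pushforwards -/

variable {Γ' : Type} [CommGroup Γ'] (φ : Γ' →* Γ)

theorem openIdeals_comp_le {I : Ideal F.R} (hI : I ∈ openIdeals fun V => F.θ (φ V)) :
    I ∈ openIdeals F.θ := by
  obtain ⟨s, hs⟩ := hI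
  exact ⟨s.map φ, by rwa [Multiset.map_map]⟩

/-- The inclusion of points for the coarser topology. -/
def inclPt {K : Type u} [CommRing K] {b : k →+* K} (g : Pt (fun V => F.θ (φ V)) b) : Pt F.θ b :=
  ⟨g.hom, g.comm, F.openIdeals_comp_le φ g.isOpen⟩

theorem inclPt_injective {K : Type u} [CommRing K] {b : k →+* K} :
    Function.Injective (F.inclPt φ : Pt (fun V => F.θ (φ V)) b → _) := fun _ _ H =>
  Pt.ext fun x => congrArg (fun p : Pt F.θ b => p.hom x) H

theorem inclPt_aug {K : Type u} [CommRing K] {b : k →+* K} (V : Γ') :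
    F.inclPt φ (Pt.aug (fun V => F.θ (φ V)) V b) = Pt.aug F.θ (φ V) b := rfl

/-- The product of points for the coarser topology. -/
def pushforwardMul {K : Type u} [CommRing K] {b : k →+* K} (g h : Pt (fun V => F.θ (φ V)) b) :
    Pt (fun V => F.θ (φ V)) b where
  hom := (F.pointMul (F.inclPt φ g) (F.inclPt φ h)).hom
  comm := (F.pointMul (F.inclPt φ g) (F.inclPt φ h)).comm
  isOpen := by
    obtain ⟨s, hs⟩ := g.isOpen
    obtain ⟨t, ht⟩ := h.isOpen
    refine ⟨(s ×ˢ t).map fun p => p.1 * p.2, ?_⟩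
    -- Both families are `φ`, and `φ V * φ W = φ (V * W)` stays in the image of `φ`; this is why the
    -- product is continuous for the coarser topology.
    have := F.points.prod_ker_le_ker_mul (F.inclPt φ g) (F.inclPt φ h) φ φ hs ht
    rw [Multiset.map_map]
    simp only [Function.comp_def, map_mul]
    exact this

theorem inclPt_pushforwardMul {K : Type u} [CommRing K] {b : k →+* K}
    (g h : Pt (fun V => F.θ (φ V)) b) :
    F.inclPt φ (F.pushforwardMul φ g h) = F.points.mul (F.inclPt φ g) (F.inclPt φ h) := rfl

/-- The group structure on the points for the coarser topology. -/
def pushforwardPoints : PointMonoid (fun V => F.θ (φ V)) where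
  mul := F.pushforwardMul φ
  map_mul j _ g h := F.inclPt_injective φ (F.points.map_mul j (F.inclPt φ g) (F.inclPt φ h))
  mul_comm _ _ := F.inclPt_injective φ (F.points.mul_comm _ _)
  mul_assoc _ _ _ := F.inclPt_injective φ (F.points.mul_assoc _ _ _)
  one_mul g := F.inclPt_injective φ (by
    rw [inclPt_pushforwardMul, inclPt_aug, map_one, F.points.one_mul])
  aug_mul V W := F.inclPt_injective φ (by
    rw [inclPt_pushforwardMul, inclPt_aug, inclPt_aug, F.points.aug_mul, inclPt_aug, map_mul])

/-- The pushforward of an equivariant formal group law. -/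
def pushforward : EquivariantFGL Γ' k :=
  ofCompletion (y := fun V => F.yTranslate (φ V)) (fun V => F.ker_aug_eq_span (φ V))
    (fun V => F.yTranslate_mem_nonZeroDivisors (φ V)) (F.pushforwardPoints φ)

end EquivariantFGL

/-! ### Morphisms in terms of points -/

section Pullback

variable {Γ Γ' : Type} {k k' R R' : Type u} [CommRing k] [CommRing k'] [CommRing R] [CommRing R']
  [Algebra k R] [Algebra k' R'] {θ' : Γ' → R' →ₐ[k'] k'} {θ : Γ → R →ₐ[k] k}

/-- The pullback of a point along a homomorphism compatible with the augmentations. -/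
def Pt.pullback (base : k →+* k') (ρ : R →+* R')
    (comm : ρ.comp (algebraMap k R) = (algebraMap k' R').comp base) (φ : Γ' → Γ)
    (aug : ∀ V x, θ' V (ρ x) = base (θ (φ V) x)) {K : Type u} [CommRing K] {b : k' →+* K}
    (g : Pt θ' b) : Pt θ (b.comp base) where
  hom := g.hom.comp ρ
  comm := by
    ext r
    have := DFunLike.congr_fun comm r
    rw [RingHom.comp_apply, RingHom.comp_apply] at this
    rw [RingHom.comp_apply, RingHom.comp_apply, this, RingHom.comp_apply, g.comm_apply]
  isOpen := comap_mem_openIdeals ρ φ (fun V x hx => by rw [aug, hx, map_zero]) g.isOpen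

end Pullback

namespace EquivariantFGL

variable {Γ Γ' Γ'' : Type} [CommGroup Γ] [CommGroup Γ'] [CommGroup Γ'']
variable {k k' k'' : Type u} [CommRing k] [CommRing k'] [CommRing k'']

/-- Yoneda: the comultiplication is the product of the two universal points. -/
theorem comul_eq_pointMul (F : EquivariantFGL Γ k) (I J : openIdeals F.θ) (x : F.R) :
    F.comul I J x = (F.pointMul (Pt.left I J) (Pt.right I J)).hom x := by
  rw [F.pointMul_hom_apply (Pt.left I J) (Pt.right I J) I J (fun x hx => by
      rw [RingHom.mem_ker, Pt.left_hom_apply, Ideal.Quotient.eq_zero_iff_mem.2 hx,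
        TensorProduct.zero_tmul]) (fun x hx => by
      rw [RingHom.mem_ker, Pt.right_hom_apply, Ideal.Quotient.eq_zero_iff_mem.2 hx,
        TensorProduct.tmul_zero])]
  refine DFunLike.congr_fun (f := RingHom.id _) (tensorHom_ext (fun s => ?_) (fun s => ?_)) _ <;>
  · obtain ⟨s, rfl⟩ := Ideal.Quotient.mk_surjective s
    simp [Pt.desc₂]

/-- Morphisms of equivariant formal group laws along a homomorphism of character groups, in terms
of points. -/
structure PointHom (φ : Γ' →* Γ) (F : EquivariantFGL Γ k) (F' : EquivariantFGL Γ' k') where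
  base : k →+* k'
  ring : F.R →+* F'.R
  comm : ring.comp (algebraMap k F.R) = (algebraMap k' F'.R).comp base
  aug : ∀ V x, F'.θ V (ring x) = base (F.θ (φ V) x)
  orientation : ring F.y = F'.y
  pullback_mul : ∀ {K : Type u} [CommRing K] {b : k' →+* K} (g h : Pt F'.θ b),
    (F'.pointMul g h).pullback base ring comm φ aug =
      F.pointMul (g.pullback base ring comm φ aug) (h.pullback base ring comm φ aug)

namespace PointHom

variable {φ : Γ' →* Γ} {F' : EquivariantFGL Γ' k'} {F : EquivariantFGL Γ k}

/-- The map on points induced by a morphism. -/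
def pullback (f : PointHom φ F F') {K : Type u} [CommRing K] {b : k' →+* K} (g : Pt F'.θ b) :
    Pt F.θ (b.comp f.base) :=
  g.pullback f.base f.ring f.comm φ f.aug

@[simp]
theorem pullback_hom_apply (f : PointHom φ F F') {K : Type u} [CommRing K] {b : k' →+* K}
    (g : Pt F'.θ b) (x : F.R) : (f.pullback g).hom x = g.hom (f.ring x) := rfl

theorem pullback_aug (f : PointHom φ F F') {K : Type u} [CommRing K] (b : k' →+* K) (V : Γ') :
    f.pullback (Pt.aug F'.θ V b) = Pt.aug F.θ (φ V) (b.comp f.base) := by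
  ext x
  simp [f.aug]

theorem comul_ring (f : PointHom φ F F') (I J : openIdeals F'.θ) (hI : I.1.comap f.ring ∈ openIdeals F.θ)
    (hJ : J.1.comap f.ring ∈ openIdeals F.θ) (hI') (hJ') (x : F.R) :
    F'.comul I J (f.ring x) = Algebra.TensorProduct.mapRingHom f.base
        (Ideal.quotientMap I.1 f.ring le_rfl)
        (Ideal.quotientMap J.1 f.ring le_rfl) hI' hJ' (F.comul ⟨_, hI⟩ ⟨_, hJ⟩ x) := by
  rw [comul_eq_pointMul]
  refine (congrArg (fun p => Pt.hom p x) (f.pullback_mul _ _)).trans ?_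
  rw [F.pointMul_hom_apply _ _ ⟨_, hI⟩ ⟨_, hJ⟩ (fun x hx => by
      rw [RingHom.mem_ker]
      change (Pt.left I J).hom (f.ring x) = 0
      rw [Pt.left_hom_apply, Ideal.Quotient.eq_zero_iff_mem.2 (Ideal.mem_comap.1 hx),
        TensorProduct.zero_tmul]) (fun x hx => by
      rw [RingHom.mem_ker]
      change (Pt.right I J).hom (f.ring x) = 0
      rw [Pt.right_hom_apply, Ideal.Quotient.eq_zero_iff_mem.2 (Ideal.mem_comap.1 hx),
        TensorProduct.tmul_zero])]
  refine DFunLike.congr_fun (tensorHom_ext (fun s => ?_) (fun s => ?_)) _ <;>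
  · obtain ⟨s, rfl⟩ := Ideal.Quotient.mk_surjective s
    simp [Pt.desc₂, Pt.pullback]

/-- A morphism for a fixed group, in terms of points, is a morphism. -/
def toHom {F : EquivariantFGL Γ k} {F' : EquivariantFGL Γ k'}
    (f : PointHom (MonoidHom.id Γ) F F') : F.Hom F' where
  base := f.base
  toRingHom := f.ring
  map_algebraMap := f.comm
  map_aug := f.aug
  map_orientation := f.orientation
  map_comul I J x := f.comul_ring I J _ _ _ _ x

/-- Composition of morphisms. -/
def comp {ψ : Γ'' →* Γ'} {F'' : EquivariantFGL Γ'' k''} (f' : PointHom ψ F' F'')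
    (f : PointHom φ F F') : PointHom (φ.comp ψ) F F'' where
  base := f'.base.comp f.base
  ring := f'.ring.comp f.ring
  comm := by
    rw [RingHom.comp_assoc, f.comm, ← RingHom.comp_assoc, f'.comm, RingHom.comp_assoc]
  aug V x := by
    simp only [RingHom.comp_apply, f'.aug, f.aug]
    rfl
  orientation := by rw [RingHom.comp_apply, f.orientation, f'.orientation]
  pullback_mul g h :=
    (congrArg f.pullback (f'.pullback_mul g h)).trans (f.pullback_mul _ _)

end PointHom

/-- Morphisms in terms of points. -/
def Hom.toPointHom {F : EquivariantFGL Γ k} {F' : EquivariantFGL Γ k'} (f : F.Hom F') :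
    PointHom (MonoidHom.id Γ) F F' where
  base := f.base
  ring := f.toRingHom
  comm := f.map_algebraMap
  aug := f.map_aug
  orientation := f.map_orientation
  pullback_mul {K _ b} g h := by
    ext x
    refine (congrArg (g.desc₂ h _ _ le_rfl le_rfl)
      (f.map_comul ⟨_, g.isOpen⟩ ⟨_, h.isOpen⟩ x)).trans ?_
    rw [F.pointMul_hom_apply _ _ ⟨(RingHom.ker g.hom).comap f.toRingHom,
      (g.pullback f.base f.toRingHom f.map_algebraMap (MonoidHom.id Γ) f.map_aug).isOpen⟩
      ⟨(RingHom.ker h.hom).comap f.toRingHom, (h.pullback f.base f.toRingHom f.map_algebraMap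
      (MonoidHom.id Γ) f.map_aug).isOpen⟩ le_rfl le_rfl, ← RingHom.comp_apply]
    refine DFunLike.congr_fun (tensorHom_ext (fun s => ?_) (fun s => ?_)) _ <;>
    · obtain ⟨s, rfl⟩ := Ideal.Quotient.mk_surjective s
      simp [Pt.desc₂, Pt.pullback]

/-- The completion morphism from an equivariant formal group law to its pushforward. -/
def Pushforward.toPointHom {φ : Γ' →* Γ} {F : EquivariantFGL Γ k} {G : EquivariantFGL Γ' k}
    (P : Pushforward φ F G) : PointHom φ F G where
  base := RingHom.id k
  ring := (P.equiv.toAlgHom.comp (toIdealCompletion k _)).toRingHom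
  comm := (P.equiv.toAlgHom.comp (toIdealCompletion k _)).comp_algebraMap
  aug V x := P.aug_eq V _
  orientation := P.orientation_eq.symm
  pullback_mul {K _ b} g h := by
    ext x
    refine (congrArg (g.desc₂ h _ _ le_rfl le_rfl)
      (P.comul_eq ⟨_, g.isOpen⟩ ⟨_, h.isOpen⟩ x)).trans ?_
    let f : F.R →ₐ[k] G.R := P.equiv.toAlgHom.comp (toIdealCompletion k _)
    have hf : f.toRingHom.comp (algebraMap k F.R) = (algebraMap k G.R).comp (RingHom.id k) :=
      f.comp_algebraMap
    have ha : ∀ V x, G.θ V (f.toRingHom x) = RingHom.id k (F.θ (φ V) x) := fun V x => P.aug_eq V _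
    rw [F.pointMul_hom_apply _ _ ⟨(RingHom.ker g.hom).comap f,
      (g.pullback (RingHom.id k) f.toRingHom hf φ ha).isOpen⟩
      ⟨(RingHom.ker h.hom).comap f, (h.pullback (RingHom.id k) f.toRingHom hf φ ha).isOpen⟩ le_rfl le_rfl]
    refine DFunLike.congr_fun (f := (g.desc₂ h _ _ le_rfl le_rfl).comp
      (Algebra.TensorProduct.map (Ideal.quotientMapₐ (RingHom.ker g.hom) f le_rfl)
        (Ideal.quotientMapₐ (RingHom.ker h.hom) f le_rfl)).toRingHom)
      (tensorHom_ext (fun s => ?_) (fun s => ?_)) _ <;>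
    · obtain ⟨s, rfl⟩ := Ideal.Quotient.mk_surjective s
      simp [Pt.desc₂, Pt.pullback]
      rfl

/-- The completion defines a pushforward. -/
def isPushforward (F : EquivariantFGL Γ k) (φ : Γ' →* Γ) :
    Pushforward φ F (F.pushforward φ) where
  equiv := AlgEquiv.refl
  aug_eq _ _ := rfl
  orientation_eq := by
    -- The orientation produced by `ofCompletion` is the generator attached to the trivial
    -- character, and translation by `1` does not change `y`.
    change toIdealCompletion k _ (F.yTranslate (φ 1)) = _
    rw [map_one, yTranslate_one]
    rfl
  comul_eq I J x := by
    intro f c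
    rw [comul_eq_pointMul]
    let G := F.pushforward φ
    have e : ∀ {K : Type u} [CommRing K] {b : k →+* K} (g h : Pt G.θ b),
        (G.pointMul g h).hom (f x) = (F.pointMul (g.pullback (RingHom.id k) f.toRingHom
          f.comp_algebraMap φ fun _ _ => rfl) (h.pullback (RingHom.id k) f.toRingHom
          f.comp_algebraMap φ fun _ _ => rfl)).hom x := by
      intro K _ b g h
      exact congrArg (fun p => Pt.hom p (f x)) (ofPoints_pointMul _ _ _ _ _ g h)
    refine (e _ _).trans ?_
    rw [F.pointMul_hom_apply _ _ ⟨I.1.comap f, c I⟩ ⟨J.1.comap f, c J⟩ (fun x hx => by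
      rw [RingHom.mem_ker]
      change (Pt.left I J).hom (f x) = 0
      rw [Pt.left_hom_apply, Ideal.Quotient.eq_zero_iff_mem.2 (Ideal.mem_comap.1 hx),
        TensorProduct.zero_tmul]) (fun x hx => by
      rw [RingHom.mem_ker]
      change (Pt.right I J).hom (f x) = 0
      rw [Pt.right_hom_apply, Ideal.Quotient.eq_zero_iff_mem.2 (Ideal.mem_comap.1 hx),
        TensorProduct.tmul_zero])]
    refine DFunLike.congr_fun (g := (Algebra.TensorProduct.map (Ideal.quotientMapₐ I.1 f le_rfl)
        (Ideal.quotientMapₐ J.1 f le_rfl)).toRingHom)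
      (tensorHom_ext (fun s => ?_) (fun s => ?_)) _ <;>
    · obtain ⟨s, rfl⟩ := Ideal.Quotient.mk_surjective s
      simp [Pt.desc₂, Pt.pullback]

end EquivariantFGL

/-! ### Global group laws -/

/-- The characters of a torus, as homomorphisms to the circle torus. -/
abbrev Torus.Chars (A : Torus) : Type := A.obj →ₜ* circleTorus.obj

namespace Torus

variable {A B C D : Torus}

theorem comp_assoc (f : C.obj →ₜ* D.obj) (g : B.obj →ₜ* C.obj) (h : A.obj →ₜ* B.obj) :
    (f.comp g).comp h = f.comp (g.comp h) := rfl

@[simp]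
theorem comp_id (f : A.obj →ₜ* B.obj) : f.comp (ContinuousMonoidHom.id A.obj) = f := rfl

@[simp]
theorem id_comp (f : A.obj →ₜ* B.obj) : (ContinuousMonoidHom.id B.obj).comp f = f := rfl

@[simp]
theorem mul_comp (f g : B.obj →ₜ* C.obj) (h : A.obj →ₜ* B.obj) :
    (f * g).comp h = f.comp h * g.comp h := rfl

@[simp]
theorem one_comp (h : A.obj →ₜ* B.obj) : (1 : B.obj →ₜ* C.obj).comp h = 1 := rfl

@[simp]
theorem inv_comp (f : B.obj →ₜ* C.obj) (h : A.obj →ₜ* B.obj) : f⁻¹.comp h = (f.comp h)⁻¹ := rfl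

@[simp]
theorem comp_one (f : B.obj →ₜ* C.obj) : f.comp (1 : A.obj →ₜ* B.obj) = 1 :=
  ContinuousMonoidHom.ext fun _ => map_one f

@[simp]
theorem comp_mul (f : B.obj →ₜ* C.obj) (g h : A.obj →ₜ* B.obj) :
    f.comp (g * h) = f.comp g * f.comp h :=
  ContinuousMonoidHom.ext fun _ => map_mul f _ _

/-- Pullback of characters along a homomorphism of tori. -/
def charPullback (f : A.obj →ₜ* B.obj) : B.Chars →* A.Chars where
  toFun V := V.comp f
  map_one' := rfl
  map_mul' _ _ := rfl

@[simp]
theorem charPullback_apply (f : A.obj →ₜ* B.obj) (V : B.Chars) : charPullback f V = V.comp f := rfl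

/-- The inclusion of the first factor. -/
def inl (A B : Torus) : A.obj →ₜ* (A.prod B).obj := lift (ContinuousMonoidHom.id A.obj) 1

/-- The inclusion of the second factor. -/
def inr (A B : Torus) : B.obj →ₜ* (A.prod B).obj := lift 1 (ContinuousMonoidHom.id B.obj)

@[simp]
theorem fst_comp_inl : (fst A B).comp (inl A B) = ContinuousMonoidHom.id _ := rfl

@[simp]
theorem snd_comp_inl : (snd A B).comp (inl A B) = 1 := rfl

@[simp]
theorem fst_comp_inr : (fst A B).comp (inr A B) = 1 := rfl

@[simp]
theorem snd_comp_inr : (snd A B).comp (inr A B) = ContinuousMonoidHom.id _ := rfl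

theorem char_prod_eq (V : (A.prod B).Chars) :
    V = (V.comp (inl A B)).comp (fst A B) * (V.comp (inr A B)).comp (snd A B) := by
  rw [comp_assoc, comp_assoc, ← comp_mul]
  conv_lhs => rw [← comp_id V]
  congr 1
  refine hom_ext ?_ ?_ <;> simp [← comp_assoc]

end Torus

section Res

variable (X : Torusᵒᵖ ⥤ CommRingCat.{v}) {A B C : Torus}

@[simp]
theorem torusRes_id (x : X.obj (op A)) :
    torusRes X (ContinuousMonoidHom.id A.obj) x = x := by
  have : X.map (ObjectProperty.homMk (ofHom (ContinuousMonoidHom.id A.obj)) : A ⟶ A).op = 𝟙 _ :=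
    X.map_id (op A)
  simp [torusRes, this]

theorem torusRes_torusRes (f : A.obj →ₜ* B.obj) (g : B.obj →ₜ* C.obj) (x : X.obj (op C)) :
    torusRes X f (torusRes X g x) = torusRes X (g.comp f) x := by
  have : X.map (ObjectProperty.homMk (ofHom (g.comp f)) : A ⟶ C).op =
      X.map (ObjectProperty.homMk (ofHom g) : B ⟶ C).op ≫
        X.map (ObjectProperty.homMk (ofHom f) : A ⟶ B).op := by
    rw [← X.map_comp]
    rfl
  simp [torusRes, this]

theorem naturality_torusRes {X Y : Torusᵒᵖ ⥤ CommRingCat.{v}} (η : X ⟶ Y) (f : A.obj →ₜ* B.obj)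
    (x : X.obj (op B)) :
    (η.app (op A)).hom (torusRes X f x) = torusRes Y f ((η.app (op B)).hom x) :=
  DFunLike.congr_fun (congrArg CommRingCat.Hom.hom
    (η.naturality (ObjectProperty.homMk (ofHom f) : A ⟶ B).op)) x

variable (e : X.obj (op circleTorus))

/-- The Euler class `V^* e` of a character of a torus. -/
def eulerClass (V : A.Chars) : X.obj (op A) := torusRes X V e

@[simp]
theorem torusRes_eulerClass (f : A.obj →ₜ* B.obj) (V : B.Chars) :
    torusRes X f (eulerClass X e V) = eulerClass X e (V.comp f) :=
  torusRes_torusRes X f V e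

theorem eulerClass_id : eulerClass X e (ContinuousMonoidHom.id _) = e := torusRes_id X e

end Res

/-! ### Split characters and coordinates. -/

/-- A character that is split, with given kernel, and a retraction to the kernel. -/
structure CharSplitting {A K : Torus} (V : A.Chars) (i : K.obj →ₜ* A.obj) (r : A.obj →ₜ* K.obj)
    (s : circleTorus.obj →ₜ* A.obj) : Prop where
  char_section : V.comp s = ContinuousMonoidHom.id _
  retraction : r.comp i = ContinuousMonoidHom.id _
  char_incl : V.comp i = 1
  decomp : i.comp r * s.comp V = ContinuousMonoidHom.id _

namespace CharSplitting

variable {A K : Torus} {V : A.Chars} {i : K.obj →ₜ* A.obj} {r : A.obj →ₜ* K.obj}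
  {s : circleTorus.obj →ₜ* A.obj}

theorem mem_ker_iff (h : CharSplitting V i r s) (a : A.obj) : V a = 1 ↔ a ∈ Set.range i := by
  constructor
  · intro ha
    refine ⟨r a, ?_⟩
    have : i (r a) * s (V a) = a := DFunLike.congr_fun h.decomp a
    rwa [ha, map_one, mul_one] at this
  · rintro ⟨b, rfl⟩
    exact DFunLike.congr_fun h.char_incl b

theorem isSplit (h : CharSplitting V i r s) : IsSplit (A := A.obj) V :=
  ⟨s, fun z => DFunLike.congr_fun h.char_section z⟩

theorem injective (h : CharSplitting V i r s) : Function.Injective i :=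
  Function.LeftInverse.injective (g := r) fun b => DFunLike.congr_fun h.retraction b

/-- Split characters with given kernel. -/
theorem exists_of_isSplit {V : A.Chars} {i : K.obj →ₜ* A.obj} {s : circleTorus.obj →ₜ* A.obj}
    (hs : ∀ z, V (s z) = z) (hi : Function.Injective i) (hker : ∀ a, V a = 1 ↔ a ∈ Set.range i) :
    ∃ r, CharSplitting V i r s := by
  have h : ∀ a, ∃ b, i b = a * (s (V a))⁻¹ := fun a => (hker _).1 (by simp [hs])
  choose r hr using h
  have hri : ∀ b, r (i b) = b := fun b => hi (by rw [hr, (hker _).2 ⟨b, rfl⟩]; simp)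
  have hemb : Topology.IsClosedEmbedding i := (map_continuous i).isClosedEmbedding hi
  let r' : A.obj →ₜ* K.obj :=
    { toFun := r
      map_one' := hi (by simp [hr])
      map_mul' := fun a b => hi (by simp only [hr, map_mul, mul_inv]; exact mul_mul_mul_comm _ _ _ _)
      continuous_toFun := hemb.isInducing.continuous_iff.2 (by
        have : i ∘ r = fun a => a * (s (V a))⁻¹ := funext hr
        rw [this]
        fun_prop) }
  refine ⟨r', ContinuousMonoidHom.ext hs, ContinuousMonoidHom.ext hri,
    ContinuousMonoidHom.ext fun b => (hker _).2 ⟨b, rfl⟩, ContinuousMonoidHom.ext fun a => ?_⟩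
  change i (r a) * s (V a) = a
  rw [hr, inv_mul_cancel_right]

theorem snd (A : Torus) : CharSplitting (Torus.snd A circleTorus) (Torus.inl A circleTorus)
    (Torus.fst A circleTorus) (Torus.inr A circleTorus) where
  char_section := rfl
  retraction := rfl
  char_incl := rfl
  decomp := Torus.hom_ext (by simp [← Torus.comp_assoc]) (by simp [← Torus.comp_assoc])

end CharSplitting

/-- A criterion for coordinates. -/
theorem isCoordinate_of_prod {X : Torusᵒᵖ ⥤ CommRingCat.{v}} {e : X.obj (op circleTorus)}
    (h₁ : ∀ A : Torus, eulerClass X e (1 : A.Chars) = 0)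
    (h₂ : ∀ (A : Torus) (x : X.obj (op (A.prod circleTorus))),
      eulerClass X e (Torus.snd A circleTorus) * x = 0 → x = 0)
    (h₃ : ∀ (A : Torus) (x : X.obj (op (A.prod circleTorus))),
      torusRes X (Torus.inl A circleTorus) x = 0 →
        ∃ z, eulerClass X e (Torus.snd A circleTorus) * z = x) :
    IsCoordinate X e := by
  intro A K V' i ⟨s', hs⟩ hi hker
  let V : A.Chars := V'
  let s : circleTorus.obj →ₜ* A.obj := s'
  obtain ⟨r, h⟩ := CharSplitting.exists_of_isSplit (V := V) (s := s) hs hi hker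
  -- The section and the retraction identify `A` with `K × 𝕋`, in such a way that `V` becomes the
  -- second projection and `i` the first inclusion. Everything is transported along this
  -- isomorphism.
  let φ : (K.prod circleTorus).obj →ₜ* A.obj :=
    i.comp (Torus.fst K circleTorus) * s.comp (Torus.snd K circleTorus)
  let ψ : A.obj →ₜ* (K.prod circleTorus).obj := Torus.lift r V
  have hφψ : φ.comp ψ = ContinuousMonoidHom.id _ := h.decomp
  have hrs : r.comp s = 1 := by
    ext z
    refine hi ?_
    have : i (r (s z)) * s (V (s z)) = s z := DFunLike.congr_fun h.decomp (s z)
    rw [show V (s z) = z from hs z, mul_eq_right] at this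
    exact this.trans (map_one i).symm
  have hψφ : ψ.comp φ = ContinuousMonoidHom.id _ := by
    refine Torus.hom_ext ?_ ?_
    · change r.comp φ = Torus.fst _ _
      refine (Torus.comp_mul _ _ _).trans ?_
      rw [← Torus.comp_assoc, h.retraction, Torus.id_comp, ← Torus.comp_assoc, hrs, Torus.one_comp,
        mul_one]
    · change V.comp φ = Torus.snd _ _
      refine (Torus.comp_mul _ _ _).trans ?_
      rw [← Torus.comp_assoc, h.char_incl, Torus.one_comp, one_mul, ← Torus.comp_assoc,
        h.char_section, Torus.id_comp]
  have hφi : φ.comp (Torus.inl K circleTorus) = i := by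
    ext b
    change i b * s 1 = i b
    rw [map_one, mul_one]
  have hΦΨ : ∀ x, torusRes X φ (torusRes X ψ x) = x := fun x => by
    rw [torusRes_torusRes, hψφ, torusRes_id]
  have hΨΦ : ∀ x, torusRes X ψ (torusRes X φ x) = x := fun x => by
    rw [torusRes_torusRes, hφψ, torusRes_id]
  have hΦe : torusRes X φ (eulerClass X e V) = eulerClass X e (Torus.snd K circleTorus) := by
    rw [torusRes_eulerClass]
    congr 1
    exact congrArg (fun w => (Torus.snd K circleTorus).comp w) hψφ
  have hΦi : ∀ x, torusRes X (Torus.inl K circleTorus) (torusRes X φ x) = torusRes X i x :=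
    fun x => by rw [torusRes_torusRes, hφi]
  change Function.Injective (fun x => eulerClass X e V * x) ∧
    Function.Exact (fun x => eulerClass X e V * x) _ ∧ _
  refine ⟨fun x y hxy => ?_, fun x => ⟨fun hx => ?_, ?_⟩, fun x => ?_⟩
  · have h' := congrArg (torusRes X φ) hxy
    simp only [map_mul, hΦe] at h'
    rw [← hΨΦ x, ← hΨΦ y, sub_eq_zero.1 (h₂ K (torusRes X φ x - torusRes X φ y)
      (by rw [mul_sub, h', sub_self]))]
  · obtain ⟨z, hz⟩ := h₃ K (torusRes X φ x) (by rw [hΦi, hx])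
    refine ⟨torusRes X ψ z, ?_⟩
    dsimp only
    rw [← hΨΦ x, ← hz, map_mul, ← hΦe, hΨΦ]
  · rintro ⟨z, rfl⟩
    dsimp only
    rw [map_mul, torusRes_eulerClass, h.char_incl, h₁, zero_mul]
  · refine ⟨torusRes X ψ (torusRes X (Torus.fst K circleTorus) x), ?_⟩
    rw [← hΦi, hΦΨ, torusRes_torusRes]
    exact torusRes_id X x

namespace IsCoordinate

variable {X : Torusᵒᵖ ⥤ CommRingCat.{v}} {e : X.obj (op circleTorus)} (hX : IsCoordinate X e)
  {A K : Torus} {V : A.Chars} {i : K.obj →ₜ* A.obj} {r : A.obj →ₜ* K.obj}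
  {s : circleTorus.obj →ₜ* A.obj}

include hX

theorem eulerClass_mul_injective (h : CharSplitting V i r s) :
    Function.Injective fun x => eulerClass X e V * x :=
  (hX A K V i h.isSplit h.injective h.mem_ker_iff).1

theorem eq_of_eulerClass_mul_eq (h : CharSplitting V i r s) {x y : X.obj (op A)}
    (hxy : eulerClass X e V * x = eulerClass X e V * y) : x = y :=
  hX.eulerClass_mul_injective h hxy

theorem exists_eulerClass_mul (h : CharSplitting V i r s) (x : X.obj (op A)) :
    ∃ z, eulerClass X e V * z = x - torusRes X r (torusRes X i x) :=
  ((hX A K V i h.isSplit h.injective h.mem_ker_iff).2.1 _).1 (by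
    rw [map_sub, torusRes_torusRes X i r, h.retraction, torusRes_id, sub_self])

theorem eulerClass_one (A : Torus) : eulerClass X e (1 : A.Chars) = 0 := by
  have h := CharSplitting.snd A
  have := ((hX _ _ _ _ h.isSplit h.injective h.mem_ker_iff).2.1 _).2 ⟨1, rfl⟩
  dsimp only at this
  rw [mul_one] at this
  exact (torusRes_eulerClass X e (Torus.inl A circleTorus) (Torus.snd A circleTorus)).symm.trans this

/-- Euler classes are additive modulo the Euler class of one of the factors. -/
theorem exists_eulerClass_mul_char (V W : A.Chars) :
    ∃ c, eulerClass X e (V * W) = eulerClass X e V + eulerClass X e W * c := by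
  -- In the universal case, on `𝕋 × 𝕋`, the Euler class of the product restricts on the first factor
  -- to that of the first character, so their difference is divisible by the Euler class of the
  -- second.
  obtain ⟨z, hz⟩ := hX.exists_eulerClass_mul (CharSplitting.snd circleTorus)
    (eulerClass X e (Torus.fst circleTorus circleTorus * Torus.snd circleTorus circleTorus))
  refine ⟨torusRes X (Torus.lift V W) z, ?_⟩
  have := congrArg (torusRes X (Torus.lift V W)) hz
  simp only [map_mul, map_sub, torusRes_eulerClass, Torus.mul_comp, Torus.fst_comp_lift,
    Torus.snd_comp_lift, Torus.fst_comp_inl, Torus.snd_comp_inl, mul_one, Torus.id_comp] at this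
  rw [this]
  ring

/-- The Euler class of a power is divisible by the Euler class. -/
theorem exists_eulerClass_comp (V : A.Chars) (χ : circleTorus.Chars) :
    ∃ c, eulerClass X e (χ.comp V) = eulerClass X e V * c := by
  -- In the universal case `V` is the identity of the circle, with trivial kernel, where the Euler
  -- class of `χ` restricts to `e_1 = 0`.
  have h : CharSplitting (A := circleTorus) (ContinuousMonoidHom.id _)
      (1 : Torus.unit.obj →ₜ* circleTorus.obj) 1 (ContinuousMonoidHom.id _) :=
    ⟨rfl, Subsingleton.elim _ _, rfl, by simp⟩
  obtain ⟨z, hz⟩ := hX.exists_eulerClass_mul h (eulerClass X e χ)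
  refine ⟨torusRes X V z, ?_⟩
  have := congrArg (torusRes X V) hz
  simp only [map_mul, map_zero, torusRes_eulerClass, Torus.comp_one,
    hX.eulerClass_one, sub_zero, Torus.id_comp] at this
  exact this.symm

end IsCoordinate

/-! ### The initial global group law -/

/-- Global group laws, bundled. -/
structure GlobalGroupLaw where
  X : Torusᵒᵖ ⥤ CommRingCat.{v}
  e : X.obj (op circleTorus)
  isCoordinate : IsCoordinate X e

/-- Formal expressions for the natural operations on global group laws. -/
inductive TorusTerm : ℕ → Type
  | zero (n : ℕ) : TorusTerm n
  | one (n : ℕ) : TorusTerm n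
  | neg {n : ℕ} (t : TorusTerm n) : TorusTerm n
  | add {n : ℕ} (t t' : TorusTerm n) : TorusTerm n
  | mul {n : ℕ} (t t' : TorusTerm n) : TorusTerm n
  | euler {n : ℕ} (V : (Torus.std n).Chars) : TorusTerm n
  | res {n m : ℕ} (f : (Torus.std n).obj →ₜ* (Torus.std m).obj) (t : TorusTerm m) : TorusTerm n
  | div {n : ℕ} (t : TorusTerm (n + 1)) : TorusTerm (n + 1)

/-- Division by the Euler class of the projection to the circle. -/
def GlobalGroupLaw.div (X : GlobalGroupLaw.{v}) (A : Torus)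
    (x : X.X.obj (op (A.prod circleTorus))) : X.X.obj (op (A.prod circleTorus)) :=
  (X.isCoordinate.exists_eulerClass_mul (CharSplitting.snd A) x).choose

theorem GlobalGroupLaw.eulerClass_mul_div (X : GlobalGroupLaw.{v}) (A : Torus)
    (x : X.X.obj (op (A.prod circleTorus))) :
    eulerClass X.X X.e (Torus.snd A circleTorus) * X.div A x =
      x - torusRes X.X (Torus.fst A circleTorus) (torusRes X.X (Torus.inl A circleTorus) x) :=
  (X.isCoordinate.exists_eulerClass_mul (CharSplitting.snd A) x).choose_spec

/-- The value of a formal expression in a global group law. -/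
def TorusTerm.eval (X : GlobalGroupLaw.{v}) : ∀ {n : ℕ}, TorusTerm n → X.X.obj (op (Torus.std n))
  | _, zero _ => 0
  | _, one _ => 1
  | _, neg t => -t.eval X
  | _, add t t' => t.eval X + t'.eval X
  | _, mul t t' => t.eval X * t'.eval X
  | _, euler V => eulerClass X.X X.e V
  | _, res f t => torusRes X.X f (t.eval X)
  | _, div (n := n) t => X.div (Torus.std n) (t.eval X)

namespace Torus

/-- The rank of a torus. -/
def rank (A : Torus) : ℕ := A.exists_equiv_std.choose

/-- An isomorphism with a standard torus. -/
def stdEquiv (A : Torus) : A.obj ≃ₜ* (std A.rank).obj := A.exists_equiv_std.choose_spec.some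

/-- An isomorphism with a standard torus. -/
def toStd (A : Torus) : A.obj →ₜ* (std A.rank).obj := A.stdEquiv

/-- The inverse of the isomorphism with a standard torus. -/
def ofStd (A : Torus) : (std A.rank).obj →ₜ* A.obj := A.stdEquiv.symm

theorem ofStd_comp_toStd (A : Torus) : A.ofStd.comp A.toStd = ContinuousMonoidHom.id _ :=
  ContinuousMonoidHom.ext fun a => A.stdEquiv.symm_apply_apply a

end Torus

namespace LazardFunctor

/-- Families of elements of all global group laws. -/
abbrev Fam (A : Torus) : Type (v + 1) := ∀ X : GlobalGroupLaw.{v}, X.X.obj (op A)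

/-- Restriction of families. -/
def famRes {A B : Torus} (f : A.obj →ₜ* B.obj) : Fam.{v} B →+* Fam.{v} A :=
  RingHom.pi fun X => (torusRes X.X f).comp (Pi.evalRingHom _ X)

theorem famRes_apply {A B : Torus} (f : A.obj →ₜ* B.obj) (x : Fam.{v} B) (X : GlobalGroupLaw.{v}) :
    famRes f x X = torusRes X.X f (x X) := rfl

theorem famRes_famRes {A B C : Torus} (f : A.obj →ₜ* B.obj) (g : B.obj →ₜ* C.obj)
    (x : Fam.{v} C) : famRes f (famRes g x) = famRes (g.comp f) x :=
  funext fun X => torusRes_torusRes X.X f g (x X)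

theorem famRes_id {A : Torus} (x : Fam.{v} A) : famRes (ContinuousMonoidHom.id _) x = x :=
  funext fun X => torusRes_id X.X (x X)

/-- The family of values of a formal expression. -/
def evalFam {n : ℕ} (t : TorusTerm n) : Fam.{v} (Torus.std n) := fun X => t.eval X

/-- The families given by formal expressions. -/
def sub (A : Torus) : Subring (Fam.{v} A) where
  carrier := Set.range fun t : TorusTerm A.rank => famRes A.toStd (evalFam t)
  zero_mem' := ⟨.zero _, map_zero (famRes A.toStd)⟩
  one_mem' := ⟨.one _, map_one (famRes A.toStd)⟩
  neg_mem' := by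
    rintro _ ⟨t, rfl⟩
    exact ⟨t.neg, map_neg (famRes A.toStd) (evalFam t)⟩
  add_mem' := by
    rintro _ _ ⟨t, rfl⟩ ⟨t', rfl⟩
    exact ⟨t.add t', map_add (famRes A.toStd) (evalFam t) (evalFam t')⟩
  mul_mem' := by
    rintro _ _ ⟨t, rfl⟩ ⟨t', rfl⟩
    exact ⟨t.mul t', map_mul (famRes A.toStd) (evalFam t) (evalFam t')⟩

theorem famRes_evalFam_mem {A : Torus} {n : ℕ} (f : A.obj →ₜ* (Torus.std n).obj) (t : TorusTerm n) :
    famRes.{v} f (evalFam t) ∈ sub A := by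
  refine ⟨t.res (f.comp A.ofStd), ?_⟩
  change famRes A.toStd (famRes (f.comp A.ofStd) (evalFam t)) = _
  rw [famRes_famRes, Torus.comp_assoc, A.ofStd_comp_toStd, Torus.comp_id]

theorem famRes_mem {A B : Torus} (f : A.obj →ₜ* B.obj) {x : Fam.{v} B} (hx : x ∈ sub B) :
    famRes f x ∈ sub A := by
  obtain ⟨t, rfl⟩ := hx
  dsimp only
  rw [famRes_famRes]
  exact famRes_evalFam_mem _ t

/-- Any standard torus of which `A` is a retract may serve to describe the elements. For `A × 𝕋`
this permits a standard torus with an explicit last factor, on which the expression `div` is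
available. -/
theorem mem_sub_iff {A : Torus} {n : ℕ} (f : A.obj →ₜ* (Torus.std n).obj)
    (g : (Torus.std n).obj →ₜ* A.obj) (h : g.comp f = ContinuousMonoidHom.id _) {x : Fam.{v} A} :
    x ∈ sub A ↔ ∃ t : TorusTerm n, famRes f (evalFam t) = x := by
  constructor
  · rintro ⟨t, rfl⟩
    refine ⟨t.res (A.toStd.comp g), ?_⟩
    change famRes f (famRes (A.toStd.comp g) (evalFam t)) = _
    rw [famRes_famRes, Torus.comp_assoc, h, Torus.comp_id]
  · rintro ⟨t, rfl⟩
    exact famRes_evalFam_mem f t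

/-- Formal expressions live in the lowest universe, so the families that they define form a small
set, although there is a proper class of global group laws. -/
instance (A : Torus) : Small.{u} (sub.{v} A) :=
  small_of_surjective (f := fun t : TorusTerm A.rank => (⟨_, t, rfl⟩ : sub.{v} A))
    (by rintro ⟨_, t, rfl⟩; exact ⟨t, rfl⟩)

/-- The restriction maps of the initial global group law. -/
def res {A B : Torus} (f : A.obj →ₜ* B.obj) : Shrink.{u} (sub.{v} B) →+* Shrink.{u} (sub.{v} A) :=
  (Shrink.ringEquiv (sub.{v} A)).symm.toRingHom.comp
    (((famRes f).restrict (sub B) (sub A) fun _ hx => famRes_mem f hx).comp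
      (Shrink.ringEquiv (sub.{v} B)).toRingHom)

/-- The values of an element of the initial global group law. -/
def shrinkVal (A : Torus) : Shrink.{u} (sub.{v} A) →+* Fam.{v} A :=
  (sub A).subtype.comp (Shrink.ringEquiv (sub.{v} A)).toRingHom

theorem shrinkVal_injective (A : Torus) : Function.Injective (shrinkVal.{u, v} A) :=
  Subtype.val_injective.comp (Shrink.ringEquiv (sub.{v} A)).injective

theorem exists_shrinkVal_eq {A : Torus} {x : Fam.{v} A} (hx : x ∈ sub A) :
    ∃ z, shrinkVal.{u, v} A z = x :=
  ⟨(Shrink.ringEquiv (sub.{v} A)).symm ⟨x, hx⟩,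
    congrArg Subtype.val ((Shrink.ringEquiv (sub.{v} A)).apply_symm_apply ⟨x, hx⟩)⟩

theorem shrinkVal_mem {A : Torus} (z : Shrink.{u} (sub.{v} A)) : shrinkVal A z ∈ sub A :=
  (Shrink.ringEquiv (sub.{v} A) z).2

theorem shrinkVal_res {A B : Torus} (f : A.obj →ₜ* B.obj) (x : Shrink.{u} (sub.{v} B)) :
    shrinkVal A (res f x) = famRes f (shrinkVal B x) :=
  congrArg Subtype.val ((Shrink.ringEquiv (sub.{v} A)).apply_symm_apply _)

end LazardFunctor

open LazardFunctor

/-- The initial global group law. -/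
def lazardFunctor : Torusᵒᵖ ⥤ CommRingCat.{u} where
  obj A := CommRingCat.of (Shrink.{u} (sub.{u + 1} A.unop))
  map f := CommRingCat.ofHom (res (f.unop.hom : _ →ₜ* _))
  map_id A := by
    refine CommRingCat.hom_ext (RingHom.ext fun x => ?_)
    refine shrinkVal_injective A.unop ((shrinkVal_res _ _).trans ?_)
    exact famRes_id _
  map_comp f g := by
    refine CommRingCat.hom_ext (RingHom.ext fun x => ?_)
    refine shrinkVal_injective _ ((shrinkVal_res _ _).trans ?_)
    refine Eq.trans ?_ (shrinkVal_res _ _).symm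
    refine Eq.trans ?_ (congrArg _ (shrinkVal_res _ _).symm)
    exact (famRes_famRes _ _ _).symm

/-- The coordinate of the initial global group law. -/
theorem exists_lazardCoordinate : ∃ e : lazardFunctor.{u}.obj (op circleTorus),
    ∀ X, shrinkVal circleTorus e X = X.e := by
  obtain ⟨z, hz⟩ := exists_shrinkVal_eq.{u, u + 1}
    (famRes_evalFam_mem circleTorus.toStd (TorusTerm.euler circleTorus.ofStd))
  refine ⟨z, fun X => ?_⟩
  rw [hz, famRes_apply]
  change torusRes X.X _ (eulerClass X.X X.e _) = _
  rw [torusRes_eulerClass, Torus.ofStd_comp_toStd, eulerClass_id]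

/-- The coordinate of the initial global group law. -/
def lazardCoordinate : lazardFunctor.{u}.obj (op circleTorus) := exists_lazardCoordinate.choose

namespace LazardFunctor

/-- The values of an element of the initial global group law. -/
def val (A : Torus) : lazardFunctor.{u}.obj (op A) →+* Fam.{u + 1} A := shrinkVal A

theorem val_injective (A : Torus) : Function.Injective (val.{u} A) := shrinkVal_injective A

theorem val_mem {A : Torus} (x : lazardFunctor.{u}.obj (op A)) : val A x ∈ sub A := shrinkVal_mem x

theorem exists_val_eq {A : Torus} {x : Fam.{u + 1} A} (hx : x ∈ sub A) : ∃ z, val.{u} A z = x :=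
  exists_shrinkVal_eq hx

theorem val_torusRes {A B : Torus} (f : A.obj →ₜ* B.obj) (x : lazardFunctor.{u}.obj (op B)) :
    val A (torusRes lazardFunctor f x) = famRes f (val B x) :=
  shrinkVal_res f x

theorem val_torusRes_apply {A B : Torus} (f : A.obj →ₜ* B.obj) (x : lazardFunctor.{u}.obj (op B))
    (X : GlobalGroupLaw.{u + 1}) :
    val A (torusRes lazardFunctor f x) X = torusRes X.X f (val B x X) :=
  congrFun (val_torusRes f x) X

theorem val_coordinate (X : GlobalGroupLaw.{u + 1}) :
    val circleTorus lazardCoordinate.{u} X = X.e :=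
  exists_lazardCoordinate.choose_spec X

theorem val_eulerClass {A : Torus} (V : A.Chars) (X : GlobalGroupLaw.{u + 1}) :
    val A (eulerClass lazardFunctor.{u} lazardCoordinate V) X = eulerClass X.X X.e V := by
  rw [eulerClass, val_torusRes_apply, val_coordinate, eulerClass]

end LazardFunctor

/-- Vanishing of `e_1` and regularity hold in each component. Exactness needs quotients inside the
subring, and the expression `div` was included to supply them. -/
theorem isCoordinate_lazardFunctor : IsCoordinate lazardFunctor.{u} lazardCoordinate := by
  refine isCoordinate_of_prod (fun A => val_injective A (funext fun X => ?_))
    (fun A x hx => val_injective _ (funext fun X => ?_)) (fun A x hx => ?_)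
  · rw [val_eulerClass, X.isCoordinate.eulerClass_one, map_zero]
    rfl
  · have := congrFun (congrArg (val _) hx) X
    rw [map_mul, Pi.mul_apply, val_eulerClass, map_zero] at this
    rw [map_zero]
    exact X.isCoordinate.eq_of_eulerClass_mul_eq (CharSplitting.snd A)
      (this.trans (mul_zero _).symm)
  · let f : (A.prod circleTorus).obj →ₜ* (Torus.std (A.rank + 1)).obj :=
      Torus.lift (A := Torus.std A.rank) (A.toStd.comp (Torus.fst A circleTorus))
        (Torus.snd A circleTorus)
    let g : (Torus.std (A.rank + 1)).obj →ₜ* (A.prod circleTorus).obj :=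
      Torus.lift (A.ofStd.comp (Torus.fst (Torus.std A.rank) circleTorus))
        (Torus.snd (Torus.std A.rank) circleTorus)
    have hgf : g.comp f = ContinuousMonoidHom.id _ := by
      refine Torus.hom_ext ?_ rfl
      change A.ofStd.comp (A.toStd.comp (Torus.fst A circleTorus)) = Torus.fst A circleTorus
      rw [← Torus.comp_assoc, A.ofStd_comp_toStd, Torus.id_comp]
    obtain ⟨t, ht⟩ := (mem_sub_iff f g hgf).1 (val_mem x)
    obtain ⟨z, hz⟩ := exists_val_eq (famRes_evalFam_mem f t.div)
    refine ⟨z, val_injective _ (funext fun X => ?_)⟩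
    have hx' := congrFun (congrArg (val _) hx) X
    rw [map_zero, val_torusRes_apply, ← ht, famRes_apply, torusRes_torusRes] at hx'
    rw [map_mul, Pi.mul_apply, val_eulerClass, hz, famRes_apply, ← ht, famRes_apply]
    let f' : (A.prod circleTorus).obj →ₜ* ((Torus.std A.rank).prod circleTorus).obj := f
    have key : ∀ w, torusRes X.X f' (eulerClass X.X X.e (Torus.snd _ circleTorus) * X.div _ w) =
        torusRes X.X f' w - torusRes X.X (((Torus.inl (Torus.std A.rank) circleTorus).comp
          (Torus.fst (Torus.std A.rank) circleTorus)).comp f') w := fun w => by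
      rw [X.eulerClass_mul_div, map_sub, torusRes_torusRes, torusRes_torusRes, Torus.comp_assoc]
    have key := key (t.eval X)
    rw [map_mul, torusRes_eulerClass] at key
    refine key.trans ?_
    -- The correction term in the division identity vanishes because `x` restricts to zero on the
    -- first factor.
    have h0 : torusRes X.X (((Torus.inl (Torus.std A.rank) circleTorus).comp
        (Torus.fst (Torus.std A.rank) circleTorus)).comp f) (t.eval X) = 0 := by
      have := congrArg (torusRes X.X (Torus.fst A circleTorus)) hx'
      rw [torusRes_torusRes] at this
      exact this.trans (map_zero _)
    exact (congrArg (fun w => torusRes X.X f (t.eval X) - w) h0).trans (sub_zero _)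

/-- The homomorphism from the initial global group law. -/
def lazardDesc (X : GlobalGroupLaw.{u + 1}) (A : Torus) :
    lazardFunctor.{u}.obj (op A) →+* X.X.obj (op A) :=
  (Pi.evalRingHom _ X).comp (val A)

theorem lazardDesc_torusRes (X : GlobalGroupLaw.{u + 1}) {A B : Torus} (f : A.obj →ₜ* B.obj)
    (x : lazardFunctor.{u}.obj (op B)) :
    lazardDesc X A (torusRes _ f x) = torusRes X.X f (lazardDesc X B x) :=
  val_torusRes_apply f x X

theorem lazardDesc_eulerClass (X : GlobalGroupLaw.{u + 1}) {A : Torus} (V : A.Chars) :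
    lazardDesc X A (eulerClass lazardFunctor.{u} lazardCoordinate V) = eulerClass X.X X.e V :=
  val_eulerClass V X

/-- Homomorphisms from the initial global group law to a global group law are unique. -/
theorem lazard_hom_ext {Z : Torusᵒᵖ ⥤ CommRingCat.{w}} {e : Z.obj (op circleTorus)}
    (hZ : IsCoordinate Z e) (f g : ∀ A : Torus, lazardFunctor.{u}.obj (op A) →+* Z.obj (op A))
    (hf : ∀ {A B : Torus} (h : A.obj →ₜ* B.obj) (x : lazardFunctor.{u}.obj (op B)),
      f A (torusRes _ h x) = torusRes Z h (f B x))
    (hg : ∀ {A B : Torus} (h : A.obj →ₜ* B.obj) (x : lazardFunctor.{u}.obj (op B)),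
      g A (torusRes _ h x) = torusRes Z h (g B x))
    (he : f circleTorus lazardCoordinate = e) (he' : g circleTorus lazardCoordinate = e)
    (A : Torus) (x : lazardFunctor.{u}.obj (op A)) : f A x = g A x := by
  have hV : ∀ {A : Torus} (V : A.Chars), f A (eulerClass _ lazardCoordinate V) = eulerClass Z e V :=
    fun V => (hf V _).trans (congrArg _ he)
  have hV' : ∀ {A : Torus} (V : A.Chars), g A (eulerClass _ lazardCoordinate V) = eulerClass Z e V :=
    fun V => (hg V _).trans (congrArg _ he')
  -- Induction on the expression defining the element. Ring operations, Euler classes and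
  -- restrictions are preserved by both families of homomorphisms.
  have key : ∀ {n : ℕ} (t : TorusTerm n) (x : lazardFunctor.{u}.obj (op (Torus.std n))),
      val _ x = evalFam t → f _ x = g _ x := by
    have ex : ∀ {n : ℕ} (t : TorusTerm n), ∃ x, val.{u} (Torus.std n) x = evalFam t :=
      fun {n} t => exists_val_eq (by
        simpa [famRes_id] using famRes_evalFam_mem (ContinuousMonoidHom.id (Torus.std n).obj) t)
    intro n t
    induction t with
    | zero n =>
      intro x hx
      rw [val_injective _ (hx.trans (map_zero (val (Torus.std n))).symm), map_zero, map_zero]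
    | one n =>
      intro x hx
      rw [val_injective _ (hx.trans (map_one (val (Torus.std n))).symm), map_one, map_one]
    | neg t ih =>
      intro x hx
      obtain ⟨y, hy⟩ := ex t
      have : x = -y := val_injective _ (by rw [hx, map_neg, hy]; rfl)
      rw [this, map_neg, map_neg, ih y hy]
    | add t t' ih ih' =>
      intro x hx
      obtain ⟨y, hy⟩ := ex t
      obtain ⟨y', hy'⟩ := ex t'
      have : x = y + y' := val_injective _ (by rw [hx, map_add, hy, hy']; rfl)
      rw [this, map_add, map_add, ih y hy, ih' y' hy']
    | mul t t' ih ih' =>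
      intro x hx
      obtain ⟨y, hy⟩ := ex t
      obtain ⟨y', hy'⟩ := ex t'
      have : x = y * y' := val_injective _ (by rw [hx, map_mul, hy, hy']; rfl)
      rw [this, map_mul, map_mul, ih y hy, ih' y' hy']
    | euler V =>
      intro x hx
      have : x = eulerClass _ lazardCoordinate V :=
        val_injective _ (by rw [hx]; funext X; exact (val_eulerClass V X).symm)
      rw [this, hV, hV']
    | res h t ih =>
      intro x hx
      obtain ⟨y, hy⟩ := ex t
      have : x = torusRes _ h y := val_injective _ (by rw [hx, val_torusRes, hy]; rfl)
      rw [this, hf, hg, ih y hy]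
    | @div n t ih =>
      intro x hx
      obtain ⟨y, hy⟩ := ex t
      let x' : lazardFunctor.{u}.obj (op ((Torus.std n).prod circleTorus)) := x
      let y' : lazardFunctor.{u}.obj (op ((Torus.std n).prod circleTorus)) := y
      -- A quotient is characterized by this identity: the Euler class is cancellable in `Z`, so two
      -- homomorphisms that agree on the dividend agree on the quotient.
      have hxy : eulerClass _ lazardCoordinate (Torus.snd (Torus.std n) circleTorus) * x' =
          y' - torusRes _ (Torus.fst (Torus.std n) circleTorus)
            (torusRes _ (Torus.inl (Torus.std n) circleTorus) y') := by
        refine val_injective _ (funext fun X => ?_)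
        rw [map_mul, map_sub, Pi.mul_apply, Pi.sub_apply, val_eulerClass, val_torusRes_apply,
          val_torusRes_apply]
        have hx' : val ((Torus.std n).prod circleTorus) x' X =
          X.div (Torus.std n) (t.eval X) := congrFun hx X
        have hy' : val ((Torus.std n).prod circleTorus) y' X = t.eval X := congrFun hy X
        rw [hx', hy']
        exact X.eulerClass_mul_div (Torus.std n) (t.eval X)
      have h1 := congrArg (f _) hxy
      have h2 := congrArg (g _) hxy
      rw [map_mul, map_sub, hf, hf, hV] at h1
      rw [map_mul, map_sub, hg, hg, hV'] at h2
      refine hZ.eq_of_eulerClass_mul_eq (CharSplitting.snd (Torus.std n)) (h1.trans (Eq.trans ?_ h2.symm))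
      exact congrArg (fun w => w - torusRes Z (Torus.fst (Torus.std n) circleTorus)
        (torusRes Z (Torus.inl (Torus.std n) circleTorus) w)) (ih y hy)
  obtain ⟨t, ht⟩ := val_mem x
  obtain ⟨y, hy⟩ : ∃ y, val.{u} (Torus.std A.rank) y = evalFam t := exists_val_eq (by
    simpa [famRes_id] using famRes_evalFam_mem (ContinuousMonoidHom.id (Torus.std A.rank).obj) t)
  have : x = torusRes _ A.toStd y := val_injective _ (by rw [val_torusRes, hy]; exact ht.symm)
  rw [this, hf, hg, key t y hy]

/-! ### The global group law of an equivariant formal group law -/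

namespace Torus

variable {A : Torus} {G : Type*} [CommGroup G]

theorem charHom_ext {φ ψ : (A.prod circleTorus).Chars →* G}
    (h₁ : ∀ V : A.Chars, φ (V.comp (fst A circleTorus)) = ψ (V.comp (fst A circleTorus)))
    (h₂ : φ (snd A circleTorus) = ψ (snd A circleTorus)) : φ = ψ := by
  refine MonoidHom.ext fun W => ?_
  have : φ.comp (charPullback (snd A circleTorus)) = ψ.comp (charPullback (snd A circleTorus)) :=
    Circle.charHom_ext h₂
  rw [char_prod_eq W, map_mul, map_mul, h₁]
  exact congrArg _ (DFunLike.congr_fun this (W.comp (inr A circleTorus)))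

theorem exists_circleCharHom (g : G) :
    ∃ φ : circleTorus.Chars →* G, φ (ContinuousMonoidHom.id _) = g :=
  Circle.exists_charHom g

/-- The extension of a homomorphism defined on the characters of a torus to the characters of the
product with the circle. -/
def extendCharHom (φ : A.Chars →* G) (g : G) : (A.prod circleTorus).Chars →* G :=
  φ.comp (charPullback (inl A circleTorus)) *
    (exists_circleCharHom g).choose.comp (charPullback (inr A circleTorus))

@[simp]
theorem extendCharHom_fst (φ : A.Chars →* G) (g : G) (V : A.Chars) :
    extendCharHom φ g (V.comp (fst A circleTorus)) = φ V := by
  have h : charPullback (inr A circleTorus) (V.comp (fst A circleTorus)) = 1 := comp_one V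
  rw [extendCharHom, MonoidHom.mul_apply, MonoidHom.comp_apply, MonoidHom.comp_apply, h, map_one,
    mul_one]
  rfl

@[simp]
theorem extendCharHom_snd (φ : A.Chars →* G) (g : G) :
    extendCharHom φ g (snd A circleTorus) = g := by
  have h : charPullback (inl A circleTorus) (snd A circleTorus) = 1 := rfl
  rw [extendCharHom, MonoidHom.mul_apply, MonoidHom.comp_apply, MonoidHom.comp_apply, h, map_one,
    one_mul]
  exact (exists_circleCharHom g).choose_spec

end Torus

namespace EquivariantFGL

variable {Γ : Type} [CommGroup Γ] {k : Type u} [CommRing k] (F : EquivariantFGL Γ k)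

instance {K : Type u} [CommRing K] (b : k →+* K) : CommGroup (Pt F.θ b) := F.points.commGroup b

theorem one_hom_apply {F : EquivariantFGL Γ k} {K : Type u} [CommRing K] (b : k →+* K) (x : F.R) :
    (1 : Pt F.θ b).hom x = b (F.θ 1 x) := rfl

/-- Change of rings, as a homomorphism of groups of points. -/
def ptMap {K K' : Type u} [CommRing K] [CommRing K'] (j : K →+* K') (b : k →+* K) :
    Pt F.θ b →* Pt F.θ (j.comp b) where
  toFun := Pt.map j
  map_one' := rfl
  map_mul' := F.points.map_mul j

/-- The augmentations, as a homomorphism to the group of points. -/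
def augHom {K : Type u} [CommRing K] (b : k →+* K) : Γ →* Pt F.θ b where
  toFun V := Pt.aug F.θ V b
  map_one' := rfl
  map_mul' V W := (F.points.aug_mul V W).symm

theorem aug_one_y : F.θ 1 F.y = 0 := by
  have : F.y ∈ RingHom.ker (F.θ 1) := by
    rw [F.ker_aug]
    exact Ideal.mem_span_singleton_self _
  exact this

/-- Since `y` is regular the quotient of `x - θ(1)(x)` by `y` is unique, and uniqueness makes it
depend `k`-linearly on `x`. -/
theorem exists_divY : ∃ δ : F.R →ₗ[k] F.R, ∀ x, F.y * δ x = x - algebraMap k F.R (F.θ 1 x) := by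
  have h : ∀ x, ∃ z, F.y * z = x - algebraMap k F.R (F.θ 1 x) := fun x => by
    have : x - algebraMap k F.R (F.θ 1 x) ∈ RingHom.ker (F.θ 1) := by
      rw [RingHom.mem_ker, map_sub, AlgHom.commutes, Algebra.algebraMap_self_apply, sub_self]
    rw [F.ker_aug, Ideal.mem_span_singleton] at this
    exact this.imp fun z hz => hz.symm
  choose δ hδ using h
  have hinj : ∀ {a b : F.R}, F.y * a = F.y * b → a = b := fun {a b} hab => by
    rw [← sub_eq_zero]
    refine mem_nonZeroDivisors_iff_left.1 F.regular _ ?_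
    rw [mul_sub, hab, sub_self]
  refine ⟨⟨⟨δ, fun a b => hinj ?_⟩, fun c a => hinj ?_⟩, hδ⟩
  · rw [mul_add, hδ, hδ, hδ, map_add, map_add]
    ring
  · change F.y * δ (c • a) = F.y * (c • δ a)
    rw [mul_smul_comm, hδ, hδ, map_smul, smul_sub, smul_eq_mul, map_mul, Algebra.smul_def c
      (algebraMap k F.R _)]

/-- Division by the orientation. -/
def divY : F.R →ₗ[k] F.R := F.exists_divY.choose

theorem y_mul_divY (x : F.R) : F.y * F.divY x = x - algebraMap k F.R (F.θ 1 x) :=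
  F.exists_divY.choose_spec x

theorem divY_y_mul (x : F.R) : F.divY (F.y * x) = x := by
  have h := F.y_mul_divY (F.y * x)
  have h0 : F.θ 1 (F.y * x) = 0 := by rw [map_mul, aug_one_y, zero_mul]
  rw [h0, map_zero, sub_zero] at h
  rw [← sub_eq_zero]
  refine mem_nonZeroDivisors_iff_left.1 F.regular _ ?_
  rw [mul_sub, h, sub_self]

/-- Homomorphisms from the characters of a torus to the points of a formal group law. -/
structure CharPoint (A : Torus) where
  K : Type u
  [ring : CommRing K]
  b : k →+* K
  p : A.Chars →* Pt F.θ b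

namespace CharPoint

attribute [instance] CharPoint.ring

variable {F} {A B : Torus}

/-- A homomorphism of rings that maps one character point to another. -/
def Compat (s s' : CharPoint F A) (j : s.K →+* s'.K) : Prop :=
  ∀ V x, j ((s.p V).hom x) = (s'.p V).hom x

/-- The image under a homomorphism of tori. -/
abbrev push (f : A.obj →ₜ* B.obj) (s : CharPoint F A) : CharPoint F B :=
  ⟨s.K, s.b, s.p.comp (Torus.charPullback f)⟩

theorem Compat.push {s s' : CharPoint F A} {j : s.K →+* s'.K} (h : Compat s s' j)
    (f : A.obj →ₜ* B.obj) : Compat (s.push f) (s'.push f) j :=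
  fun V x => h (V.comp f) x

theorem Compat.comp_b {s s' : CharPoint F A} {j : s.K →+* s'.K} (h : Compat s s' j) :
    j.comp s.b = s'.b := by
  ext r
  rw [RingHom.comp_apply, ← (s.p 1).comm_apply, h 1, (s'.p 1).comm_apply]

/-- The extension of a character point by a point. -/
abbrev extend (s : CharPoint F A) (q : Pt F.θ s.b) : CharPoint F (A.prod circleTorus) :=
  ⟨s.K, s.b, Torus.extendCharHom s.p q⟩

theorem map_charHom_eq {K K' : Type u} [CommRing K] [CommRing K'] {b : k →+* K} {b' : k →+* K'}
    {p : (A.prod circleTorus).Chars →* Pt F.θ b} {p' : (A.prod circleTorus).Chars →* Pt F.θ b'}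
    {j : K →+* K'} (hb : j.comp b = b')
    (h₁ : ∀ (V : A.Chars) (x : F.R), j ((p (V.comp (Torus.fst A circleTorus))).hom x) =
      (p' (V.comp (Torus.fst A circleTorus))).hom x)
    (h₂ : ∀ x, j ((p (Torus.snd A circleTorus)).hom x) = (p' (Torus.snd A circleTorus)).hom x)
    (V : (A.prod circleTorus).Chars) (x : F.R) : j ((p V).hom x) = (p' V).hom x := by
  subst hb
  have : (F.ptMap j b).comp p = p' :=
    Torus.charHom_ext (fun V => Pt.ext fun x => h₁ V x) (Pt.ext h₂)
  rw [← this]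
  rfl

theorem Compat.of_prod {s s' : CharPoint F (A.prod circleTorus)} {j : s.K →+* s'.K}
    (h₁ : Compat (s.push (Torus.fst A circleTorus)) (s'.push (Torus.fst A circleTorus)) j)
    (h₂ : ∀ x, j ((s.p (Torus.snd A circleTorus)).hom x) =
      (s'.p (Torus.snd A circleTorus)).hom x) : Compat s s' j :=
  map_charHom_eq (j := j) h₁.comp_b h₁ h₂

instance (s : CharPoint F A) : Algebra k s.K := s.b.toAlgebra

/-- The universal extension, modulo an open ideal. -/
def univPt (s : CharPoint F A) (I : openIdeals F.θ) :
    Pt F.θ (algebraMap k (s.K ⊗[k] (F.R ⧸ I.1))) where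
  hom := (Algebra.TensorProduct.includeRight (R := k) (A := s.K)
    (B := F.R ⧸ I.1)).toRingHom.comp (Ideal.Quotient.mk I.1)
  comm := RingHom.ext fun r =>
    (Algebra.TensorProduct.includeRight (R := k) (A := s.K) (B := F.R ⧸ I.1)).commutes r
  isOpen := openIdeals_mono I.2 fun x hx => by
    rw [RingHom.mem_ker, RingHom.comp_apply, Ideal.Quotient.eq_zero_iff_mem.2 hx, map_zero]

/-- The base change of a character point. -/
abbrev map (s : CharPoint F A) {K : Type u} [CommRing K] (j : s.K →+* K) : CharPoint F A :=
  ⟨K, j.comp s.b, (F.ptMap j s.b).comp s.p⟩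

/-- The universal extension, modulo an open ideal. -/
abbrev univ (s : CharPoint F A) (I : openIdeals F.θ) : CharPoint F (A.prod circleTorus) :=
  (s.map (Algebra.TensorProduct.includeLeftRingHom (R := k) (A := s.K) (B := F.R ⧸ I.1))).extend
    (s.univPt I)

theorem univ_p_fst (s : CharPoint F A) (I : openIdeals F.θ) (V : A.Chars) (x : F.R) :
    ((s.univ I).p (V.comp (Torus.fst A circleTorus))).hom x = (s.p V).hom x ⊗ₜ[k] 1 :=
  congrArg (fun q : Pt F.θ (algebraMap k (s.K ⊗[k] (F.R ⧸ I.1))) => q.hom x)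
    (Torus.extendCharHom_fst _ _ V)

theorem univ_p_snd (s : CharPoint F A) (I : openIdeals F.θ) (x : F.R) :
    ((s.univ I).p (Torus.snd A circleTorus)).hom x = (1 : s.K) ⊗ₜ[k] Ideal.Quotient.mk I.1 x :=
  congrArg (fun q : Pt F.θ (algebraMap k (s.K ⊗[k] (F.R ⧸ I.1))) => q.hom x)
    (Torus.extendCharHom_snd _ _)

section Specialize

variable {s : CharPoint F A} {t : CharPoint F (A.prod circleTorus)} {j : s.K →+* t.K}
  (h : Compat s (t.push (Torus.fst A circleTorus)) j) {I : openIdeals F.θ}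
  (hI : I.1 ≤ RingHom.ker (t.p (Torus.snd A circleTorus)).hom)

/-- The universal property of the universal extension. -/
def specialize : (s.univ I).K →+* t.K :=
  tensorLift (k := k) (S := s.K) (T := F.R ⧸ I.1) j ((t.p (Torus.snd A circleTorus)).desc I.1 hI)
    (by rw [Pt.desc_comp_algebraMap]; exact h.comp_b)

theorem specialize_tmul (a : s.K) (x : F.R) :
    specialize h hI (a ⊗ₜ[k] Ideal.Quotient.mk I.1 x) =
      j a * (t.p (Torus.snd A circleTorus)).hom x :=
  tensorLift_tmul _ _ _ _ _

theorem compat_specialize : Compat (s.univ I) t (specialize h hI) := by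
  refine Compat.of_prod (fun V x => ?_) fun x => ?_
  · change specialize h hI (((s.univ I).p (V.comp (Torus.fst A circleTorus))).hom x) = _
    rw [univ_p_fst]
    refine (specialize_tmul h hI _ 1).trans ?_
    rw [map_one, mul_one]
    exact h V x
  · rw [univ_p_snd, specialize_tmul, map_one, one_mul]

end Specialize

end CharPoint

end EquivariantFGL

/-! ### Natural functions on character points and their difference quotients. -/

namespace EquivariantFGL

variable {Γ : Type} [CommGroup Γ] {k : Type u} [CommRing k] (F : EquivariantFGL Γ k)

/-- The ring of natural functions on character points. -/
def natFun (A : Torus) : Subring (∀ s : CharPoint F A, s.K) where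
  carrier := {x | ∀ (s s' : CharPoint F A) (j : s.K →+* s'.K), CharPoint.Compat s s' j →
    j (x s) = x s'}
  mul_mem' hx hy s s' j h := by rw [Pi.mul_apply, Pi.mul_apply, map_mul, hx s s' j h, hy s s' j h]
  add_mem' hx hy s s' j h := by rw [Pi.add_apply, Pi.add_apply, map_add, hx s s' j h, hy s s' j h]
  neg_mem' hx s s' j h := by rw [Pi.neg_apply, Pi.neg_apply, map_neg, hx s s' j h]
  one_mem' _ _ j _ := map_one j
  zero_mem' _ _ j _ := map_zero j

/-- Restriction of natural functions. -/
def natFunRes {A B : Torus} (f : A.obj →ₜ* B.obj) : natFun F B →+* natFun F A where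
  toFun x := ⟨fun s => x.1 (s.push f), fun s s' j h => x.2 (s.push f) (s'.push f) j (h.push f)⟩
  map_one' := rfl
  map_mul' _ _ := rfl
  map_zero' := rfl
  map_add' _ _ := rfl

/-- The contravariant functor of natural functions on character points. -/
def pointFunctor : Torusᵒᵖ ⥤ CommRingCat.{u + 1} where
  obj A := CommRingCat.of (natFun F A.unop)
  map f := CommRingCat.ofHom (natFunRes F f.unop.hom)
  map_id _ := rfl
  map_comp _ _ := rfl

/-- The coordinate of the functor of natural functions, given by the orientation. -/
def pointCoordinate : F.pointFunctor.obj (op circleTorus) :=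
  (⟨fun s => (s.p (ContinuousMonoidHom.id _)).hom F.y,
    fun _ _ _ h => h (ContinuousMonoidHom.id _) F.y⟩ : natFun F circleTorus)

/-- Evaluation at a character point. -/
def pointEval {A : Torus} (s : CharPoint F A) : F.pointFunctor.obj (op A) →+* s.K :=
  (Pi.evalRingHom _ s).comp (natFun F A).subtype

variable {F}

theorem pointFunctor_ext {A : Torus} {x x' : F.pointFunctor.obj (op A)}
    (h : ∀ s, F.pointEval s x = F.pointEval s x') : x = x' :=
  Subtype.ext (funext h)

theorem pointEval_torusRes {A B : Torus} (f : A.obj →ₜ* B.obj) (s : CharPoint F A)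
    (x : F.pointFunctor.obj (op B)) :
    F.pointEval s (torusRes _ f x) = F.pointEval (s.push f) x := rfl

theorem pointEval_eulerClass {A : Torus} (V : A.Chars) (s : CharPoint F A) :
    F.pointEval s (eulerClass _ F.pointCoordinate V) = (s.p V).hom F.y := rfl

theorem pointEval_compat {A : Torus} {s s' : CharPoint F A} {j : s.K →+* s'.K}
    (h : CharPoint.Compat s s' j) (x : F.pointFunctor.obj (op A)) :
    j (F.pointEval s x) = F.pointEval s' x := x.2 s s' j h

namespace CharPoint

variable {A : Torus} (s : CharPoint F (A.prod circleTorus))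

/-- The base of a character point for a product. -/
abbrev base : CharPoint F A := s.push (Torus.fst A circleTorus)

/-- The coordinate of a character point for a product with the circle. -/
abbrev coord : Pt F.θ s.b := s.p (Torus.snd A circleTorus)

theorem compat_base : Compat s.base (s.push (Torus.fst A circleTorus)) (RingHom.id s.K) :=
  fun _ _ => rfl

/-- An open ideal that is mapped to the kernel of a point by division by the orientation. -/
def kerMulY : openIdeals F.θ :=
  ⟨Ideal.span {F.y} * RingHom.ker s.coord.hom, openIdeals_mul
    (F.ker_aug ▸ ker_mem_openIdeals F.θ 1) s.coord.isOpen⟩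

theorem kerMulY_le_ker : s.kerMulY.1 ≤ RingHom.ker s.coord.hom := Ideal.mul_le_right

theorem kerMulY_le_span : s.kerMulY.1 ≤ Ideal.span {F.y} := Ideal.mul_le_left

/-- The factor `y` in `kerMulY` compensates for the one removed by division, so that `divY` descends
to the quotient by this ideal. -/
theorem coord_divY_of_mem {x : F.R} (hx : x ∈ s.kerMulY.1) : s.coord.hom (F.divY x) = 0 := by
  obtain ⟨z, hz, rfl⟩ := Ideal.mem_span_singleton_mul.1 hx
  rw [divY_y_mul]
  exact hz

/-- The difference quotient of a point, with values in the ring of a character point. -/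
def divQuot : F.R ⧸ s.kerMulY.1 →+ s.K :=
  QuotientAddGroup.lift s.kerMulY.1.toAddSubgroup
    (s.coord.hom.toAddMonoidHom.comp F.divY.toAddMonoidHom) fun _ hx => s.coord_divY_of_mem hx

theorem divQuot_mk (x : F.R) :
    s.divQuot (Ideal.Quotient.mk _ x) = s.coord.hom (F.divY x) := rfl

/-- The difference quotient of functions on the universal extension. -/
def diffQuot : (s.base.univ s.kerMulY).K →+ s.K :=
  TensorProduct.liftAddHom (R := k) (M := s.K) (N := F.R ⧸ s.kerMulY.1)
    ((AddMonoidHom.compHom.flip s.divQuot).comp AddMonoidHom.mul) fun r a n => by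
      obtain ⟨x, rfl⟩ := Ideal.Quotient.mk_surjective n
      change (s.b r * a) * s.divQuot (Ideal.Quotient.mk _ x) =
        a * s.divQuot (Ideal.Quotient.mk _ (r • x))
      rw [divQuot_mk, divQuot_mk, map_smul, Algebra.smul_def, map_mul, s.coord.comm_apply]
      ring

theorem diffQuot_tmul (a : s.K) (x : F.R) :
    s.diffQuot (a ⊗ₜ[k] Ideal.Quotient.mk _ x) = a * s.coord.hom (F.divY x) := rfl

/-- Evaluation at the given point. -/
abbrev evalCoord : (s.base.univ s.kerMulY).K →+* s.K := specialize s.compat_base s.kerMulY_le_ker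

/-- Dividing by the coordinate after multiplying by it recovers the value. This is the regularity of
the Euler class of the second projection. -/
theorem diffQuot_coord_mul (w : (s.base.univ s.kerMulY).K) :
    s.diffQuot ((s.base.univ s.kerMulY).coord.hom F.y * w) = s.evalCoord w := by
  rw [coord, univ_p_snd]
  revert w
  refine fun w => TensorProduct.induction_on (R := k) (M := s.K) (N := F.R ⧸ s.kerMulY.1) w
    ?_ ?_ ?_
  · rw [mul_zero, map_zero]; exact (map_zero s.evalCoord).symm
  · intro a n
    obtain ⟨x, rfl⟩ := Ideal.Quotient.mk_surjective n
    refine (congrArg s.diffQuot (Algebra.TensorProduct.tmul_mul_tmul (R := k) (A := s.K)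
      (B := F.R ⧸ s.kerMulY.1) 1 a (Ideal.Quotient.mk _ F.y) (Ideal.Quotient.mk _ x))).trans ?_
    rw [one_mul, ← map_mul, diffQuot_tmul, divY_y_mul]
    exact (specialize_tmul s.compat_base s.kerMulY_le_ker a x).symm
  · intro w w' hw hw'
    rw [mul_add, map_add, hw, hw']
    exact (map_add s.evalCoord w w').symm

theorem compat_inl : Compat s.base ((s.base.push (Torus.inl A circleTorus)).push
    (Torus.fst A circleTorus)) (RingHom.id s.K) := fun _ _ => rfl

theorem coord_inl (x : F.R) : (s.base.push (Torus.inl A circleTorus)).coord.hom x = s.b (F.θ 1 x) :=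
  congrArg (fun q : Pt F.θ s.b => q.hom x) (map_one s.base.p)

theorem kerMulY_le_ker_inl :
    s.kerMulY.1 ≤ RingHom.ker (s.base.push (Torus.inl A circleTorus)).coord.hom := fun x hx => by
  have : x ∈ RingHom.ker (F.θ 1) := F.ker_aug ▸ s.kerMulY_le_span hx
  exact (s.coord_inl x).trans ((congrArg s.b this).trans (map_zero s.b))

/-- Evaluation at the trivial point. -/
abbrev evalOne : (s.base.univ s.kerMulY).K →+* s.K := specialize s.compat_inl s.kerMulY_le_ker_inl

/-- The defining identity of `divY`, extended linearly over the universal extension. For a function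
that vanishes at the trivial point, the difference quotient is a preimage under multiplication by
the Euler class. -/
theorem coord_mul_diffQuot (w : (s.base.univ s.kerMulY).K) :
    s.coord.hom F.y * s.diffQuot w = s.evalCoord w - s.evalOne w := by
  refine TensorProduct.induction_on (R := k) (M := s.K) (N := F.R ⧸ s.kerMulY.1) w ?_ ?_ ?_
  · exact (congrArg _ (map_zero s.diffQuot)).trans ((mul_zero _).trans
      ((sub_zero _).symm.trans (congrArg₂ _ (map_zero s.evalCoord).symm (map_zero s.evalOne).symm)))
  · intro a n
    obtain ⟨x, rfl⟩ := Ideal.Quotient.mk_surjective n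
    rw [diffQuot_tmul, specialize_tmul, specialize_tmul, coord_inl, mul_left_comm, ← map_mul,
      y_mul_divY, map_sub, s.coord.comm_apply, mul_sub]
    rfl
  · intro w w' hw hw'
    have h1 : s.evalCoord (w + w') = s.evalCoord w + s.evalCoord w' := map_add s.evalCoord w w'
    have h2 : s.evalOne (w + w') = s.evalOne w + s.evalOne w' := map_add s.evalOne w w'
    have h3 : s.diffQuot (w + w') = s.diffQuot w + s.diffQuot w' := map_add s.diffQuot w w'
    refine (congrArg _ h3).trans ?_
    rw [mul_add, hw, hw']
    refine Eq.trans ?_ (congrArg₂ _ h1 h2).symm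
    ring

-- Needed for the difference quotient to be a natural function. The universal extension of `s`
-- modulo its ideal specializes to that of `s'`, whose ideal is larger, and the quotient is natural
-- on pure tensors.
variable {s} in
theorem Compat.diffQuot {s' : CharPoint F (A.prod circleTorus)} {j : s.K →+* s'.K}
    (h : Compat s s' j) (x : F.pointFunctor.obj (op (A.prod circleTorus))) :
    j (s.diffQuot (F.pointEval (s.base.univ s.kerMulY) x)) =
      s'.diffQuot (F.pointEval (s'.base.univ s'.kerMulY) x) := by
  have hle : s.kerMulY.1 ≤ s'.kerMulY.1 := Ideal.mul_mono le_rfl fun x hx => by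
    rw [RingHom.mem_ker] at hx ⊢
    rw [← h, hx, map_zero]
  let i : s.K →+* (s'.base.univ s'.kerMulY).K :=
    (Algebra.TensorProduct.includeLeftRingHom (R := k) (A := s'.K)
      (B := F.R ⧸ s'.kerMulY.1)).comp j
  have hi : Compat s.base ((s'.base.univ s'.kerMulY).push (Torus.fst A circleTorus)) i := by
    intro V x
    refine Eq.trans ?_ (univ_p_fst s'.base s'.kerMulY V x).symm
    exact congrArg (fun a => a ⊗ₜ[k] (1 : F.R ⧸ s'.kerMulY.1)) (h.push (Torus.fst A circleTorus) V x)
  have hker : s.kerMulY.1 ≤ RingHom.ker (s'.base.univ s'.kerMulY).coord.hom := fun x hx => by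
    rw [RingHom.mem_ker, coord, univ_p_snd, Ideal.Quotient.eq_zero_iff_mem.2 (hle hx)]
    exact TensorProduct.tmul_zero _ _
  rw [← pointEval_compat (compat_specialize hi hker) x]
  generalize F.pointEval (s.base.univ s.kerMulY) x = w
  refine TensorProduct.induction_on (R := k) (M := s.K) (N := F.R ⧸ s.kerMulY.1) w ?_ ?_ ?_
  · have h1 : s.diffQuot (0 : (s.base.univ s.kerMulY).K) = 0 := map_zero _
    have h2 : specialize hi hker (0 : (s.base.univ s.kerMulY).K) = 0 := map_zero _
    exact (congrArg j h1).trans ((map_zero j).trans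
      ((map_zero s'.diffQuot).symm.trans (congrArg s'.diffQuot h2).symm))
  · intro a n
    obtain ⟨x, rfl⟩ := Ideal.Quotient.mk_surjective n
    rw [diffQuot_tmul, specialize_tmul, univ_p_snd, map_mul, h]
    refine Eq.trans ?_ (congrArg s'.diffQuot (Algebra.TensorProduct.tmul_mul_tmul (R := k)
      (A := s'.K) (B := F.R ⧸ s'.kerMulY.1) (j a) 1 1 (Ideal.Quotient.mk _ x))).symm
    rw [one_mul, mul_one, diffQuot_tmul]
  · intro w w' hw hw'
    have h1 : s.diffQuot (w + w') = s.diffQuot w + s.diffQuot w' := map_add _ _ _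
    have h2 : specialize hi hker (w + w') = specialize hi hker w + specialize hi hker w' :=
      map_add _ _ _
    refine (congrArg j h1).trans (Eq.trans ?_ (congrArg s'.diffQuot h2).symm)
    rw [map_add, map_add, hw, hw']

end CharPoint

variable (F) in
/-- The natural functions on character points form a global group law. -/
theorem isCoordinate_pointCoordinate : IsCoordinate F.pointFunctor F.pointCoordinate := by
  refine isCoordinate_of_prod (fun A => ?_) (fun A x hx => ?_) fun A x hx => ?_
  · refine pointFunctor_ext fun s => ?_
    rw [pointEval_eulerClass, map_one, one_hom_apply, aug_one_y, map_zero, map_zero]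
  · refine pointFunctor_ext fun s => ?_
    rw [← pointEval_compat (CharPoint.compat_specialize s.compat_base s.kerMulY_le_ker) x,
      ← s.diffQuot_coord_mul, CharPoint.coord, ← pointEval_eulerClass, ← map_mul, hx, map_zero,
      map_zero, map_zero]
  · let z : F.pointFunctor.obj (op (A.prod circleTorus)) :=
      (⟨fun s => s.diffQuot (F.pointEval (s.base.univ s.kerMulY) x),
        fun s s' j h => h.diffQuot x⟩ : natFun F (A.prod circleTorus))
    refine ⟨z, pointFunctor_ext fun s => ?_⟩
    rw [map_mul, pointEval_eulerClass]
    refine (s.coord_mul_diffQuot _).trans ?_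
    rw [pointEval_compat (CharPoint.compat_specialize s.compat_base s.kerMulY_le_ker) x,
      pointEval_compat (CharPoint.compat_specialize s.compat_inl s.kerMulY_le_ker_inl) x,
      ← pointEval_torusRes, hx, map_zero, sub_zero]

variable (F) in
/-- The global group law of natural functions on character points. -/
abbrev pointLaw : GlobalGroupLaw.{u + 1} := ⟨_, _, F.isCoordinate_pointCoordinate⟩

/-- The evaluation of the initial global group law at a character point. -/
def lazardEval {A : Torus} (s : CharPoint F A) : lazardFunctor.{u}.obj (op A) →+* s.K :=
  (F.pointEval s).comp (lazardDesc F.pointLaw A)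

theorem lazardEval_torusRes {A B : Torus} (f : A.obj →ₜ* B.obj) (s : CharPoint F A)
    (x : lazardFunctor.{u}.obj (op B)) :
    lazardEval s (torusRes _ f x) = lazardEval (s.push f) x := by
  rw [lazardEval, RingHom.comp_apply, lazardDesc_torusRes]
  rfl

theorem lazardEval_eulerClass {A : Torus} (V : A.Chars) (s : CharPoint F A) :
    lazardEval s (eulerClass _ lazardCoordinate V) = (s.p V).hom F.y := by
  rw [lazardEval, RingHom.comp_apply, lazardDesc_eulerClass]
  rfl

theorem lazardEval_compat {A : Torus} {s s' : CharPoint F A} {j : s.K →+* s'.K}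
    (h : CharPoint.Compat s s' j) (x : lazardFunctor.{u}.obj (op A)) :
    j (lazardEval s x) = lazardEval s' x := pointEval_compat h _

/-- The universal property of the evaluation of the initial global group law. -/
theorem lazardEval_unique
    (f : ∀ {A : Torus} (s : CharPoint F A), lazardFunctor.{u}.obj (op A) →+* s.K)
    (hf : ∀ {A B : Torus} (g : A.obj →ₜ* B.obj) (s : CharPoint F A)
      (x : lazardFunctor.{u}.obj (op B)), f s (torusRes _ g x) = f (s.push g) x)
    (he : ∀ s : CharPoint F circleTorus,
      f s lazardCoordinate = (s.p (ContinuousMonoidHom.id _)).hom F.y)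
    (hc : ∀ {A : Torus} {s s' : CharPoint F A} {j : s.K →+* s'.K}, CharPoint.Compat s s' j →
      ∀ x, j (f s x) = f s' x)
    {A : Torus} (s : CharPoint F A) (x : lazardFunctor.{u}.obj (op A)) : f s x = lazardEval s x := by
  let f' : ∀ A : Torus, lazardFunctor.{u}.obj (op A) →+* F.pointFunctor.obj (op A) := fun A =>
    (RingHom.codRestrict (RingHom.pi fun s : CharPoint F A => f s) (natFun F A)
      fun x s s' j h => hc h x : _ →+* natFun F A)
  exact congrArg (F.pointEval s) (lazard_hom_ext F.isCoordinate_pointCoordinate f'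
    (fun A => lazardDesc F.pointLaw A) (fun h x => pointFunctor_ext fun s => hf h s x)
    (fun h x => lazardDesc_torusRes F.pointLaw h x) (pointFunctor_ext fun s => he s)
    ((lazardDesc_eulerClass F.pointLaw (ContinuousMonoidHom.id circleTorus.obj) |> fun h => by
      rwa [eulerClass_id, eulerClass_id] at h)) A x)

end EquivariantFGL

/-! ### The equivariant formal group law of a global group law -/

section Lift

variable {S₀ S T U K : Type*} [CommRing S₀] [CommRing S] [CommRing T] [CommRing U] [CommRing K]
  {h : S₀ →+* S} {f : S₀ →+* T} {p : S →+* U} {q : T →+* U} {s : Multiset T}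

/-- Injectivity of `κ` modulo the product of `s`, by removing one factor `y` at a time: after
division with remainder in `Z`, the hypothesis `hsep` forces the remainder to vanish, and `hreg`
cancels `y`. -/
theorem exists_eq_mul_of_map_eq_mul {Z : Type*} [CommRing Z] (κ : Z →+* U) (ι : T →+* Z)
    (ι' : S →+* Z) (hι : κ.comp ι = q) (hι' : κ.comp ι' = p)
    (hZ : ∀ y ∈ s, ∀ z, ∃ c z', z = ι' c + ι y * z')
    (hsep : ∀ y ∈ s, ∀ c x, p c = q y * x → c = 0)
    (hreg : ∀ y ∈ s, ∀ x x', q y * x = q y * x' → x = x') {z : Z} {r : U}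
    (hz : κ z = q s.prod * r) : ∃ z', z = ι s.prod * z' := by
  subst hι hι'
  induction s using Multiset.induction_on generalizing z with
  | empty => exact ⟨z, by simp⟩
  | cons y s ih =>
    obtain ⟨c, z', rfl⟩ := hZ y (Multiset.mem_cons_self y s) z
    rw [Multiset.prod_cons, map_add, map_mul, map_mul, mul_assoc] at hz
    obtain rfl : c = 0 := hsep y (Multiset.mem_cons_self y s) c
      ((κ.comp ι) s.prod * r - κ z') (by rw [mul_sub, ← hz]; exact (add_sub_cancel_right _ _).symm)
    rw [map_zero, map_zero, zero_add] at hz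
    obtain ⟨z'', rfl⟩ := ih (fun y hy => hZ y (Multiset.mem_cons_of_mem hy))
      (fun y hy => hreg y (Multiset.mem_cons_of_mem hy))
      (hreg y (Multiset.mem_cons_self y s) _ _ hz)
      (fun y hy => hsep y (Multiset.mem_cons_of_mem hy))
    exact ⟨z'', by rw [map_zero, zero_add, Multiset.prod_cons, map_mul, mul_assoc]⟩

/-- The corresponding surjectivity modulo the product, by repeated division with remainder in `U`.
-/
theorem exists_eq_add_mul {Z : Type*} [CommRing Z] (κ : Z →+* U) (ι : T →+* Z)
    (ι' : S →+* Z) (hι : κ.comp ι = q) (hι' : κ.comp ι' = p)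
    (hU : ∀ y ∈ s, ∀ x, ∃ c x', x = p c + q y * x') (x : U) :
    ∃ z r, x = κ z + q s.prod * r := by
  subst hι hι'
  induction s using Multiset.induction_on generalizing x with
  | empty => exact ⟨0, x, by simp⟩
  | cons y s ih =>
    obtain ⟨c, x', rfl⟩ := hU y (Multiset.mem_cons_self y s) x
    obtain ⟨z, r, rfl⟩ := ih x' (fun y hy => hU y (Multiset.mem_cons_of_mem hy))
    refine ⟨ι' c + ι y * z, r, ?_⟩
    simp only [Multiset.prod_cons, map_add, map_mul, RingHom.comp_apply]
    ring

/-- A homomorphism that is defined on generators extends, provided that it vanishes on a product of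
elements with a division algorithm. -/
theorem existsUnique_lift (hpq : p.comp h = q.comp f)
    (hT : ∀ y ∈ s, ∀ t, ∃ a t', t = f a + y * t')
    (hU : ∀ y ∈ s, ∀ x, ∃ c x', x = p c + q y * x')
    (hsep : ∀ y ∈ s, ∀ c x, p c = q y * x → c = 0)
    (hreg : ∀ y ∈ s, ∀ x x', q y * x = q y * x' → x = x')
    (u : S →+* K) (v : T →+* K) (huv : u.comp h = v.comp f) (hv : v s.prod = 0) :
    ∃! w : U →+* K, w.comp p = u ∧ w.comp q = v := by
  let _ := h.toAlgebra
  let _ := f.toAlgebra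
  let κ : S ⊗[S₀] T →+* U := tensorLift p q hpq
  let ι : T →+* S ⊗[S₀] T := (Algebra.TensorProduct.includeRight (R := S₀) (A := S)).toRingHom
  let ι' : S →+* S ⊗[S₀] T := Algebra.TensorProduct.includeLeftRingHom
  have hι : κ.comp ι = q := RingHom.ext fun t => by
    refine (tensorLift_tmul p q hpq 1 t).trans ?_
    rw [map_one, one_mul]
  have hι' : κ.comp ι' = p := RingHom.ext fun t => by
    refine (tensorLift_tmul p q hpq t 1).trans ?_
    rw [map_one, mul_one]
  have hZ : ∀ y ∈ s, ∀ z, ∃ c z', z = ι' c + ι y * z' := by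
    intro y hy z
    induction z using TensorProduct.induction_on with
    | zero => exact ⟨0, 0, by simp⟩
    | add z z' hz hz' =>
      obtain ⟨c, w, rfl⟩ := hz
      obtain ⟨c', w', rfl⟩ := hz'
      exact ⟨c + c', w + w', by rw [map_add]; ring⟩
    | tmul a t =>
      obtain ⟨a', t', rfl⟩ := hT y hy t
      refine ⟨h a' * a, a ⊗ₜ t', ?_⟩
      rw [TensorProduct.tmul_add]
      congr 1
      · change a ⊗ₜ (algebraMap S₀ T a') = (a' • a) ⊗ₜ 1
        rw [TensorProduct.smul_tmul, Algebra.algebraMap_eq_smul_one]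
      · change _ = ((1 : S) ⊗ₜ[S₀] y) * (a ⊗ₜ t')
        rw [Algebra.TensorProduct.tmul_mul_tmul, one_mul]
  let τ : S ⊗[S₀] T →+* K := tensorLift u v huv
  have hτ : ∀ t, τ (ι t) = v t := fun t => by
    refine (tensorLift_tmul u v huv 1 t).trans ?_
    rw [map_one, one_mul]
  have hτ' : ∀ c, τ (ι' c) = u c := fun t => by
    refine (tensorLift_tmul u v huv t 1).trans ?_
    rw [map_one, mul_one]
  have hS := exists_eq_add_mul κ ι ι' hι hι' hU
  -- By the two preceding lemmas `κ` is an isomorphism modulo the product of `s`. Since `τ` kills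
  -- that product, it factors over the quotient of `U`.
  let ρ : S ⊗[S₀] T →+* U ⧸ Ideal.span {q s.prod} := (Ideal.Quotient.mk _).comp κ
  have hρ : Function.Surjective ρ := fun x => by
    obtain ⟨x, rfl⟩ := Ideal.Quotient.mk_surjective x
    obtain ⟨z, r, rfl⟩ := hS x
    refine ⟨z, ?_⟩
    refine (Ideal.Quotient.eq.2 ?_).symm
    rw [add_sub_cancel_left]
    exact Ideal.mul_mem_right _ _ (Ideal.mem_span_singleton_self _)
  have hker : RingHom.ker ρ ≤ RingHom.ker τ := fun z hz => by
    have : κ z ∈ Ideal.span {q s.prod} := Ideal.Quotient.eq_zero_iff_mem.1 hz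
    obtain ⟨r, hr⟩ := Ideal.mem_span_singleton.1 this
    obtain ⟨z', rfl⟩ := exists_eq_mul_of_map_eq_mul κ ι ι' hι hι' hZ hsep hreg hr
    rw [RingHom.mem_ker, map_mul, hτ, hv, zero_mul]
  let w : U →+* K := (RingHom.liftOfSurjective ρ hρ ⟨τ, hker⟩).comp (Ideal.Quotient.mk _)
  have hw : ∀ z, w (κ z) = τ z := fun z => ρ.liftOfSurjective_comp_apply hρ ⟨τ, hker⟩ z
  refine ⟨w, ⟨?_, ?_⟩, fun w' ⟨h₁, h₂⟩ => ?_⟩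
  · rw [← hι']
    exact RingHom.ext fun c => (hw _).trans (hτ' c)
  · rw [← hι]
    exact RingHom.ext fun c => (hw _).trans (hτ c)
  · have h₃ : w'.comp κ = τ := by
      refine tensorHom_ext (fun c => ?_) fun t => ?_
      · exact (DFunLike.congr_fun ((congrArg w'.comp hι').trans h₁) c).trans (hτ' c).symm
      · exact (DFunLike.congr_fun ((congrArg w'.comp hι).trans h₂) t).trans (hτ t).symm
    ext x
    obtain ⟨z, r, rfl⟩ := hS x
    have h₄ : w' (q s.prod) = 0 := (DFunLike.congr_fun h₂ _).trans hv
    have h₅ : w (q s.prod) = 0 := by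
      rw [← hι]
      exact (hw _).trans ((hτ _).trans hv)
    rw [map_add, map_add, map_mul, map_mul, h₄, h₅, hw, zero_mul, zero_mul]
    exact congrArg (· + 0) (DFunLike.congr_fun h₃ z)

end Lift

namespace Torus

variable {A B C D : Torus}

/-- The character of `A × 𝕋` with kernel the graph of a character of `A`. -/
def graphChar (V : A.Chars) : (A.prod circleTorus).Chars :=
  (V.comp (fst A circleTorus))⁻¹ * snd A circleTorus

theorem charSplitting_graphChar (V : A.Chars) : CharSplitting (graphChar V)
    (lift (ContinuousMonoidHom.id _) V) (fst A circleTorus) (inr A circleTorus) where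
  char_section := by simp [graphChar, comp_assoc]
  retraction := rfl
  char_incl := by simp [graphChar, comp_assoc]
  decomp := hom_ext (by simp [← comp_assoc]) (by simp [← comp_assoc, graphChar])

theorem graphChar_comp_lift (V : B.Chars) (h : C.obj →ₜ* B.obj) (χ : C.Chars) :
    (graphChar V).comp (lift h χ) = (V.comp h)⁻¹ * χ := rfl

/-- The product of a homomorphism with the identity. -/
abbrev prodMap (h : C.obj →ₜ* B.obj) (A : Torus) : (C.prod A).obj →ₜ* (B.prod A).obj :=
  lift (h.comp (fst C A)) (snd C A)

end Torus

section LiftTorus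

variable {X : Torusᵒᵖ ⥤ CommRingCat.{u}} {e : X.obj (op circleTorus)} (hX : IsCoordinate X e)

-- Modulo the product of the Euler classes, `X(C × 𝕋)` is the base change of `X(B × 𝕋)` along `X(B)
-- → X(C)`. The reason is division with remainder by the Euler class of a graph character: the
-- kernel of that character is the graph, a copy of the base, over `B` as well as over `C`.
include hX in
theorem existsUnique_torus_lift {B C : Torus} (h : C.obj →ₜ* B.obj) {K : Type*} [CommRing K]
    (u : X.obj (op C) →+* K) (v : X.obj (op (B.prod circleTorus)) →+* K)
    (huv : u.comp (torusRes X h) = v.comp (torusRes X (Torus.fst B circleTorus)))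
    (s : Multiset B.Chars) (hv : v (s.map fun V => eulerClass X e (Torus.graphChar V)).prod = 0) :
    ∃! w : X.obj (op (C.prod circleTorus)) →+* K,
      w.comp (torusRes X (Torus.fst C circleTorus)) = u ∧
      w.comp (torusRes X (Torus.prodMap h circleTorus)) = v := by
  have hq : ∀ V : B.Chars, torusRes X (Torus.prodMap h circleTorus)
      (eulerClass X e (Torus.graphChar V)) = eulerClass X e (Torus.graphChar (V.comp h)) :=
    fun V => torusRes_eulerClass _ _ _ _
  refine existsUnique_lift (h := torusRes X h) (f := torusRes X (Torus.fst B circleTorus))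
    (s := s.map fun V => eulerClass X e (Torus.graphChar V)) ?_ ?_ ?_ ?_ ?_ u v huv hv
  · ext x
    simp only [RingHom.comp_apply, torusRes_torusRes]
    rfl
  · simp only [Multiset.mem_map]
    rintro _ ⟨V, -, rfl⟩ t
    obtain ⟨z, hz⟩ := hX.exists_eulerClass_mul (Torus.charSplitting_graphChar V) t
    exact ⟨_, z, by rw [hz, add_sub_cancel]⟩
  · simp only [Multiset.mem_map]
    rintro _ ⟨V, -, rfl⟩ t
    obtain ⟨z, hz⟩ := hX.exists_eulerClass_mul (Torus.charSplitting_graphChar (V.comp h)) t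
    exact ⟨_, z, by rw [hq, hz, add_sub_cancel]⟩
  · simp only [Multiset.mem_map]
    rintro _ ⟨V, -, rfl⟩ c x hcx
    have := congrArg (torusRes X (Torus.lift (ContinuousMonoidHom.id _) (V.comp h))) hcx
    rw [hq, map_mul, torusRes_eulerClass, (Torus.charSplitting_graphChar (V.comp h)).char_incl,
      hX.eulerClass_one, zero_mul, torusRes_torusRes, Torus.fst_comp_lift, torusRes_id] at this
    exact this
  · simp only [Multiset.mem_map]
    rintro _ ⟨V, -, rfl⟩ x x' hxx
    rw [hq] at hxx
    exact hX.eq_of_eulerClass_mul_eq (Torus.charSplitting_graphChar (V.comp h)) hxx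

end LiftTorus

/-! ### Quotients of global group laws: ground ring, augmentations and generators of their kernels.
-/

/-- A global group law and a torus, together with a quotient of the group of characters of the
torus. -/
structure LawQuotient (Γ : Type) [CommGroup Γ] where
  X : Torusᵒᵖ ⥤ CommRingCat.{u}
  e : X.obj (op circleTorus)
  isCoordinate : IsCoordinate X e
  B : Torus
  φ : B.Chars →* Γ
  surjective : Function.Surjective φ

namespace LawQuotient

variable {Γ : Type} [CommGroup Γ] (S : LawQuotient.{u} Γ)

/-- The ideal generated by the Euler classes of the characters that become trivial. -/
def ideal : Ideal (S.X.obj (op S.B)) :=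
  Ideal.span {x | ∃ V : S.B.Chars, S.φ V = 1 ∧ eulerClass S.X S.e V = x}

theorem eulerClass_mem {V : S.B.Chars} (hV : S.φ V = 1) : eulerClass S.X S.e V ∈ S.ideal :=
  Ideal.subset_span ⟨V, hV, rfl⟩

/-- The ground ring. -/
abbrev k : Type u := S.X.obj (op S.B) ⧸ S.ideal

/-- The coordinate ring, before completion. -/
abbrev P : Type u :=
  S.X.obj (op (S.B.prod circleTorus)) ⧸ S.ideal.map (torusRes S.X (Torus.fst S.B circleTorus))

/-- The projection to the ground ring. -/
abbrev mkK : S.X.obj (op S.B) →+* S.k := Ideal.Quotient.mk _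

/-- The projection to the coordinate ring. -/
abbrev mkP : S.X.obj (op (S.B.prod circleTorus)) →+* S.P := Ideal.Quotient.mk _

theorem mkK_surjective : Function.Surjective S.mkK := Ideal.Quotient.mk_surjective

theorem mkP_surjective : Function.Surjective S.mkP := Ideal.Quotient.mk_surjective

instance : Algebra S.k S.P :=
  (Ideal.quotientMap _ (torusRes S.X (Torus.fst S.B circleTorus)) Ideal.le_comap_map).toAlgebra

theorem algebraMap_mkK (x : S.X.obj (op S.B)) :
    algebraMap S.k S.P (S.mkK x) = S.mkP (torusRes S.X (Torus.fst S.B circleTorus) x) := rfl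

/-- The augmentation defined by a character of the torus. -/
def aug (V : S.B.Chars) : S.P →ₐ[S.k] S.k where
  __ := Ideal.quotientMap S.ideal
    (torusRes S.X (Torus.lift (ContinuousMonoidHom.id S.B.obj) V)) (Ideal.map_le_iff_le_comap.2
      fun x hx => by
        rw [Ideal.mem_comap, Ideal.mem_comap, torusRes_torusRes, Torus.fst_comp_lift, torusRes_id]
        exact hx)
  commutes' r := by
    obtain ⟨x, rfl⟩ := S.mkK_surjective r
    refine congrArg S.mkK ((torusRes_torusRes _ _ _ x).trans ?_)
    rw [Torus.fst_comp_lift, torusRes_id]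

theorem aug_mkP (V : S.B.Chars) (x : S.X.obj (op (S.B.prod circleTorus))) :
    S.aug V (S.mkP x) =
      S.mkK (torusRes S.X (Torus.lift (ContinuousMonoidHom.id S.B.obj) V) x) := rfl

/-- The generator of the kernel of an augmentation. -/
def y (V : S.B.Chars) : S.P := S.mkP (eulerClass S.X S.e (Torus.graphChar V))

/-- The two graph characters differ by a character pulled back from the base on which `φ` is
trivial. Its Euler class is zero in the quotient, and Euler classes are additive up to a multiple of
it. -/
theorem y_eq {V V' : S.B.Chars} (h : S.φ V = S.φ V') : S.y V = S.y V' := by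
  refine Ideal.Quotient.eq.2 ?_
  obtain ⟨c, hc⟩ := S.isCoordinate.exists_eulerClass_mul_char (Torus.graphChar V')
    ((V'.comp (Torus.fst S.B circleTorus)) * (V.comp (Torus.fst S.B circleTorus))⁻¹)
  have h₁ : Torus.graphChar V' * ((V'.comp (Torus.fst S.B circleTorus)) *
      (V.comp (Torus.fst S.B circleTorus))⁻¹) = Torus.graphChar V := by
    rw [Torus.graphChar, Torus.graphChar]
    exact mul_left_cancel (a := V'.comp (Torus.fst S.B circleTorus)) (by
      rw [← mul_assoc, mul_inv_cancel_left, mul_comm, mul_assoc])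
  have h₂ : (V'.comp (Torus.fst S.B circleTorus)) * (V.comp (Torus.fst S.B circleTorus))⁻¹ =
    (V' * V⁻¹).comp (Torus.fst S.B circleTorus) := rfl
  rw [h₁, h₂, ← torusRes_eulerClass] at hc
  rw [hc, add_sub_cancel_left]
  refine Ideal.mul_mem_right _ _ (Ideal.mem_map_of_mem _ (S.eulerClass_mem ?_))
  rw [map_mul, map_inv, h, mul_inv_cancel]

theorem aug_y (V V' : S.B.Chars) : S.aug V (S.y V') = S.mkK (eulerClass S.X S.e (V'⁻¹ * V)) := by
  rw [y, aug_mkP, torusRes_eulerClass, Torus.graphChar_comp_lift, Torus.comp_id]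

theorem aug_y_self (V : S.B.Chars) : S.aug V (S.y V) = 0 := by
  rw [aug_y, inv_mul_cancel, S.isCoordinate.eulerClass_one, map_zero]

theorem exists_eq_add (V : S.B.Chars) (x : S.P) :
    ∃ z, x = algebraMap S.k S.P (S.aug V x) + S.y V * z := by
  obtain ⟨x, rfl⟩ := S.mkP_surjective x
  obtain ⟨z, hz⟩ := S.isCoordinate.exists_eulerClass_mul (Torus.charSplitting_graphChar V) x
  refine ⟨S.mkP z, ?_⟩
  rw [aug_mkP, algebraMap_mkK, y, ← map_mul, ← map_add, hz, add_sub_cancel]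

theorem aug_eq {V V' : S.B.Chars} (h : S.φ V = S.φ V') : S.aug V = S.aug V' := by
  ext x
  obtain ⟨z, hz⟩ := S.exists_eq_add V x
  have h₁ := congrArg (S.aug V') hz
  rw [map_add, AlgHom.commutes, map_mul, S.y_eq h, aug_y_self, zero_mul, add_zero] at h₁
  exact h₁.symm

theorem ker_aug (V : S.B.Chars) : RingHom.ker (S.aug V) = Ideal.span {S.y V} := by
  refine le_antisymm (fun x hx => ?_) ?_
  · obtain ⟨z, hz⟩ := S.exists_eq_add V x
    rw [RingHom.mem_ker.1 hx, map_zero, zero_add] at hz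
    exact Ideal.mem_span_singleton.2 ⟨z, hz⟩
  · rw [Ideal.span_singleton_le_iff_mem]
    exact S.aug_y_self V

/-- Division with remainder respects ideals extended from the base: if `y V * x` lies in the
extended ideal, it is `a + y V * z` with `a` in the ideal of `X(B)` and `z` in the extended ideal.
Restriction to the graph gives `a = 0`, and `y V` cancels in `X(B × 𝕋)`. -/
theorem y_mem_nonZeroDivisors (V : S.B.Chars) : S.y V ∈ nonZeroDivisors S.P := by
  refine mem_nonZeroDivisors_iff_left.2 fun x hx => ?_
  obtain ⟨x, rfl⟩ := S.mkP_surjective x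
  rw [y, ← map_mul, Ideal.Quotient.eq_zero_iff_mem] at hx
  refine Ideal.Quotient.eq_zero_iff_mem.2 ?_
  have hs := Torus.charSplitting_graphChar V
  have key : ∀ w ∈ S.ideal.map (torusRes S.X (Torus.fst S.B circleTorus)), ∃ a ∈ S.ideal,
      ∃ z ∈ S.ideal.map (torusRes S.X (Torus.fst S.B circleTorus)),
        w = torusRes S.X (Torus.fst S.B circleTorus) a +
          eulerClass S.X S.e (Torus.graphChar V) * z := by
    intro w hw
    rw [Ideal.map] at hw
    induction hw using Submodule.span_induction with
    | mem w hw =>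
      obtain ⟨a, ha, rfl⟩ := hw
      exact ⟨a, ha, 0, zero_mem _, by rw [mul_zero, add_zero]⟩
    | zero => exact ⟨0, zero_mem _, 0, zero_mem _, by simp⟩
    | add w w' _ _ h h' =>
      obtain ⟨a, ha, z, hz, rfl⟩ := h
      obtain ⟨a', ha', z', hz', rfl⟩ := h'
      exact ⟨a + a', add_mem ha ha', z + z', add_mem hz hz', by rw [map_add]; ring⟩
    | smul c w _ h =>
      obtain ⟨a, ha, z, hz, rfl⟩ := h
      obtain ⟨c', hc⟩ := S.isCoordinate.exists_eulerClass_mul hs c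
      refine ⟨torusRes S.X (Torus.lift (ContinuousMonoidHom.id S.B.obj) V) c * a,
        Ideal.mul_mem_left _ _ ha, torusRes S.X (Torus.fst S.B circleTorus) a * c' + c * z,
        add_mem (Ideal.mul_mem_right _ _ (Ideal.mem_map_of_mem _ ha)) (Ideal.mul_mem_left _ _ hz),
        ?_⟩
      rw [map_mul, smul_eq_mul]
      linear_combination (-torusRes S.X (Torus.fst S.B circleTorus) a) * hc
  obtain ⟨a, ha, z, hz, hw⟩ := key _ hx
  have h₀ := congrArg (torusRes S.X (Torus.lift (ContinuousMonoidHom.id S.B.obj) V)) hw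
  rw [map_mul, map_add, map_mul, torusRes_eulerClass, hs.char_incl,
    S.isCoordinate.eulerClass_one, zero_mul, zero_mul, add_zero, torusRes_torusRes,
    Torus.fst_comp_lift, torusRes_id] at h₀
  rw [← h₀, map_zero, zero_add] at hw
  rw [S.isCoordinate.eq_of_eulerClass_mul_eq hs hw]
  exact hz

/-- The augmentations. -/
def θ (γ : Γ) : S.P →ₐ[S.k] S.k := S.aug (Function.surjInv S.surjective γ)

/-- The generators of the kernels of the augmentations. -/
def gen (γ : Γ) : S.P := S.y (Function.surjInv S.surjective γ)

theorem θ_φ (V : S.B.Chars) : S.θ (S.φ V) = S.aug V :=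
  S.aug_eq (Function.surjInv_eq S.surjective _)

theorem gen_φ (V : S.B.Chars) : S.gen (S.φ V) = S.y V :=
  S.y_eq (Function.surjInv_eq S.surjective _)

theorem ker_θ (γ : Γ) : RingHom.ker (S.θ γ) = Ideal.span {S.gen γ} := S.ker_aug _

theorem gen_mem_nonZeroDivisors (γ : Γ) : S.gen γ ∈ nonZeroDivisors S.P :=
  S.y_mem_nonZeroDivisors _

/-- A homomorphism to `K` from the value of the global group law at a torus over `B`. -/
structure Realization {K : Type u} [CommRing K] (b : S.k →+* K) where
  C : Torus
  h : C.obj →ₜ* S.B.obj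
  w : S.X.obj (op C) →+* K
  comm : ∀ x, w (torusRes S.X h x) = b (S.mkK x)

variable {S} {K K' : Type u} [CommRing K] [CommRing K'] {b : S.k →+* K}

theorem exists_hom_prod_y_eq_zero (g : Pt S.θ b) :
    ∃ s : Multiset S.B.Chars, g.hom (s.map S.y).prod = 0 := by
  obtain ⟨s, hs⟩ := g.isOpen
  refine ⟨s.map (Function.surjInv S.surjective), ?_⟩
  rw [AugCompletion.prod_ker_eq_span S.ker_θ, Ideal.span_singleton_le_iff_mem] at hs
  rw [Multiset.map_map]
  exact hs

theorem isOpen_of_prod_y {I : Ideal S.P} (s : Multiset S.B.Chars) (hs : (s.map S.y).prod ∈ I) :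
    I ∈ openIdeals S.θ := by
  refine ⟨s.map S.φ, ?_⟩
  rw [AugCompletion.prod_ker_eq_span S.ker_θ, Ideal.span_singleton_le_iff_mem, Multiset.map_map]
  have : S.gen ∘ S.φ = S.y := funext S.gen_φ
  rwa [this]

namespace Realization

/-- The characters that define continuous points. -/
def chars (r : S.Realization b) : Subgroup r.C.Chars where
  carrier := {χ | ∃ s : Multiset S.B.Chars,
    r.w (s.map fun V => eulerClass S.X S.e ((V.comp r.h)⁻¹ * χ)).prod = 0}
  one_mem' := ⟨{1}, by
    rw [Multiset.map_singleton, Multiset.prod_singleton, Torus.one_comp, inv_one, mul_one,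
      S.isCoordinate.eulerClass_one, map_zero]⟩
  mul_mem' := by
    rintro χ ψ ⟨s, hs⟩ ⟨t, ht⟩
    refine ⟨(s ×ˢ t).map fun p => p.1 * p.2, ?_⟩
    rw [Multiset.map_map]
    -- The Euler class of a product of two characters lies in the sum of the two principal ideals. A
    -- product over all pairs therefore lies in the sum of the two products, both of which are
    -- killed.
    have h₁ := Ideal.prod_product_sup_le s t
      (fun V => Ideal.span {eulerClass S.X S.e ((V.comp r.h)⁻¹ * χ)})
      (fun V => Ideal.span {eulerClass S.X S.e ((V.comp r.h)⁻¹ * ψ)})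
    have h₂ : ∀ (q : Multiset S.B.Chars) (ψ' : r.C.Chars),
        r.w (q.map fun V => eulerClass S.X S.e ((V.comp r.h)⁻¹ * ψ')).prod = 0 →
        (q.map fun V => Ideal.span {eulerClass S.X S.e ((V.comp r.h)⁻¹ * ψ')}).prod ≤
          RingHom.ker r.w := by
      intro q ψ' hq
      have := Ideal.multiset_prod_span_singleton
        (q.map fun V => eulerClass S.X S.e ((V.comp r.h)⁻¹ * ψ'))
      rw [Multiset.map_map] at this
      refine this.le.trans ?_
      rw [Ideal.span_singleton_le_iff_mem]
      exact hq
    have h₃ := Ideal.multiset_prod_span_singleton ((s ×ˢ t).map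
      ((fun V => eulerClass S.X S.e ((V.comp r.h)⁻¹ * (χ * ψ))) ∘ fun p => p.1 * p.2))
    rw [Multiset.map_map] at h₃
    rw [← RingHom.mem_ker, ← Ideal.span_singleton_le_iff_mem, ← h₃]
    refine (Multiset.prod_map_le_prod_map₀ _ _ (fun _ _ => bot_le) fun p _ => ?_).trans
      (h₁.trans (sup_le (h₂ s χ hs) (h₂ t ψ ht)))
    obtain ⟨c, hc⟩ := S.isCoordinate.exists_eulerClass_mul_char ((p.1.comp r.h)⁻¹ * χ)
      ((p.2.comp r.h)⁻¹ * ψ)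
    have h₄ : (((p.1 * p.2).comp r.h)⁻¹ * (χ * ψ)) =
        ((p.1.comp r.h)⁻¹ * χ) * ((p.2.comp r.h)⁻¹ * ψ) := by
      rw [Torus.mul_comp, mul_inv, mul_mul_mul_comm]
    refine (Ideal.span_singleton_le_iff_mem _).2 ?_
    dsimp only [Function.comp_apply]
    rw [h₄, hc]
    exact Submodule.add_mem_sup (Ideal.mem_span_singleton_self _)
      (Ideal.mul_mem_right _ _ (Ideal.mem_span_singleton_self _))
  inv_mem' := by
    rintro χ ⟨s, hs⟩
    refine ⟨s.map fun V => V⁻¹, ?_⟩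
    rw [Multiset.map_map]
    have h₁ : (s.map fun V => eulerClass S.X S.e ((V.comp r.h)⁻¹ * χ)).prod ∣
        (s.map ((fun V => eulerClass S.X S.e ((V.comp r.h)⁻¹ * χ⁻¹)) ∘ fun V => V⁻¹)).prod := by
      refine Multiset.prod_dvd_prod_of_dvd _ _ fun V _ => ?_
      -- The Euler class of an inverse character is divisible by that of the character.
      obtain ⟨c, hc⟩ := S.isCoordinate.exists_eulerClass_comp ((V.comp r.h)⁻¹ * χ)
        (ContinuousMonoidHom.id circleTorus.obj)⁻¹
      have h₂ : ((V⁻¹.comp r.h)⁻¹ * χ⁻¹) =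
          (ContinuousMonoidHom.id circleTorus.obj)⁻¹.comp ((V.comp r.h)⁻¹ * χ) := by
        rw [Torus.inv_comp, Torus.inv_comp, Torus.id_comp, mul_inv]
      exact ⟨c, (congrArg (eulerClass S.X S.e) h₂).trans hc⟩
    obtain ⟨c, hc⟩ := h₁
    rw [hc, map_mul, hs, zero_mul]

variable (r : S.Realization b)

/-- The point defined by a character. -/
def pt (χ : r.C.Chars) (hχ : χ ∈ r.chars) : Pt S.θ b where
  hom := Ideal.Quotient.lift _ (r.w.comp (torusRes S.X (Torus.lift r.h χ))) fun x hx => by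
    have : S.ideal.map (torusRes S.X (Torus.fst S.B circleTorus)) ≤
        RingHom.ker (r.w.comp (torusRes S.X (Torus.lift r.h χ))) :=
      Ideal.map_le_iff_le_comap.2 fun x hx => by
        rw [Ideal.mem_comap, RingHom.mem_ker, RingHom.comp_apply, torusRes_torusRes,
          Torus.fst_comp_lift, r.comm, Ideal.Quotient.eq_zero_iff_mem.2 hx, map_zero]
    exact RingHom.mem_ker.1 (this hx)
  comm := RingHom.ext fun x => by
    obtain ⟨x, rfl⟩ := S.mkK_surjective x
    rw [RingHom.comp_apply, algebraMap_mkK, Ideal.Quotient.lift_mk, RingHom.comp_apply,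
      torusRes_torusRes, Torus.fst_comp_lift, r.comm]
  isOpen := by
    obtain ⟨s, hs⟩ := hχ
    refine isOpen_of_prod_y s ?_
    have : (s.map S.y).prod = S.mkP (s.map fun V => eulerClass S.X S.e (Torus.graphChar V)).prod := by
      rw [map_multiset_prod, Multiset.map_map]
      rfl
    rw [RingHom.mem_ker, this, Ideal.Quotient.lift_mk, RingHom.comp_apply, map_multiset_prod,
      Multiset.map_map]
    simpa only [Function.comp_def, torusRes_eulerClass, Torus.graphChar_comp_lift] using hs

@[simp]
theorem pt_hom_mkP (χ : r.C.Chars) (hχ : χ ∈ r.chars) (x) :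
    (r.pt χ hχ).hom (S.mkP x) = r.w (torusRes S.X (Torus.lift r.h χ) x) := rfl

theorem pt_eq_iff {χ : r.C.Chars} {hχ : χ ∈ r.chars} {g : Pt S.θ b} :
    r.pt χ hχ = g ↔ ∀ x, r.w (torusRes S.X (Torus.lift r.h χ) x) = g.hom (S.mkP x) := by
  constructor
  · rintro rfl x
    rfl
  · intro h
    ext x
    obtain ⟨x, rfl⟩ := S.mkP_surjective x
    exact h x

theorem mem_chars_of_hom {χ : r.C.Chars} (g : Pt S.θ b)
    (h : ∀ x, r.w (torusRes S.X (Torus.lift r.h χ) x) = g.hom (S.mkP x)) : χ ∈ r.chars := by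
  obtain ⟨s, hs⟩ := exists_hom_prod_y_eq_zero g
  refine ⟨s, ?_⟩
  have h₁ : (s.map S.y).prod = S.mkP (s.map fun V => eulerClass S.X S.e (Torus.graphChar V)).prod := by
    rw [map_multiset_prod, Multiset.map_map]
    rfl
  rw [h₁, ← h, map_multiset_prod, Multiset.map_map] at hs
  simpa only [Function.comp_def, torusRes_eulerClass, Torus.graphChar_comp_lift] using hs

/-- A continuous point kills a product of the `y V`, i.e. of Euler classes of graph characters, so
the base change property applies. In this way any point can be adjoined to a realization as a new
character. -/
theorem existsUnique_extend (g : Pt S.θ b) :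
    ∃! w : S.X.obj (op (r.C.prod circleTorus)) →+* K,
      w.comp (torusRes S.X (Torus.fst r.C circleTorus)) = r.w ∧
      w.comp (torusRes S.X (Torus.prodMap r.h circleTorus)) = g.hom.comp S.mkP := by
  obtain ⟨s, hs⟩ := exists_hom_prod_y_eq_zero g
  refine existsUnique_torus_lift S.isCoordinate r.h r.w (g.hom.comp S.mkP) ?_ s ?_
  · ext x
    rw [RingHom.comp_apply, r.comm, RingHom.comp_apply, RingHom.comp_apply, ← algebraMap_mkK,
      g.comm_apply]
  · rw [RingHom.comp_apply, map_multiset_prod, Multiset.map_map]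
    exact hs

/-- The extension of a realization by a point. -/
abbrev extend (g : Pt S.θ b) : S.Realization b where
  C := r.C.prod circleTorus
  h := r.h.comp (Torus.fst r.C circleTorus)
  w := (r.existsUnique_extend g).choose
  comm x := by
    rw [← torusRes_torusRes]
    exact (DFunLike.congr_fun (r.existsUnique_extend g).choose_spec.1.1 _).trans (r.comm x)

/-- The first projection, for an extension. -/
abbrev proj (g : Pt S.θ b) : (r.extend g).C.obj →ₜ* r.C.obj := Torus.fst r.C circleTorus

/-- The second projection, for an extension. -/
abbrev char (g : Pt S.θ b) : (r.extend g).C.Chars := Torus.snd r.C circleTorus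

theorem extend_w_torusRes (g : Pt S.θ b) (x : S.X.obj (op r.C)) :
    (r.extend g).w (torusRes S.X (r.proj g) x) = r.w x :=
  DFunLike.congr_fun (r.existsUnique_extend g).choose_spec.1.1 x

theorem char_mem (g : Pt S.θ b) : r.char g ∈ (r.extend g).chars :=
  mem_chars_of_hom _ g (DFunLike.congr_fun (r.existsUnique_extend g).choose_spec.1.2)

@[simp]
theorem pt_char (g : Pt S.θ b) : (r.extend g).pt (r.char g) (r.char_mem g) = g :=
  (pt_eq_iff _).2 (DFunLike.congr_fun (r.existsUnique_extend g).choose_spec.1.2)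

theorem comp_proj_mem (g : Pt S.θ b) {χ : r.C.Chars} (hχ : χ ∈ r.chars) :
    χ.comp (r.proj g) ∈ (r.extend g).chars :=
  mem_chars_of_hom _ (r.pt χ hχ) fun x => by
    rw [pt_hom_mkP, ← r.extend_w_torusRes g, torusRes_torusRes]
    rfl

@[simp]
theorem pt_comp_proj (g : Pt S.θ b) {χ : r.C.Chars} (hχ : χ ∈ r.chars) :
    (r.extend g).pt (χ.comp (r.proj g)) (r.comp_proj_mem g hχ) = r.pt χ hχ :=
  (pt_eq_iff _).2 fun x => by
    rw [pt_hom_mkP, ← r.extend_w_torusRes g, torusRes_torusRes]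
    rfl

theorem extend_w_unique (g : Pt S.θ b) (w : S.X.obj (op (r.C.prod circleTorus)) →+* K)
    (h₁ : ∀ x, w (torusRes S.X (Torus.fst r.C circleTorus) x) = r.w x)
    (h₂ : ∀ x, w (torusRes S.X (Torus.prodMap r.h circleTorus) x) = g.hom (S.mkP x)) :
    w = (r.extend g).w :=
  (r.existsUnique_extend g).choose_spec.2 w ⟨RingHom.ext h₁, RingHom.ext h₂⟩

variable (b) in
/-- The trivial realization. -/
abbrev base : S.Realization b where
  C := S.B
  h := ContinuousMonoidHom.id _
  w := b.comp S.mkK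
  comm x := by rw [torusRes_id, RingHom.comp_apply]

theorem mem_base_chars (V : S.B.Chars) : V ∈ (base b).chars :=
  mem_chars_of_hom _ (Pt.aug S.θ (S.φ V) b) fun x => by
    rw [Pt.aug_hom_apply, θ_φ, aug_mkP]
    rfl

theorem pt_base (V : S.B.Chars) : (base b).pt V (mem_base_chars V) = Pt.aug S.θ (S.φ V) b :=
  (pt_eq_iff _).2 fun x => by
    rw [Pt.aug_hom_apply, θ_φ, aug_mkP]
    rfl

theorem pt_one : r.pt 1 (one_mem _) = Pt.aug S.θ 1 b := (pt_eq_iff _).2 fun x => by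
  have : Torus.lift r.h (1 : r.C.Chars) =
      (Torus.lift (ContinuousMonoidHom.id S.B.obj) (1 : S.B.Chars)).comp r.h := rfl
  rw [this, ← torusRes_torusRes, r.comm, Pt.aug_hom_apply, ← map_one S.φ, θ_φ, aug_mkP]

/-- The change of rings. -/
abbrev map (j : K →+* K') : S.Realization (j.comp b) where
  C := r.C
  h := r.h
  w := j.comp r.w
  comm x := by rw [RingHom.comp_apply, r.comm, RingHom.comp_apply]

end Realization

open Realization

/-- The product of points. -/
def mul (g g' : Pt S.θ b) : Pt S.θ b :=
  (((base b).extend g).extend g').pt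
    (((base b).char g).comp (((base b).extend g).proj g') * ((base b).extend g).char g')
    (mul_mem (comp_proj_mem _ g' (char_mem _ g)) (char_mem _ g'))

/-- By uniqueness of extensions, any realization containing the two points restricts to the one used
to define `mul`. Products may hence be computed in any realization, and the monoid axioms become
those of a character group. -/
theorem mul_pt (r : S.Realization b) {χ ψ : r.C.Chars} (hχ : χ ∈ r.chars) (hψ : ψ ∈ r.chars) :
    mul (r.pt χ hχ) (r.pt ψ hψ) = r.pt (χ * ψ) (mul_mem hχ hψ) := by
  have h₁ : r.w.comp (torusRes S.X (Torus.lift r.h χ)) = ((base b).extend (r.pt χ hχ)).w :=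
    extend_w_unique (base b) (r.pt χ hχ) _ (fun x => by
      rw [RingHom.comp_apply, torusRes_torusRes, Torus.fst_comp_lift, r.comm]
      rfl) fun x => by
      rw [RingHom.comp_apply, torusRes_torusRes]
      rfl
  have h₂ : r.w.comp (torusRes S.X (Torus.lift (Torus.lift r.h χ) ψ)) =
      (((base b).extend (r.pt χ hχ)).extend (r.pt ψ hψ)).w :=
    extend_w_unique ((base b).extend (r.pt χ hχ)) (r.pt ψ hψ)
      (r.w.comp (torusRes S.X (Torus.lift (Torus.lift r.h χ) ψ))) (fun x => by
      rw [← h₁, RingHom.comp_apply, RingHom.comp_apply, torusRes_torusRes]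
      rfl) fun x => by
      rw [RingHom.comp_apply, torusRes_torusRes]
      rfl
  refine (pt_eq_iff _).2 fun x => ?_
  rw [← h₂, pt_hom_mkP, RingHom.comp_apply]
  exact congrArg _ (torusRes_torusRes _ _ _ _)

theorem exists_realization₂ (g g' : Pt S.θ b) : ∃ (r : S.Realization b) (χ χ' : r.C.Chars)
    (hχ : χ ∈ r.chars) (hχ' : χ' ∈ r.chars), r.pt χ hχ = g ∧ r.pt χ' hχ' = g' :=
  ⟨((base b).extend g).extend g', _, _, comp_proj_mem _ g' (char_mem _ g), char_mem _ g',
    (pt_comp_proj _ g' (char_mem _ g)).trans (pt_char _ _), pt_char _ _⟩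

theorem exists_realization₃ (g g' g'' : Pt S.θ b) : ∃ (r : S.Realization b)
    (χ χ' χ'' : r.C.Chars) (hχ : χ ∈ r.chars) (hχ' : χ' ∈ r.chars) (hχ'' : χ'' ∈ r.chars),
      r.pt χ hχ = g ∧ r.pt χ' hχ' = g' ∧ r.pt χ'' hχ'' = g'' := by
  obtain ⟨r, χ, χ', hχ, hχ', rfl, rfl⟩ := exists_realization₂ g g'
  exact ⟨r.extend g'', _, _, _, comp_proj_mem r g'' hχ, comp_proj_mem r g'' hχ', char_mem r g'',
    pt_comp_proj r g'' hχ, pt_comp_proj r g'' hχ', pt_char r g''⟩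

variable (S) in
/-- The group structure on points. -/
def pointMonoid : PointMonoid S.θ where
  mul := mul
  map_mul j b g g' := by
    obtain ⟨r, χ, χ', hχ, hχ', rfl, rfl⟩ := exists_realization₂ g g'
    have key : ∀ {χ : r.C.Chars} (hχ : χ ∈ r.chars), χ ∈ (r.map j).chars := fun hχ =>
      mem_chars_of_hom (r.map j) ((r.pt _ hχ).map j) fun x => rfl
    have key' : ∀ {χ : r.C.Chars} (hχ : χ ∈ r.chars), (r.map j).pt χ (key hχ) = (r.pt χ hχ).map j :=
      fun hχ => (pt_eq_iff (r.map j)).2 fun x => rfl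
    -- After a change of rings the same torus and the same characters realize the images of the
    -- points.
    rw [mul_pt, ← key', ← key', ← key', ← mul_pt (r.map j)]
  mul_comm g g' := by
    obtain ⟨r, χ, χ', hχ, hχ', rfl, rfl⟩ := exists_realization₂ g g'
    simp only [mul_pt, _root_.mul_comm χ χ']
  mul_assoc g g' g'' := by
    obtain ⟨r, χ, χ', χ'', hχ, hχ', hχ'', rfl, rfl, rfl⟩ := exists_realization₃ g g' g''
    simp only [mul_pt, _root_.mul_assoc χ χ' χ'']
  one_mul {K _ b} g := by
    obtain ⟨r, χ, -, hχ, -, rfl, -⟩ := exists_realization₂ g g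
    rw [← pt_one r, mul_pt]
    simp only [_root_.one_mul]
  aug_mul {K _ b} V W := by
    obtain ⟨V, rfl⟩ := S.surjective V
    obtain ⟨W, rfl⟩ := S.surjective W
    rw [← pt_base, ← pt_base, mul_pt, ← map_mul, ← pt_base]

variable (S) in
/-- The equivariant formal group law of a global group law. -/
def law : EquivariantFGL Γ S.k :=
  EquivariantFGL.ofCompletion S.ker_θ S.gen_mem_nonZeroDivisors S.pointMonoid

end LawQuotient

namespace Torus

variable {A : Torus}

theorem mem_subgroup_of_id_mem (H : Subgroup circleTorus.Chars)
    (h : ContinuousMonoidHom.id _ ∈ H) (χ : circleTorus.Chars) : χ ∈ H := by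
  obtain ⟨n, rfl⟩ : ∃ n : ℤ, χ = (ContinuousMonoidHom.id circleTorus.obj) ^ n :=
    Circle.char_eq_zpow χ
  exact zpow_mem h n

end Torus

/-! ### Evaluation of a global group law at points of its formal group law. -/

namespace LawQuotient

variable {Γ : Type} [CommGroup Γ] {S : LawQuotient.{u} Γ} {K K' : Type u} [CommRing K]
  [CommRing K'] {b : S.k →+* K} {A A' : Torus}

instance : CommGroup (Pt S.θ b) := S.pointMonoid.commGroup b

/-- A homomorphism from the value of the global group law that realizes given points. -/
def IsEval (p : A.Chars →* Pt S.θ b) (w : S.X.obj (op (S.B.prod A)) →+* K) : Prop :=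
  ∀ (V : A.Chars) (x : S.X.obj (op (S.B.prod circleTorus))),
    w (torusRes S.X (Torus.lift (Torus.fst S.B A) (V.comp (Torus.snd S.B A))) x) =
      (p V).hom (S.mkP x)

/-- The product of the identity with a homomorphism. -/
abbrev idProd (S : LawQuotient.{u} Γ) (f : A.obj →ₜ* A'.obj) :
    (S.B.prod A).obj →ₜ* (S.B.prod A').obj :=
  Torus.lift (Torus.fst S.B A) (f.comp (Torus.snd S.B A))

namespace IsEval

variable {p : A.Chars →* Pt S.θ b} {w : S.X.obj (op (S.B.prod A)) →+* K}

theorem comp (h : IsEval p w) (f : A.obj →ₜ* A'.obj) :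
    IsEval (p.comp (Torus.charPullback f)) (w.comp (torusRes S.X (S.idProd f))) := fun V x => by
  rw [RingHom.comp_apply, torusRes_torusRes]
  exact h (V.comp f) x

theorem w_fst (h : IsEval p w) (x : S.X.obj (op S.B)) :
    w (torusRes S.X (Torus.fst S.B A) x) = b (S.mkK x) := by
  have h₁ := h 1 (torusRes S.X (Torus.fst S.B circleTorus) x)
  rw [torusRes_torusRes, Torus.fst_comp_lift, ← algebraMap_mkK, (p 1).comm_apply] at h₁
  exact h₁

/-- The realization defined by an evaluation homomorphism. -/
abbrev realization (h : IsEval p w) : S.Realization b :=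
  ⟨S.B.prod A, Torus.fst S.B A, w, h.w_fst⟩

theorem mem_chars (h : IsEval p w) (V : A.Chars) :
    V.comp (Torus.snd S.B A) ∈ h.realization.chars :=
  Realization.mem_chars_of_hom _ (p V) (h V)

theorem pt_eq (h : IsEval p w) (V : A.Chars) :
    h.realization.pt (V.comp (Torus.snd S.B A)) (h.mem_chars V) = p V :=
  (Realization.pt_eq_iff _).2 (h V)

end IsEval

theorem existsUnique_isEval_unit (p : Torus.unit.Chars →* Pt S.θ b) : ∃! w, IsEval p w := by
  refine ⟨(b.comp S.mkK).comp (torusRes S.X (Torus.inl S.B Torus.unit)), fun V x => ?_,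
    fun w hw => RingHom.ext fun x => ?_⟩
  · obtain rfl : V = 1 := Subsingleton.elim _ _
    rw [RingHom.comp_apply, torusRes_torusRes, map_one]
    change _ = b (S.θ 1 (S.mkP x))
    rw [← map_one S.φ, θ_φ]
    rfl
  · have h₁ : (Torus.inl S.B Torus.unit).comp (Torus.fst S.B Torus.unit) =
        ContinuousMonoidHom.id _ :=
      Torus.hom_ext rfl (Subsingleton.elim _ _)
    have h₂ : torusRes S.X (Torus.fst S.B Torus.unit) (torusRes S.X (Torus.inl S.B Torus.unit) x) =
        x := by
      rw [torusRes_torusRes, h₁, torusRes_id]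
    rw [← h₂, hw.w_fst, h₂]
    rfl

theorem existsUnique_isEval_equiv (φ : A.obj ≃ₜ* A'.obj)
    (h : ∀ p : A.Chars →* Pt S.θ b, ∃! w, IsEval p w) (p : A'.Chars →* Pt S.θ b) :
    ∃! w, IsEval p w := by
  let f : A.obj →ₜ* A'.obj := φ
  let f' : A'.obj →ₜ* A.obj := φ.symm
  have hf : f.comp f' = ContinuousMonoidHom.id _ :=
    ContinuousMonoidHom.ext fun a => φ.apply_symm_apply a
  have hf' : ∀ V : A'.Chars, (V.comp f).comp f' = V := fun V => by rw [Torus.comp_assoc, hf]; rfl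
  obtain ⟨w, hw, hw'⟩ := h (p.comp (Torus.charPullback f'))
  refine ⟨w.comp (torusRes S.X (S.idProd f)), fun V x => ?_, fun w' h' => ?_⟩
  · refine (hw.comp f V x).trans ?_
    exact congrArg (fun V => (p V).hom (S.mkP x)) (hf' V)
  · rw [← hw' _ (h'.comp f')]
    ext x
    rw [RingHom.comp_apply, RingHom.comp_apply, torusRes_torusRes]
    have : (S.idProd f).comp (S.idProd f') = ContinuousMonoidHom.id _ :=
      Torus.hom_ext rfl (congrArg (fun q => ContinuousMonoidHom.comp q (Torus.snd S.B A')) hf)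
    rw [this, torusRes_id]

/-- The reassociation of a product. -/
abbrev assocHom (S : LawQuotient.{u} Γ) (A : Torus) :
    ((S.B.prod A).prod circleTorus).obj →ₜ* (S.B.prod (A.prod circleTorus)).obj :=
  Torus.lift ((Torus.fst S.B A).comp (Torus.fst (S.B.prod A) circleTorus))
    (Torus.prodMap (Torus.snd S.B A) circleTorus)

/-- The reassociation of a product. -/
abbrev assocInv (S : LawQuotient.{u} Γ) (A : Torus) :
    (S.B.prod (A.prod circleTorus)).obj →ₜ* ((S.B.prod A).prod circleTorus).obj :=
  Torus.lift (S.idProd (Torus.fst A circleTorus))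
    ((Torus.snd A circleTorus).comp (Torus.snd S.B (A.prod circleTorus)))

/-- The homomorphism from characters to points defined by a realization. -/
def Realization.charHom (r : S.Realization b) (a : r.C.obj →ₜ* A.obj)
    (ha : ∀ V : A.Chars, V.comp a ∈ r.chars) : A.Chars →* Pt S.θ b where
  toFun V := r.pt (V.comp a) (ha V)
  map_one' := r.pt_one
  map_mul' V V' := (mul_pt r (ha V) (ha V')).symm

theorem Realization.isEval_charHom (r : S.Realization b) (a : r.C.obj →ₜ* A.obj)
    (ha : ∀ V : A.Chars, V.comp a ∈ r.chars) :
    IsEval (r.charHom a ha) (r.w.comp (torusRes S.X (Torus.lift r.h a))) := fun V x => by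
  rw [RingHom.comp_apply, torusRes_torusRes]
  rfl

theorem Realization.charHom_extend (r : S.Realization b) (a : r.C.obj →ₜ* A.obj)
    (ha : ∀ V : A.Chars, V.comp a ∈ r.chars) (p : (A.prod circleTorus).Chars →* Pt S.θ b)
    (hp : ∀ V : A.Chars, r.pt (V.comp a) (ha V) = p (V.comp (Torus.fst A circleTorus))) :
    ∃ h, (r.extend (p (Torus.snd A circleTorus))).charHom (Torus.prodMap a circleTorus) h = p := by
  have h : ∀ V : (A.prod circleTorus).Chars, V.comp (Torus.prodMap a circleTorus) ∈
      (r.extend (p (Torus.snd A circleTorus))).chars := by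
    intro V
    have h₁ := r.comp_proj_mem (p (Torus.snd A circleTorus))
      (ha (V.comp (Torus.inl A circleTorus)))
    -- Characters of the circle are powers of the tautological one, whose pullback is continuous by
    -- the construction of the extension; continuous characters form a subgroup.
    have h₂ := Torus.mem_subgroup_of_id_mem (((r.extend (p (Torus.snd A circleTorus))).chars).comap
      (Torus.charPullback (Torus.snd r.C circleTorus))) (r.char_mem _)
      (V.comp (Torus.inr A circleTorus))
    have h₃ := mul_mem h₁ h₂
    rw [Torus.char_prod_eq V]
    exact h₃
  refine ⟨h, Torus.charHom_ext (fun V => ?_) ?_⟩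
  · exact (r.pt_comp_proj (p (Torus.snd A circleTorus)) (ha V)).trans (hp V)
  · exact r.pt_char (p (Torus.snd A circleTorus))

theorem IsEval.extend {p : (A.prod circleTorus).Chars →* Pt S.θ b}
    {w : S.X.obj (op (S.B.prod A)) →+* K}
    (hw : IsEval (p.comp (Torus.charPullback (Torus.fst A circleTorus))) w) :
    IsEval p ((hw.realization.extend (p (Torus.snd A circleTorus))).w.comp
      (torusRes S.X (S.assocHom A))) := by
  obtain ⟨h, hp⟩ := hw.realization.charHom_extend (Torus.snd S.B A) hw.mem_chars p hw.pt_eq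
  have := (hw.realization.extend (p (Torus.snd A circleTorus))).isEval_charHom _ h
  rwa [hp] at this

/-- An evaluation on `B × A × 𝕋` restricts on `B × A` to the unique evaluation there and on `B × 𝕋`
to the last point, hence it is the unique extension of realizations. -/
theorem IsEval.comp_assocInv {p : (A.prod circleTorus).Chars →* Pt S.θ b}
    {w : S.X.obj (op (S.B.prod A)) →+* K}
    (hw : IsEval (p.comp (Torus.charPullback (Torus.fst A circleTorus))) w)
    (hw' : ∀ w', IsEval (p.comp (Torus.charPullback (Torus.fst A circleTorus))) w' → w' = w)
    {w' : S.X.obj (op (S.B.prod (A.prod circleTorus))) →+* K} (h' : IsEval p w') :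
    w'.comp (torusRes S.X (S.assocInv A)) =
      (hw.realization.extend (p (Torus.snd A circleTorus))).w := by
  refine Realization.extend_w_unique hw.realization _ _ (fun x => ?_) fun x => ?_
  · refine Eq.trans ?_ (DFunLike.congr_fun (hw' _ (h'.comp (Torus.fst A circleTorus))) x)
    rw [RingHom.comp_apply, RingHom.comp_apply, torusRes_torusRes]
    rfl
  · rw [RingHom.comp_apply, torusRes_torusRes]
    exact h' (Torus.snd A circleTorus) x

theorem existsUnique_isEval_prod (h : ∀ p : A.Chars →* Pt S.θ b, ∃! w, IsEval p w)
    (p : (A.prod circleTorus).Chars →* Pt S.θ b) : ∃! w, IsEval p w := by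
  obtain ⟨w, hw, hw'⟩ := h (p.comp (Torus.charPullback (Torus.fst A circleTorus)))
  refine ⟨_, hw.extend, fun w' h' => ?_⟩
  rw [← hw.comp_assocInv hw' h']
  ext x
  rw [RingHom.comp_apply, RingHom.comp_apply, torusRes_torusRes]
  exact congrArg w' (torusRes_id S.X x).symm

/-- For a fixed `b`, homomorphisms from the characters of `A` to points are thus identified with
certain homomorphisms out of `X(B × A)`. Induction on the torus: each circle factor adjoins one
point. -/
theorem existsUnique_isEval (A : Torus) : ∀ {K : Type u} [CommRing K] {b : S.k →+* K}
    (p : A.Chars →* Pt S.θ b), ∃! w, IsEval p w :=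
  Torus.induction (P := fun A => ∀ {K : Type u} [CommRing K] {b : S.k →+* K}
    (p : A.Chars →* Pt S.θ b), ∃! w, IsEval p w) existsUnique_isEval_unit
    (fun _ h => existsUnique_isEval_prod fun p => h p)
    (fun _ _ e h => existsUnique_isEval_equiv e fun p => h p) A

/-- The evaluation homomorphism defined by points. -/
def evalHom (p : A.Chars →* Pt S.θ b) : S.X.obj (op (S.B.prod A)) →+* K :=
  (existsUnique_isEval A p).choose

theorem isEval_evalHom (p : A.Chars →* Pt S.θ b) : IsEval p (evalHom p) :=
  (existsUnique_isEval A p).choose_spec.1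

theorem IsEval.eq_evalHom {p : A.Chars →* Pt S.θ b} {w : S.X.obj (op (S.B.prod A)) →+* K}
    (h : IsEval p w) : w = evalHom p :=
  (existsUnique_isEval A p).choose_spec.2 w h

end LawQuotient

/-! ### The universal equivariant formal group law -/

namespace EquivariantFGL

variable {Γ : Type} [CommGroup Γ] {k : Type u} [CommRing k] {K : Type u} [CommRing K] {B : Torus}

/-- The character point defined by the augmentations. -/
abbrev augPoint (F : EquivariantFGL Γ k) (φ : B.Chars →* Γ) (b : k →+* K) : CharPoint F B :=
  ⟨K, b, (F.augHom b).comp φ⟩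

end EquivariantFGL

namespace LawQuotient

variable {Γ : Type} [CommGroup Γ] {S : LawQuotient.{u} Γ} {K K' : Type u} [CommRing K]
  [CommRing K'] {b : S.k →+* K} {A : Torus}

variable (S) in
/-- The homomorphism to the completed coordinate ring. -/
def toLaw : S.P →+* S.law.R := (toIdealCompletion S.k (openIdeals S.θ)).toRingHom

/-- The restriction of a point to the coordinate ring before completion. -/
def restrictPt (g : Pt S.law.θ b) : Pt S.θ b :=
  AugCompletion.restrict S.ker_θ S.gen_mem_nonZeroDivisors g

/-- The extension of a point to the completion. -/
def extendPt (g : Pt S.θ b) : Pt S.law.θ b := AugCompletion.extend g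

theorem restrictPt_injective : Function.Injective (restrictPt : Pt S.law.θ b → Pt S.θ b) :=
  AugCompletion.restrict_injective S.ker_θ S.gen_mem_nonZeroDivisors

theorem restrictPt_mul (g h : Pt S.law.θ b) :
    restrictPt (g * h) = mul (restrictPt g) (restrictPt h) :=
  congrArg (AugCompletion.restrict S.ker_θ S.gen_mem_nonZeroDivisors)
    (EquivariantFGL.ofPoints_pointMul (AugCompletion.pointMonoid S.ker_θ S.gen_mem_nonZeroDivisors
      S.pointMonoid) _ _ _ _ g h)

theorem law_y : S.law.y = S.toLaw (S.y 1) :=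
  congrArg S.toLaw ((congrArg S.gen (map_one S.φ).symm).trans (S.gen_φ 1))

theorem extendPt_hom_map {b' : S.k →+* K'} {g : Pt S.θ b} {g' : Pt S.θ b'} (j : K →+* K')
    (h : ∀ x, j (g.hom x) = g'.hom x) (z : S.law.R) :
    j ((extendPt g).hom z) = (extendPt g').hom z := by
  have hle : RingHom.ker g.hom ≤ RingHom.ker g'.hom := fun x hx => by
    rw [RingHom.mem_ker] at hx ⊢
    rw [← h, hx, map_zero]
  refine Eq.trans ?_ (AugCompletion.extend_hom_apply g' ⟨_, g.isOpen⟩ hle z).symm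
  refine (congrArg j (AugCompletion.extend_hom_apply g ⟨_, g.isOpen⟩ le_rfl z)).trans ?_
  obtain ⟨x, hx⟩ := AugCompletion.exists_proj_eq_mk ⟨_, g.isOpen⟩ z
  rw [hx, Pt.desc_mk, Pt.desc_mk, h]

variable (b) in
/-- Restriction of points, as a homomorphism. -/
def restrictHom : Pt S.law.θ b →* Pt S.θ b where
  toFun := restrictPt
  map_one' := rfl
  map_mul' := restrictPt_mul

theorem Realization.extend_base_w (g : Pt S.θ b) :
    ((Realization.base b).extend g).w = g.hom.comp S.mkP := by
  refine (Realization.extend_w_unique (Realization.base b) g _ (fun x => ?_) fun x => ?_).symm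
  · rw [RingHom.comp_apply, ← algebraMap_mkK, g.comm_apply]
    rfl
  · exact congrArg (fun x => g.hom (S.mkP x)) (torusRes_id S.X x)

/-- The evaluation of a global group law at a character point of the associated formal group law. -/
def evalPoint (s : S.law.CharPoint A) : S.X.obj (op A) →+* s.K :=
  (evalHom ((restrictHom s.b).comp s.p)).comp (torusRes S.X (Torus.snd S.B A))

theorem evalPoint_torusRes {A' : Torus} (f : A.obj →ₜ* A'.obj) (s : S.law.CharPoint A)
    (x : S.X.obj (op A')) : evalPoint s (torusRes S.X f x) = evalPoint (s.push f) x := by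
  have h : (evalHom ((restrictHom s.b).comp s.p)).comp (torusRes S.X (S.idProd f)) =
      evalHom ((restrictHom (s.push f).b).comp (s.push f).p) :=
    ((isEval_evalHom ((restrictHom s.b).comp s.p)).comp f).eq_evalHom
  rw [evalPoint, evalPoint, ← h]
  simp only [RingHom.comp_apply, torusRes_torusRes]
  rfl

theorem evalPoint_coordinate (s : S.law.CharPoint circleTorus) :
    evalPoint s S.e = (s.p (ContinuousMonoidHom.id _)).hom S.law.y := by
  have h := isEval_evalHom ((restrictHom s.b).comp s.p) (ContinuousMonoidHom.id _)
    (eulerClass S.X S.e (Torus.snd S.B circleTorus))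
  rw [law_y]
  refine Eq.trans ?_ (h.trans ?_)
  · rw [torusRes_eulerClass]
    rfl
  · refine congrArg (fun χ => (s.p (ContinuousMonoidHom.id _)).hom
      (S.toLaw (S.mkP (eulerClass S.X S.e χ)))) ?_
    rw [Torus.graphChar, Torus.one_comp, inv_one, one_mul]

theorem evalPoint_compat {s s' : S.law.CharPoint A} {j : s.K →+* s'.K}
    (h : EquivariantFGL.CharPoint.Compat s s' j) (x : S.X.obj (op A)) :
    j (evalPoint s x) = evalPoint s' x := by
  have : IsEval ((restrictHom s'.b).comp s'.p)
      (j.comp (evalHom ((restrictHom s.b).comp s.p))) := fun V x => by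
    rw [RingHom.comp_apply, isEval_evalHom ((restrictHom s.b).comp s.p) V x]
    exact h V _
  exact DFunLike.congr_fun this.eq_evalHom _

/-- Uniqueness of evaluations: a realization all of whose characters are continuous and give the
points `p` computes the evaluation at `p`. -/
theorem evalPoint_eq (r : S.Realization b) (p : r.C.Chars →* Pt S.law.θ b)
    (hr : ∀ V, V ∈ r.chars) (hp : ∀ V, r.pt V (hr V) = restrictPt (p V)) :
    evalPoint ⟨K, b, p⟩ = r.w := by
  have h : IsEval ((restrictHom b).comp p)
      (r.w.comp (torusRes S.X (Torus.lift r.h (ContinuousMonoidHom.id _)))) := fun V x => by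
    rw [RingHom.comp_apply, torusRes_torusRes]
    exact congrArg (fun g => Pt.hom g (S.mkP x)) (hp V)
  ext x
  rw [evalPoint, RingHom.comp_apply]
  refine (DFunLike.congr_fun h.eq_evalHom _).symm.trans ?_
  rw [RingHom.comp_apply, torusRes_torusRes, Torus.snd_comp_lift, torusRes_id]

open EquivariantFGL

/-- This and the next lemma connect the evaluations with the rings from which the law was built: the
augmentations recover the projection of `X(B)` to the ground ring, and an additional point recovers
its own values on `X(B × 𝕋)`. -/
theorem evalPoint_augPoint (x : S.X.obj (op S.B)) :
    evalPoint (S.law.augPoint S.φ b) x = b (S.mkK x) :=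
  DFunLike.congr_fun (evalPoint_eq (Realization.base b) ((S.law.augHom b).comp S.φ)
    Realization.mem_base_chars fun V => Realization.pt_base V) x

theorem evalPoint_extend_augPoint (g : Pt S.law.θ b) (x : S.X.obj (op (S.B.prod circleTorus))) :
    evalPoint ((S.law.augPoint S.φ b).extend g) x = g.hom (S.toLaw (S.mkP x)) := by
  let q : (S.B.prod circleTorus).Chars →* Pt S.law.θ b :=
    Torus.extendCharHom ((S.law.augHom b).comp S.φ) g
  let q' : (S.B.prod circleTorus).Chars →* Pt S.θ b := (restrictHom b).comp q
  have hq : q' (Torus.snd S.B circleTorus) = restrictPt g :=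
    congrArg restrictPt (Torus.extendCharHom_snd ((S.law.augHom b).comp S.φ) g)
  have hq' : ∀ V : S.B.Chars, Pt.aug S.θ (S.φ V) b = q' (V.comp (Torus.fst S.B circleTorus)) :=
    fun V => congrArg restrictPt
      (Torus.extendCharHom_fst ((S.law.augHom b).comp S.φ) g V).symm
  obtain ⟨h, hp⟩ := (Realization.base b).charHom_extend (ContinuousMonoidHom.id _)
    (fun V => Realization.mem_base_chars V) q' fun V => (Realization.pt_base V).trans (hq' V)
  refine (DFunLike.congr_fun (evalPoint_eq
    ((Realization.base b).extend (q' (Torus.snd S.B circleTorus))) q h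
    fun V => DFunLike.congr_fun hp V) x).trans ?_
  rw [Realization.extend_base_w, hq]
  rfl

variable (Γ) in
/-- Quotients of the groups of characters of tori. -/
structure CharQuotient where
  B : Torus
  φ : B.Chars →* Γ
  surjective : Function.Surjective φ

/-- The initial global group law and a quotient of the characters of a torus. -/
def lazard (Q : CharQuotient Γ) : LawQuotient.{u} Γ :=
  ⟨lazardFunctor, lazardCoordinate, isCoordinate_lazardFunctor, Q.B, Q.φ, Q.surjective⟩

/-- The initial global group law can be evaluated at points of its own formal group law in two ways,
through initiality and through the construction of the law; initiality makes them agree. -/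
theorem lazardEval_eq_evalPoint (Q : CharQuotient Γ) {A : Torus}
    (s : (lazard.{u} Q).law.CharPoint A)
    (x : lazardFunctor.{u}.obj (op A)) : lazardEval s x = evalPoint s x :=
  (lazardEval_unique (F := (lazard.{u} Q).law) (fun s => evalPoint s)
    (fun g s x => evalPoint_torusRes g s x)
    evalPoint_coordinate (fun h x => evalPoint_compat h x) s x).symm

end LawQuotient

namespace EquivariantFGL

variable {Γ Γ' : Type} [CommGroup Γ] [CommGroup Γ'] {k k' : Type u} [CommRing k] [CommRing k']

namespace PointHom

variable {φ : Γ' →* Γ} {F : EquivariantFGL Γ k} {F' : EquivariantFGL Γ' k'} (f : PointHom φ F F')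
  {K : Type u} [CommRing K]

/-- The map on points, as a homomorphism of groups. -/
def pullbackHom (b : k' →+* K) : Pt F'.θ b →* Pt F.θ (b.comp f.base) where
  toFun := f.pullback
  map_one' := (f.pullback_aug b 1).trans (by rw [map_one]; rfl)
  map_mul' := f.pullback_mul

/-- The pullback of a character point. -/
abbrev pullbackPoint {A : Torus} (s : CharPoint F' A) : CharPoint F A :=
  ⟨s.K, s.b.comp f.base, (f.pullbackHom s.b).comp s.p⟩

/-- The evaluation of the initial global group law is natural in the formal group law. -/
theorem lazardEval_pullbackPoint {A : Torus} (s : CharPoint F' A)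
    (x : lazardFunctor.{u}.obj (op A)) : lazardEval (f.pullbackPoint s) x = lazardEval s x :=
  lazardEval_unique (F := F') (fun s => lazardEval (f.pullbackPoint s))
    (fun g s x => lazardEval_torusRes g (f.pullbackPoint s) x)
    (fun s => by
      have h := lazardEval_eulerClass (ContinuousMonoidHom.id _) (f.pullbackPoint s)
      rw [eulerClass_id] at h
      refine h.trans ?_
      exact congrArg (s.p (ContinuousMonoidHom.id _)).hom f.orientation)
    (fun {A s s' j} h x => lazardEval_compat (s := f.pullbackPoint s) (s' := f.pullbackPoint s')
      (fun V x => h V _) x) s x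

end PointHom

theorem CharPoint.Compat.of_eq {F : EquivariantFGL Γ k} {A : Torus} {K : Type u} [CommRing K]
    {b b' : k →+* K} {p : A.Chars →* Pt F.θ b} {p' : A.Chars →* Pt F.θ b'}
    (h : ∀ V x, (p V).hom x = (p' V).hom x) :
    Compat (⟨K, b, p⟩ : CharPoint F A) ⟨K, b', p'⟩ (RingHom.id K) := h

theorem lazardEval_congr {F : EquivariantFGL Γ k} {A : Torus} {K : Type u} [CommRing K]
    {b b' : k →+* K} {p : A.Chars →* Pt F.θ b} {p' : A.Chars →* Pt F.θ b'}
    (h : ∀ V x, (p V).hom x = (p' V).hom x) (x : lazardFunctor.{u}.obj (op A)) :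
    lazardEval (⟨K, b, p⟩ : CharPoint F A) x = lazardEval (⟨K, b', p'⟩ : CharPoint F A) x :=
  lazardEval_compat (CharPoint.Compat.of_eq h) x

end EquivariantFGL

open EquivariantFGL

namespace LawQuotient

variable {Γ : Type} [CommGroup Γ] (Q : CharQuotient Γ) {k : Type u} [CommRing k]
  (F : EquivariantFGL Γ k)

/-- The homomorphism of ground rings. -/
def baseHom : (lazard.{u} Q).k →+* k :=
  Ideal.Quotient.lift _ (lazardEval (F.augPoint Q.φ (RingHom.id k))) fun x hx => by
    have h : (lazard.{u} Q).ideal ≤ RingHom.ker (lazardEval (F.augPoint Q.φ (RingHom.id k))) := by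
      refine Ideal.span_le.2 ?_
      rintro _ ⟨V, hV, rfl⟩
      have hV : Q.φ V = 1 := hV
      -- An Euler class is evaluated to the value of `y` at the corresponding point. When `φ V = 1`
      -- this is `θ(1)(y) = 0`, so the generators of the ideal are killed.
      refine (lazardEval_eulerClass V (F.augPoint Q.φ (RingHom.id k))).trans ?_
      refine (congrArg (fun γ => RingHom.id k (F.θ γ F.y)) hV).trans ?_
      rw [aug_one_y, map_zero]
    exact RingHom.mem_ker.1 (h hx)

variable {F} {K : Type u} [CommRing K] {b : k →+* K} {C : Torus}

theorem baseHom_mkK (x : lazardFunctor.{u}.obj (op Q.B)) :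
    b (baseHom Q F ((lazard.{u} Q).mkK x)) = lazardEval (F.augPoint Q.φ b) x :=
  lazardEval_compat (s := F.augPoint Q.φ (RingHom.id k)) (s' := F.augPoint Q.φ b) (j := b)
    (fun _ _ => rfl) x

/-- The realization defined by a character point over the augmentations. -/
abbrev charRealization (h : C.obj →ₜ* Q.B.obj) (p : C.Chars →* Pt F.θ b)
    (hp : ∀ V : Q.B.Chars, p (V.comp h) = Pt.aug F.θ (Q.φ V) b) :
    (lazard.{u} Q).Realization (b.comp (baseHom Q F)) where
  C := C
  h := h
  w := lazardEval (⟨K, b, p⟩ : CharPoint F C)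
  comm x := by
    refine Eq.trans ?_ (baseHom_mkK Q x).symm
    refine (lazardEval_torusRes h (⟨K, b, p⟩ : CharPoint F C) x).trans ?_
    exact lazardEval_congr (fun V x => congrArg (fun g => Pt.hom g x) (hp V)) x

/-- At the augmentation of `V` the translate of the coordinate is the Euler class: `e` of `V⁻¹ * χ`
is evaluated to `yTranslate (φ V)` at the point `p χ`. Openness of the kernel of `p χ` is therefore
the required vanishing of a product of Euler classes. -/
theorem mem_chars_charRealization {h : C.obj →ₜ* Q.B.obj} {p : C.Chars →* Pt F.θ b}
    (hp : ∀ V : Q.B.Chars, p (V.comp h) = Pt.aug F.θ (Q.φ V) b) (χ : C.Chars) :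
    χ ∈ (charRealization Q h p hp).chars := by
  obtain ⟨s, hs⟩ := (p χ).isOpen
  rw [AugCompletion.prod_ker_eq_span F.ker_aug_eq_span, Ideal.span_singleton_le_iff_mem,
    RingHom.mem_ker, map_multiset_prod, Multiset.map_map] at hs
  refine ⟨s.map (Function.surjInv Q.surjective), ?_⟩
  rw [Multiset.map_map, map_multiset_prod, Multiset.map_map]
  refine Eq.trans (congrArg Multiset.prod (Multiset.map_congr rfl fun γ _ => ?_)) hs
  refine (lazardEval_eulerClass _ (⟨K, b, p⟩ : CharPoint F C)).trans ?_
  change (p ((((Function.surjInv Q.surjective γ) : Q.B.Chars).comp h)⁻¹ * χ)).hom F.y =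
    (p χ).hom (F.yTranslate γ)
  rw [yTranslate, hom_translation, map_mul, ← Torus.inv_comp, hp, map_inv,
    Function.surjInv_eq Q.surjective]
  rfl

/-- The pullback of points to the universal formal group law, before completion. -/
def pull (g : Pt F.θ b) : Pt (lazard.{u} Q).θ (b.comp (baseHom Q F)) :=
  (charRealization Q (Torus.fst Q.B circleTorus)
    (Torus.extendCharHom ((F.augHom b).comp Q.φ) g) (Torus.extendCharHom_fst _ g)).pt
    (Torus.snd Q.B circleTorus) (mem_chars_charRealization Q _ _)

theorem pull_hom_mkP (g : Pt F.θ b) (x : lazardFunctor.{u}.obj (op (Q.B.prod circleTorus))) :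
    (pull Q g).hom ((lazard.{u} Q).mkP x) = lazardEval ((F.augPoint Q.φ b).extend g) x :=
  congrArg (lazardEval ((F.augPoint Q.φ b).extend g)) (torusRes_id _ x)

theorem charRealization_pt {h : C.obj →ₜ* Q.B.obj} {p : C.Chars →* Pt F.θ b}
    (hp : ∀ V : Q.B.Chars, p (V.comp h) = Pt.aug F.θ (Q.φ V) b) (χ : C.Chars) :
    (charRealization Q h p hp).pt χ (mem_chars_charRealization Q hp χ) = pull Q (p χ) := by
  refine (Realization.pt_eq_iff _).2 fun x => ?_
  refine Eq.trans ?_ (pull_hom_mkP Q (p χ) x).symm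
  refine (lazardEval_torusRes (Torus.lift h χ) (⟨K, b, p⟩ : CharPoint F C) x).trans ?_
  have : p.comp (Torus.charPullback (Torus.lift h χ)) =
      Torus.extendCharHom ((F.augHom b).comp Q.φ) (p χ) :=
    Torus.charHom_ext (fun V => (hp V).trans
      (Torus.extendCharHom_fst ((F.augHom b).comp Q.φ) (p χ) V).symm)
      (Torus.extendCharHom_snd ((F.augHom b).comp Q.φ) (p χ)).symm
  exact lazardEval_congr (fun V x => congrArg (fun q => Pt.hom (q V) x) this) x

/-- Both points are characters of the torus `B × 𝕋 × 𝕋`, realized by one evaluation of the initial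
global group law; there products of points are products of characters on both sides. -/
theorem pull_mul (g g' : Pt F.θ b) : pull Q (g * g') = mul (pull Q g) (pull Q g') := by
  let p := Torus.extendCharHom (Torus.extendCharHom ((F.augHom b).comp Q.φ) g) g'
  have hp : ∀ V : Q.B.Chars, p (V.comp ((Torus.fst Q.B circleTorus).comp
      (Torus.fst (Q.B.prod circleTorus) circleTorus))) = Pt.aug F.θ (Q.φ V) b := fun V =>
    (Torus.extendCharHom_fst (Torus.extendCharHom ((F.augHom b).comp Q.φ) g) g'
      (V.comp (Torus.fst Q.B circleTorus))).trans (Torus.extendCharHom_fst _ g V)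
  have h₁ : p ((Torus.snd Q.B circleTorus).comp (Torus.fst (Q.B.prod circleTorus) circleTorus)) =
      g := (Torus.extendCharHom_fst (Torus.extendCharHom ((F.augHom b).comp Q.φ) g) g'
      (Torus.snd Q.B circleTorus)).trans (Torus.extendCharHom_snd _ g)
  have h₂ : p (Torus.snd (Q.B.prod circleTorus) circleTorus) = g' := Torus.extendCharHom_snd _ g'
  have h₃ := mul_pt (charRealization Q _ p hp)
    (mem_chars_charRealization Q hp
      ((Torus.snd Q.B circleTorus).comp (Torus.fst (Q.B.prod circleTorus) circleTorus)))
    (mem_chars_charRealization Q hp (Torus.snd (Q.B.prod circleTorus) circleTorus))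
  rw [charRealization_pt, charRealization_pt, charRealization_pt, map_mul, h₁, h₂] at h₃
  exact h₃.symm

theorem pull_aug (γ : Γ) :
    pull Q (Pt.aug F.θ γ b) = Pt.aug (lazard.{u} Q).θ γ (b.comp (baseHom Q F)) := by
  obtain ⟨V, rfl⟩ := Q.surjective γ
  refine (charRealization_pt Q (h := ContinuousMonoidHom.id _) (p := (F.augHom b).comp Q.φ)
    (fun V => rfl) V).symm.trans ((Realization.pt_eq_iff _).2 fun x => ?_)
  rw [Pt.aug_hom_apply]
  have h : (lazard.{u} Q).θ (Q.φ V) = (lazard.{u} Q).aug V := θ_φ (lazard.{u} Q) V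
  rw [h]
  exact (baseHom_mkK Q _).symm

theorem pull_hom_map {K' : Type u} [CommRing K'] {b' : k →+* K'} {g : Pt F.θ b} {g' : Pt F.θ b'}
    (j : K →+* K') (h : ∀ x, j (g.hom x) = g'.hom x) (x : (lazard.{u} Q).P) :
    j ((pull Q g).hom x) = (pull Q g').hom x := by
  obtain ⟨x, rfl⟩ := (lazard.{u} Q).mkP_surjective x
  have hb : j.comp b = b' := by
    ext r
    rw [RingHom.comp_apply, ← g.comm_apply, h, g'.comm_apply]
  subst hb
  obtain rfl : g.map j = g' := Pt.ext h
  refine (congrArg j (pull_hom_mkP Q g x)).trans (Eq.trans ?_ (pull_hom_mkP Q _ x).symm)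
  refine lazardEval_compat (s := (F.augPoint Q.φ b).extend g)
    (s' := (F.augPoint Q.φ (j.comp b)).extend (g.map j)) (j := j)
    (CharPoint.Compat.of_prod (fun V x => ?_) fun x => ?_) x
  · have h₁ := Torus.extendCharHom_fst ((F.augHom b).comp Q.φ) g V
    have h₂ := Torus.extendCharHom_fst ((F.augHom (j.comp b)).comp Q.φ) (g.map j) V
    exact (congrArg (fun q => j (Pt.hom q x)) h₁).trans (congrArg (fun q => Pt.hom q x) h₂).symm
  · have h₁ := Torus.extendCharHom_snd ((F.augHom b).comp Q.φ) g
    have h₂ := Torus.extendCharHom_snd ((F.augHom (j.comp b)).comp Q.φ) (g.map j)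
    exact (congrArg (fun q => j (Pt.hom q x)) h₁).trans (congrArg (fun q => Pt.hom q x) h₂).symm

-- The universal points `F.R → F.R/I` are pulled back to compatible points of the constructed law,
-- and completeness of `F.R` assembles them into one homomorphism.
variable (F) in
theorem exists_ringHom_law : ∃ ρ : (lazard.{u} Q).law.R →+* F.R,
    ∀ {K : Type u} [CommRing K] {b : k →+* K} (g : Pt F.θ b) (z : (lazard.{u} Q).law.R),
      g.hom (ρ z) = (extendPt (pull Q g)).hom z := by
  obtain ⟨ρ, hρ⟩ := F.exists_ringHom (fun I => (extendPt (pull Q (Pt.univ I))).hom)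
    fun I J h => RingHom.ext fun z => extendPt_hom_map (Ideal.Quotient.factor h)
      (pull_hom_map Q (Ideal.Quotient.factor h) fun _ => rfl) z
  refine ⟨ρ, fun {K _ b} g z => ?_⟩
  rw [← extendPt_hom_map (g := pull Q (Pt.univ ⟨_, g.isOpen⟩)) (g.desc _ le_rfl)
    (pull_hom_map Q (g.desc _ le_rfl) fun _ => rfl) z]
  exact congrArg (g.desc _ le_rfl) (hρ ⟨_, g.isOpen⟩ z)

variable (F) in
theorem nonempty_pointHom_law : Nonempty (PointHom (MonoidHom.id Γ) (lazard.{u} Q).law F) := by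
  obtain ⟨ρ, hρ⟩ := exists_ringHom_law Q F
  have comm : ρ.comp (algebraMap _ (lazard.{u} Q).law.R) = (algebraMap k F.R).comp (baseHom Q F) := by
    refine RingHom.ext fun r => F.eq_of_mk_eq fun I => ?_
    exact (hρ (Pt.univ I) _).trans ((extendPt (pull Q (Pt.univ I))).comm_apply r)
  have aug : ∀ V z, F.θ V (ρ z) = baseHom Q F ((lazard.{u} Q).law.θ V z) := fun V z => by
    refine (hρ (Pt.aug F.θ V (RingHom.id k)) z).trans ?_
    rw [pull_aug]
    have : extendPt (Pt.aug (lazard.{u} Q).θ V ((RingHom.id k).comp (baseHom Q F))) =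
        Pt.aug (lazard.{u} Q).law.θ V ((RingHom.id k).comp (baseHom Q F)) :=
      restrictPt_injective rfl
    rw [this]
    rfl
  have key : ∀ {K : Type u} [CommRing K] {b : k →+* K} (g : Pt F.θ b),
      g.pullback (baseHom Q F) ρ comm (MonoidHom.id Γ) aug = extendPt (pull Q g) := fun g =>
    Pt.ext (hρ g)
  refine ⟨⟨baseHom Q F, ρ, comm, aug, F.eq_of_mk_eq fun I => ?_, fun {K _ b} g g' => ?_⟩⟩
  · rw [law_y]
    refine (hρ (Pt.univ I) _).trans ?_
    refine (pull_hom_mkP Q (Pt.univ I) _).trans ?_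
    have h : Torus.graphChar (1 : Q.B.Chars) = Torus.snd Q.B circleTorus := by
      rw [Torus.graphChar, Torus.one_comp, inv_one, one_mul]
    refine (lazardEval_eulerClass _ _).trans ?_
    refine (congrArg (fun χ => Pt.hom (CharPoint.p ((F.augPoint Q.φ _).extend (Pt.univ I)) χ) F.y)
      h).trans ?_
    exact congrArg (fun q => Pt.hom q F.y)
      (Torus.extendCharHom_snd ((F.augHom (algebraMap k (F.R ⧸ I.1))).comp Q.φ) (Pt.univ I))
  · rw [key, key, key]
    refine restrictPt_injective ?_
    refine (pull_mul Q g g').trans ?_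
    exact (restrictPt_mul (extendPt (pull Q g)) (extendPt (pull Q g'))).symm

variable {Q}

/-- Evaluation of the initial global group law is natural in the formal group law. At the
augmentations this determines any morphism on the ground ring. -/
theorem base_mkK (f : PointHom (MonoidHom.id Γ) (lazard.{u} Q).law F)
    (x : lazardFunctor.{u}.obj (op Q.B)) :
    f.base ((lazard.{u} Q).mkK x) = lazardEval (F.augPoint Q.φ (RingHom.id k)) x := by
  rw [← f.lazardEval_pullbackPoint]
  refine (evalPoint_augPoint (b := f.base) x).symm.trans
    ((lazardEval_eq_evalPoint Q _ x).symm.trans ?_)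
  exact lazardEval_congr (fun V z => (f.aug (Q.φ V) z).symm) x

/-- The same naturality, at the augmentations together with one further point `g`, determines a
morphism on the coordinate ring before completion. -/
theorem mk_ring_toLaw (f : PointHom (MonoidHom.id Γ) (lazard.{u} Q).law F) (g : Pt F.θ b)
    (x : lazardFunctor.{u}.obj (op (Q.B.prod circleTorus))) :
    g.hom (f.ring ((lazard.{u} Q).toLaw ((lazard.{u} Q).mkP x))) =
      lazardEval ((F.augPoint Q.φ b).extend g) x := by
  have h₁ : g.hom (f.ring ((lazard.{u} Q).toLaw ((lazard.{u} Q).mkP x))) =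
      lazardEval (((lazard.{u} Q).law.augPoint Q.φ (b.comp f.base)).extend (f.pullback g)) x := by
    have h := lazardEval_eq_evalPoint Q
      (((lazard.{u} Q).law.augPoint Q.φ (b.comp f.base)).extend (f.pullback g)) x
    rw [h]
    have h' := evalPoint_extend_augPoint (S := lazard.{u} Q) (f.pullback g) x
    exact h'.symm
  have h₂ : Torus.extendCharHom (((lazard.{u} Q).law.augHom (b.comp f.base)).comp Q.φ) (f.pullback g) =
      (f.pullbackHom b).comp (Torus.extendCharHom ((F.augHom b).comp Q.φ) g) := by
    refine Torus.charHom_ext (fun V => ?_) ?_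
    · refine (Torus.extendCharHom_fst _ _ V).trans (Eq.trans ?_
        (congrArg (f.pullbackHom b) (Torus.extendCharHom_fst ((F.augHom b).comp Q.φ) g V)).symm)
      exact (f.pullback_aug b (Q.φ V)).symm
    · exact (Torus.extendCharHom_snd _ _).trans
        (congrArg (f.pullbackHom b) (Torus.extendCharHom_snd ((F.augHom b).comp Q.φ) g)).symm
  have h₃ : lazardEval (((lazard.{u} Q).law.augPoint Q.φ (b.comp f.base)).extend (f.pullback g)) x =
     lazardEval (f.pullbackPoint ((F.augPoint Q.φ b).extend g)) x := by
    exact congrArg (fun p => lazardEval (⟨K, b.comp f.base, p⟩ : (lazard.{u} Q).law.CharPoint _) x) h₂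
  have h₄ := f.lazardEval_pullbackPoint ((F.augPoint Q.φ b).extend g) x
  exact h₁.trans (h₃.trans h₄)

theorem base_eq_baseHom (f : PointHom (MonoidHom.id Γ) (lazard.{u} Q).law F) :
    f.base = baseHom Q F := by
  refine RingHom.ext fun x => ?_
  obtain ⟨x, rfl⟩ := (lazard.{u} Q).mkK_surjective x
  exact base_mkK f x

theorem ring_eq (f f' : PointHom (MonoidHom.id Γ) (lazard.{u} Q).law F) : f.ring = f'.ring := by
  refine RingHom.ext fun z => F.eq_of_mk_eq fun I => ?_
  have hb : f.base = f'.base := (base_eq_baseHom f).trans (base_eq_baseHom f').symm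
  -- The two pulled back points lie over base maps that are only provably equal. Stating the
  -- comparison for arbitrary points lets the equality be rewritten before `restrictPt_injective` is
  -- used.
  have key : ∀ (g : Pt (lazard.{u} Q).law.θ ((algebraMap k (F.R ⧸ I.1)).comp f.base))
      (g' : Pt (lazard.{u} Q).law.θ ((algebraMap k (F.R ⧸ I.1)).comp f'.base)),
      (∀ x, g.hom ((lazard.{u} Q).toLaw x) = g'.hom ((lazard.{u} Q).toLaw x)) →
        ∀ z, g.hom z = g'.hom z := by
    rw [← hb]
    intro g g' h z
    rw [restrictPt_injective (Pt.ext h : restrictPt g = restrictPt g')]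
  refine key (f.pullback (Pt.univ I)) (f'.pullback (Pt.univ I)) (fun x => ?_) z
  obtain ⟨x, rfl⟩ := (lazard.{u} Q).mkP_surjective x
  exact (mk_ring_toLaw f (Pt.univ I) x).trans (mk_ring_toLaw f' (Pt.univ I) x).symm

variable (Q) in
/-- The universal equivariant formal group law. -/
theorem isUniversal_law : (lazard.{u} Q).law.IsUniversal := by
  intro k' _ F'
  obtain ⟨f⟩ := nonempty_pointHom_law Q F'
  refine ⟨⟨⟨f.toHom⟩, fun f' => ?_⟩⟩
  have h₁ : f'.base = f.toHom.base :=
    (base_eq_baseHom f'.toPointHom).trans (base_eq_baseHom f).symm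
  have h₂ : f'.toRingHom = f.toHom.toRingHom := ring_eq f'.toPointHom f
  change f' = f.toHom
  generalize f.toHom = f'' at h₁ h₂
  cases f'
  cases f''
  congr

end LawQuotient

/-! ### The global Lazard ring -/

namespace EquivariantFGL

variable {Γ Γ' : Type} [CommGroup Γ] [CommGroup Γ'] {k k' : Type u} [CommRing k'] [CommRing k]

/-- The evaluation of the initial global group law at augmentations. -/
def augEval (F : EquivariantFGL Γ k) {T : Torus} (ψ : T.Chars →* Γ) :
    lazardFunctor.{u}.obj (op T) →+* k :=
  lazardEval (F.augPoint ψ (RingHom.id k))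

theorem augEval_torusRes (F : EquivariantFGL Γ k) {T T' : Torus} (ψ : T.Chars →* Γ)
    (g : T.obj →ₜ* T'.obj) (x : lazardFunctor.{u}.obj (op T')) :
    F.augEval ψ (torusRes _ g x) = F.augEval (ψ.comp (Torus.charPullback g)) x :=
  lazardEval_torusRes g _ x

theorem augEval_eulerClass (F : EquivariantFGL Γ k) {T : Torus} (ψ : T.Chars →* Γ) (V : T.Chars) :
    F.augEval ψ (eulerClass _ lazardCoordinate V) = F.euler (ψ V) :=
  lazardEval_eulerClass V _

theorem PointHom.base_augEval {φ : Γ' →* Γ} {F : EquivariantFGL Γ k} {F' : EquivariantFGL Γ' k'}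
    (f : PointHom φ F F') {T : Torus} (ψ : T.Chars →* Γ') (x : lazardFunctor.{u}.obj (op T)) :
    f.base (F.augEval (φ.comp ψ) x) = F'.augEval ψ x := by
  rw [augEval, augEval, ← f.lazardEval_pullbackPoint]
  refine lazardEval_compat (s := F.augPoint (φ.comp ψ) (RingHom.id k))
    (s' := f.pullbackPoint (F'.augPoint ψ (RingHom.id k'))) (j := f.base) (fun V z => ?_) x
  exact (f.aug (ψ V) z).symm

/-- The identity morphism. -/
def PointHom.id (F : EquivariantFGL Γ k) : PointHom (MonoidHom.id Γ) F F where
  base := RingHom.id k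
  ring := RingHom.id F.R
  comm := rfl
  aug _ _ := rfl
  orientation := rfl
  pullback_mul _ _ := rfl

/-- A universal law maps to the constructed one, where evaluation at the augmentations is the
quotient map by precisely this ideal. Together with `augEval_surjective` this is the presentation of
the equivariant Lazard ring. -/
theorem mem_span_of_augEval_eq_zero {F : EquivariantFGL Γ k} (hF : F.IsUniversal) {T : Torus}
    {ψ : T.Chars →* Γ} (hψ : Function.Surjective ψ) {x : lazardFunctor.{u}.obj (op T)}
    (hx : F.augEval ψ x = 0) :
    x ∈ Ideal.span {x | ∃ V : T.Chars, ψ V = 1 ∧ eulerClass _ lazardCoordinate V = x} := by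
  let Q : LawQuotient.CharQuotient Γ := ⟨T, ψ, hψ⟩
  obtain ⟨g⟩ := hF _ (LawQuotient.lazard.{u} Q).law
  have h := g.default.toPointHom.base_augEval ψ x
  have h₁ : F.augEval ((MonoidHom.id Γ).comp ψ) x = 0 := hx
  rw [h₁, map_zero] at h
  have h₂ : (LawQuotient.lazard.{u} Q).law.augEval ψ x = (LawQuotient.lazard.{u} Q).mkK x :=
    (LawQuotient.lazardEval_eq_evalPoint Q _ x).trans
      (LawQuotient.evalPoint_augPoint (S := LawQuotient.lazard.{u} Q) (b := RingHom.id _) x)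
  exact Ideal.Quotient.eq_zero_iff_mem.1 (h₂.symm.trans h.symm)

theorem augEval_surjective {F : EquivariantFGL Γ k} (hF : F.IsUniversal) {T : Torus}
    {ψ : T.Chars →* Γ} (hψ : Function.Surjective ψ) : Function.Surjective (F.augEval ψ) := by
  let Q : LawQuotient.CharQuotient Γ := ⟨T, ψ, hψ⟩
  obtain ⟨g⟩ := hF _ (LawQuotient.lazard.{u} Q).law
  obtain ⟨h⟩ := hF _ F
  obtain ⟨f⟩ := LawQuotient.nonempty_pointHom_law.{u} Q F
  -- Universality of `F` makes the composite of `F` with the constructed law and back the identity,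
  -- so surjectivity is inherited from the quotient map.
  have key : PointHom.toHom (f.comp g.default.toPointHom) = PointHom.toHom (PointHom.id F) :=
    (h.uniq _).trans (h.uniq _).symm
  intro a
  obtain ⟨x, hx⟩ := (LawQuotient.lazard.{u} Q).mkK_surjective (g.default.base a)
  refine ⟨x, ?_⟩
  refine (LawQuotient.base_mkK f x).symm.trans ((congrArg f.base hx).trans ?_)
  exact DFunLike.congr_fun (congrArg Hom.base key) a

end EquivariantFGL

open EquivariantFGL

namespace AbCompactLieGroup

variable {A A' : AbCompactLieGroup} {T T' : Torus}

/-- Restriction of characters of a torus. -/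
def torusChar (δ : A →ₜ* T.obj) : T.Chars →* A.Char where
  toFun V := ContinuousMonoidHom.comp (C := circleTorus.obj) V δ
  map_one' := rfl
  map_mul' _ _ := rfl

/-- A torus whose characters restrict onto the characters of a group. -/
theorem exists_torusChar_surjective (A : AbCompactLieGroup) :
    ∃ (T : Torus) (δ : A →ₜ* T.obj), Function.Surjective (torusChar δ) :=
  exists_torus_charMap_surjective A

/-- A torus whose characters restrict onto the characters of a group. -/
def hull (A : AbCompactLieGroup) : Torus := A.exists_torusChar_surjective.choose

/-- The homomorphism to the hull. -/
def toHull (A : AbCompactLieGroup) : A →ₜ* A.hull.obj :=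
  A.exists_torusChar_surjective.choose_spec.choose

theorem torusChar_toHull_surjective (A : AbCompactLieGroup) :
    Function.Surjective (torusChar A.toHull) :=
  A.exists_torusChar_surjective.choose_spec.choose_spec

end AbCompactLieGroup

/-! ### Existence of the global Lazard ring. -/

section Existence

open LawQuotient

variable (A : AbCompactLieGroup)

/-- The characters of the hull. -/
def hullQuotient : CharQuotient A.Char := ⟨A.hull, torusChar A.toHull, A.torusChar_toHull_surjective⟩

/-- The Lazard ring of a group. -/
def lazardRing : CommRingCat.{u} := CommRingCat.of (lazard.{u} (hullQuotient A)).k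

/-- The universal equivariant formal group law. -/
def universalLaw : EquivariantFGL A.Char (lazardRing.{u} A) := (lazard.{u} (hullQuotient A)).law

theorem isUniversal_universalLaw : (universalLaw.{u} A).IsUniversal := isUniversal_law _

variable {A} {B C : AbCompactLieGroup}

/-- The morphism from the universal formal group law to a pushforward. -/
def universalHom (α : B →ₜ* A) :
    (universalLaw.{u} A).Hom ((universalLaw.{u} B).pushforward (charMap α)) :=
  (isUniversal_universalLaw A _ _).some.default

/-- The map of Lazard rings induced by a homomorphism of groups. -/
def lazardRingMap (α : B →ₜ* A) : lazardRing.{u} A →+* lazardRing.{u} B := (universalHom α).base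

theorem EquivariantFGL.Hom.base_augEval_of_pushforward {Γ Γ' : Type} [CommGroup Γ] [CommGroup Γ']
    {k k' : Type u} [CommRing k] [CommRing k'] {φ : Γ' →* Γ} {F : EquivariantFGL Γ k}
    {F' : EquivariantFGL Γ' k'} {G : EquivariantFGL Γ' k} (P : Pushforward φ F G) (f : F'.Hom G)
    {T : Torus} (ψ : T.Chars →* Γ') (x : lazardFunctor.{u}.obj (op T)) :
    f.base (F'.augEval ψ x) = F.augEval (φ.comp ψ) x :=
  (f.toPointHom.base_augEval ψ x).trans (P.toPointHom.base_augEval ψ x).symm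

/-- Restriction along `α` acts by composition on homomorphisms to tori. Since evaluations at a hull
exhaust the Lazard ring, functoriality follows from this formula. -/
theorem lazardRingMap_augEval (α : B →ₜ* A) {T : Torus} (δ : A →ₜ* T.obj)
    (x : lazardFunctor.{u}.obj (op T)) :
    lazardRingMap α ((universalLaw A).augEval (torusChar δ) x) =
      (universalLaw B).augEval (torusChar (δ.comp α)) x :=
  Hom.base_augEval_of_pushforward (isPushforward _ _) (universalHom α) (torusChar δ) x

theorem augEval_toHull_surjective :
    Function.Surjective ((universalLaw.{u} A).augEval (torusChar A.toHull)) :=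
  augEval_surjective (isUniversal_universalLaw A) A.torusChar_toHull_surjective

variable (A) in
theorem lazardRingMap_id :
    lazardRingMap (ContinuousMonoidHom.id A) = RingHom.id (lazardRing.{u} A) :=
  RingHom.ext fun a => by
    obtain ⟨x, rfl⟩ := augEval_toHull_surjective a
    exact lazardRingMap_augEval _ _ x

theorem lazardRingMap_comp (β : C →ₜ* B) (α : B →ₜ* A) :
    lazardRingMap.{u} (α.comp β) = (lazardRingMap β).comp (lazardRingMap α) :=
  RingHom.ext fun a => by
    obtain ⟨x, rfl⟩ := augEval_toHull_surjective a
    rw [RingHom.comp_apply, lazardRingMap_augEval, lazardRingMap_augEval, lazardRingMap_augEval]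
    rfl

/-- The global Lazard ring. -/
def globalLazardRing : GlobalLazardRing.{u} where
  L :=
    { obj := fun A => lazardRing A.unop
      map := fun α => CommRingCat.ofHom (lazardRingMap α.unop)
      map_id := fun A => congrArg CommRingCat.ofHom (lazardRingMap_id A.unop)
      map_comp := fun α β => congrArg CommRingCat.ofHom (lazardRingMap_comp β.unop α.unop) }
  fgl := universalLaw
  isUniversal := isUniversal_universalLaw
  map_eq α := ⟨_, ⟨isPushforward _ _⟩, universalHom α, rfl⟩

end Existence

open EquivariantFGL

/-! ### Transport of coordinates, regularity of Euler classes and change of universe. -/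

/-- Coordinates are invariant under isomorphism. -/
theorem IsCoordinate.of_equiv {X : Torusᵒᵖ ⥤ CommRingCat.{v}} {Y : Torusᵒᵖ ⥤ CommRingCat.{w}}
    {e : X.obj (op circleTorus)} {e' : Y.obj (op circleTorus)} (hX : IsCoordinate X e)
    (g : ∀ A : Torus, X.obj (op A) ≃+* Y.obj (op A))
    (hg : ∀ {A B : Torus} (f : A.obj →ₜ* B.obj) (x : X.obj (op B)),
      g A (torusRes X f x) = torusRes Y f (g B x))
    (he : g circleTorus e = e') : IsCoordinate Y e' := by
  have hV : ∀ {A : Torus} (V : A.Chars), g A (eulerClass X e V) = eulerClass Y e' V := fun V =>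
    (hg V e).trans (congrArg (torusRes Y V) he)
  refine isCoordinate_of_prod (fun A => ?_) (fun A x hx => ?_) fun A x hx => ?_
  · rw [← hV, hX.eulerClass_one, map_zero]
  · obtain ⟨x, rfl⟩ := (g _).surjective x
    rw [← hV, ← map_mul, map_eq_zero_iff _ (g _).injective] at hx
    rw [hX.eq_of_eulerClass_mul_eq (CharSplitting.snd A) (hx.trans (mul_zero _).symm), map_zero]
  · obtain ⟨x, rfl⟩ := (g _).surjective x
    rw [← hg, map_eq_zero_iff _ (g _).injective] at hx
    obtain ⟨z, hz⟩ := hX.exists_eulerClass_mul (CharSplitting.snd A) x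
    refine ⟨g _ z, ?_⟩
    rw [← hV, ← map_mul, hz, hx, map_zero, sub_zero]

/-- The Euler class of a split character of a torus is regular. -/
theorem IsCoordinate.eulerClass_mem_nonZeroDivisors {X : Torusᵒᵖ ⥤ CommRingCat.{v}}
    {e : X.obj (op circleTorus)} (hX : IsCoordinate X e) {A : Torus} {V : A.Chars}
    {s : circleTorus.obj →ₜ* A.obj} (hs : V.comp s = ContinuousMonoidHom.id _) :
    eulerClass X e V ∈ nonZeroDivisors (X.obj (op A)) := by
  let p := Torus.fst A circleTorus
  let q := Torus.snd A circleTorus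
  -- An involution of `A × 𝕋` that exchanges the pullback of `V` with the second projection: the
  -- `V`-component of `A` is swapped with the circle. Regularity is thereby reduced to the second
  -- projection, and the kernel of `V` need not be shown to be a torus.
  let Φ : (A.prod circleTorus).obj →ₜ* (A.prod circleTorus).obj :=
    Torus.lift (p * (s.comp (V.comp p))⁻¹ * s.comp q) (V.comp p)
  have h₀ : (V.comp p * (V.comp p)⁻¹ * q : (A.prod circleTorus).Chars) = q := by
    rw [mul_inv_cancel, one_mul]
  have hVΦ : V.comp (p * (s.comp (V.comp p))⁻¹ * s.comp q) = q := by
    refine Eq.trans (ContinuousMonoidHom.ext fun a => ?_) h₀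
    have hs' : ∀ z, V (s z) = z := DFunLike.congr_fun hs
    change V (p a * (s (V (p a)))⁻¹ * s (q a)) = V (p a) * (V (p a))⁻¹ * q a
    rw [map_mul, map_mul, map_inv, hs', hs']
  have hΦ : Φ.comp Φ = ContinuousMonoidHom.id _ := by
    refine Torus.hom_ext ?_ hVΦ
    ext a
    change p a * (s (V (p a)))⁻¹ * s (q a) * (s (V (p a * (s (V (p a)))⁻¹ * s (q a))))⁻¹ *
      s (V (p a)) = p a
    have : V (p a * (s (V (p a)))⁻¹ * s (q a)) = q a := DFunLike.congr_fun hVΦ a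
    rw [this]
    group
  have hres : ∀ x, torusRes X Φ (torusRes X Φ x) = x := fun x => by
    rw [torusRes_torusRes, hΦ, torusRes_id]
  refine mem_nonZeroDivisors_iff_right.2 fun x hx => ?_
  have h : eulerClass X e q * torusRes X Φ (torusRes X p x) = 0 := by
    have : torusRes X Φ (eulerClass X e (V.comp p)) = eulerClass X e q := by
      rw [torusRes_eulerClass]
      exact congrArg (eulerClass X e) hVΦ
    rw [← this, ← map_mul, ← torusRes_eulerClass, ← map_mul, mul_comm, hx, map_zero, map_zero]
  have h₁ := hX.eq_of_eulerClass_mul_eq (CharSplitting.snd A) (h.trans (mul_zero _).symm)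
  have h₂ := congrArg (fun y => torusRes X (Torus.inl A circleTorus) (torusRes X Φ y)) h₁
  rw [hres, torusRes_torusRes, map_zero, map_zero] at h₂
  exact (torusRes_id X x).symm.trans h₂

/-- A functor to rings, lifted to a larger universe. -/
def uliftFunctorRing (Y : Torusᵒᵖ ⥤ CommRingCat.{u}) : Torusᵒᵖ ⥤ CommRingCat.{u + 1} where
  obj A := CommRingCat.of (ULift.{u + 1} (Y.obj A))
  map f := CommRingCat.ofHom (((ULift.ringEquiv.symm : _ ≃+* ULift.{u + 1} _).toRingHom.comp
    (Y.map f).hom).comp (ULift.ringEquiv : ULift.{u + 1} _ ≃+* _).toRingHom)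
  map_id A := by
    ext x
    exact congrArg (fun f => CommRingCat.Hom.hom f x.down) (Y.map_id A)
  map_comp f g := by
    ext x
    exact congrArg (fun f => CommRingCat.Hom.hom f x.down) (Y.map_comp f g)

theorem isCoordinate_uliftFunctorRing {Y : Torusᵒᵖ ⥤ CommRingCat.{u}} {e : Y.obj (op circleTorus)}
    (hY : IsCoordinate Y e) : IsCoordinate (uliftFunctorRing Y) (ULift.up e) :=
  hY.of_equiv (fun _ => ULift.ringEquiv.symm) (fun _ _ => rfl) rfl

/-- Existence of homomorphisms from the initial global group law. -/
theorem exists_lazard_hom {Y : Torusᵒᵖ ⥤ CommRingCat.{u}} {e : Y.obj (op circleTorus)}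
    (hY : IsCoordinate Y e) :
    ∃ f : ∀ A : Torus, lazardFunctor.{u}.obj (op A) →+* Y.obj (op A),
      (∀ {A B : Torus} (h : A.obj →ₜ* B.obj) (x : lazardFunctor.{u}.obj (op B)),
        f A (torusRes _ h x) = torusRes Y h (f B x)) ∧ f circleTorus lazardCoordinate = e := by
  -- The initial global group law is tested against laws one universe higher, because functions on
  -- all character points live there; `Y` is lifted accordingly.
  let Z : GlobalGroupLaw.{u + 1} := ⟨_, _, isCoordinate_uliftFunctorRing hY⟩
  refine ⟨fun A => (ULift.ringEquiv : ULift.{u + 1} (Y.obj (op A)) ≃+* _).toRingHom.comp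
    (lazardDesc Z A), fun h x => ?_, ?_⟩
  · exact congrArg ULift.down (lazardDesc_torusRes Z h x)
  · have h := lazardDesc_eulerClass Z (ContinuousMonoidHom.id _)
    rw [eulerClass_id, eulerClass_id] at h
    exact congrArg ULift.down h

section Res

variable (G : AbCompactLieGroupᵒᵖ ⥤ CommRingCat.{u}) {A B C : AbCompactLieGroup}

/-- The restriction map along a homomorphism of groups. -/
def groupRes (f : A →ₜ* B) : G.obj (op B) →+* G.obj (op A) := (G.map (ofHom f).op).hom

theorem groupRes_id (x : G.obj (op A)) : groupRes G (ContinuousMonoidHom.id A) x = x := by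
  have : G.map (ofHom (ContinuousMonoidHom.id A)).op = 𝟙 _ := G.map_id (op A)
  rw [groupRes, this]
  rfl

theorem groupRes_groupRes (f : A →ₜ* B) (g : B →ₜ* C) (x : G.obj (op C)) :
    groupRes G f (groupRes G g x) = groupRes G (g.comp f) x := by
  have : G.map (ofHom (g.comp f)).op = G.map (ofHom g).op ≫ G.map (ofHom f).op :=
    G.map_comp (ofHom g).op (ofHom f).op
  rw [groupRes, groupRes, groupRes, this]
  rfl

theorem torusRes_torusInclusion {T T' : Torus} (f : T.obj →ₜ* T'.obj) (x : G.obj (op T'.obj)) :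
    torusRes (torusInclusion ⋙ G) f x = groupRes G f x := rfl

variable {G} in
theorem naturality_groupRes {G' : AbCompactLieGroupᵒᵖ ⥤ CommRingCat.{u}} (η : G ⟶ G')
    (f : A →ₜ* B) (x : G.obj (op B)) :
    (η.app (op A)).hom (groupRes G f x) = groupRes G' f ((η.app (op B)).hom x) :=
  DFunLike.congr_fun (congrArg CommRingCat.Hom.hom (η.naturality (ofHom f).op)) x

end Res

/-! ### An arbitrary global Lazard ring, compared with the initial global group law. -/

namespace GlobalLazardRing

variable (𝓛 : GlobalLazardRing.{u}) {A B : AbCompactLieGroup} {T T' : Torus}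

/-- The evaluation of the initial global group law at a homomorphism to a torus. -/
def eval (δ : A →ₜ* T.obj) : lazardFunctor.{u}.obj (op T) →+* 𝓛.L.obj (op A) :=
  (𝓛.fgl A).augEval (torusChar δ)

theorem groupRes_eval (α : B →ₜ* A) (δ : A →ₜ* T.obj) (x : lazardFunctor.{u}.obj (op T)) :
    groupRes 𝓛.L α (𝓛.eval δ x) = 𝓛.eval (δ.comp α) x := by
  obtain ⟨G, ⟨P⟩, h, hh⟩ := 𝓛.map_eq α
  rw [groupRes, ← hh]
  exact h.base_augEval_of_pushforward P (torusChar δ) x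

theorem eval_torusRes (δ : A →ₜ* T.obj) (f : T.obj →ₜ* T'.obj) (x : lazardFunctor.{u}.obj (op T')) :
    𝓛.eval δ (torusRes _ f x) = 𝓛.eval (f.comp δ) x :=
  augEval_torusRes _ _ f x

theorem eval_eulerClass (δ : A →ₜ* T.obj) (V : T.Chars) :
    𝓛.eval δ (eulerClass _ lazardCoordinate V) = 𝓛.euler (torusChar δ V) :=
  augEval_eulerClass _ _ V

theorem eval_surjective {δ : A →ₜ* T.obj} (hδ : Function.Surjective (torusChar δ)) :
    Function.Surjective (𝓛.eval δ) := augEval_surjective (𝓛.isUniversal A) hδ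

variable (T) in
/-- The evaluation on a torus. -/
abbrev evalTorus : lazardFunctor.{u}.obj (op T) →+* 𝓛.L.obj (op T.obj) :=
  𝓛.eval (ContinuousMonoidHom.id T.obj)

theorem groupRes_evalTorus (δ : A →ₜ* T.obj) (x : lazardFunctor.{u}.obj (op T)) :
    groupRes 𝓛.L δ (𝓛.evalTorus T x) = 𝓛.eval δ x :=
  𝓛.groupRes_eval δ (ContinuousMonoidHom.id T.obj) x

theorem evalTorus_torusRes (f : T.obj →ₜ* T'.obj) (x : lazardFunctor.{u}.obj (op T')) :
    𝓛.evalTorus T (torusRes _ f x) = 𝓛.eval f x :=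
  𝓛.eval_torusRes (ContinuousMonoidHom.id T.obj) f x

/-- On a torus only the trivial character restricts trivially, so the ideal in the presentation is
generated by `e_1 = 0`. -/
theorem evalTorus_bijective (T : Torus) : Function.Bijective (𝓛.evalTorus T) := by
  have hT : Function.Surjective (torusChar (ContinuousMonoidHom.id T.obj)) := fun V => ⟨V, rfl⟩
  refine ⟨(injective_iff_map_eq_zero _).2 fun x hx => ?_, 𝓛.eval_surjective hT⟩
  have h := mem_span_of_augEval_eq_zero (𝓛.isUniversal T.obj) hT hx
  refine (Ideal.span_le (I := ⊥)).2 ?_ h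
  rintro _ ⟨V, hV, rfl⟩
  have hV : V = 1 := hV
  rw [hV]
  exact isCoordinate_lazardFunctor.eulerClass_one T

variable (T) in
/-- The evaluation on a torus, as an isomorphism. -/
def evalEquiv : lazardFunctor.{u}.obj (op T) ≃+* (torusInclusion ⋙ 𝓛.L).obj (op T) :=
  RingEquiv.ofBijective (𝓛.evalTorus T) (𝓛.evalTorus_bijective T)

theorem evalEquiv_torusRes (f : T.obj →ₜ* T'.obj) (x : lazardFunctor.{u}.obj (op T')) :
    𝓛.evalEquiv T (torusRes _ f x) = torusRes (torusInclusion ⋙ 𝓛.L) f (𝓛.evalEquiv T' x) := by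
  have h := (𝓛.evalTorus_torusRes f x).trans (𝓛.groupRes_evalTorus f x).symm
  exact h.trans (torusRes_torusInclusion 𝓛.L f _).symm

theorem evalEquiv_coordinate : 𝓛.evalEquiv circleTorus lazardCoordinate = 𝓛.e := by
  have h := 𝓛.eval_eulerClass (T := circleTorus) (ContinuousMonoidHom.id circleTorus.obj)
    (ContinuousMonoidHom.id _)
  rw [eulerClass_id] at h
  exact h

theorem isCoordinate : IsCoordinate (torusInclusion ⋙ 𝓛.L) 𝓛.e :=
  isCoordinate_lazardFunctor.of_equiv 𝓛.evalEquiv 𝓛.evalEquiv_torusRes 𝓛.evalEquiv_coordinate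

theorem isUniversalGlobalGroupLaw : IsUniversalGlobalGroupLaw (torusInclusion ⋙ 𝓛.L) 𝓛.e := by
  refine ⟨𝓛.isCoordinate, fun Y e' hY => ?_⟩
  obtain ⟨f, hf, he⟩ := exists_lazard_hom hY
  refine ⟨⟨fun T => CommRingCat.ofHom ((f T.unop).comp (𝓛.evalEquiv T.unop).symm.toRingHom),
    fun T T' g => ?_⟩, ?_, fun g hg => ?_⟩
  · ext y
    obtain ⟨x, rfl⟩ := (𝓛.evalEquiv T.unop).surjective y
    have h₁ := 𝓛.evalEquiv_torusRes g.unop.hom x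
    have h₂ := hf g.unop.hom x
    change f T'.unop ((𝓛.evalEquiv T'.unop).symm
      (torusRes (torusInclusion ⋙ 𝓛.L) g.unop.hom (𝓛.evalEquiv T.unop x))) =
      torusRes Y g.unop.hom (f T.unop ((𝓛.evalEquiv T.unop).symm (𝓛.evalEquiv T.unop x)))
    rw [← h₁, RingEquiv.symm_apply_apply, RingEquiv.symm_apply_apply, h₂]
  · change f circleTorus ((𝓛.evalEquiv circleTorus).symm 𝓛.e) = e'
    rw [← evalEquiv_coordinate, RingEquiv.symm_apply_apply, he]
  · ext T y
    obtain ⟨x, rfl⟩ := (𝓛.evalEquiv T.unop).surjective y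
    refine Eq.trans ?_ (congrArg (f T.unop) (RingEquiv.symm_apply_apply _ x)).symm
    refine lazard_hom_ext hY (fun T => (g.app (op T)).hom.comp (𝓛.evalEquiv T).toRingHom) f
      (fun h x => ?_) hf ?_ he T.unop x
    · exact (congrArg (g.app (op _)).hom (𝓛.evalEquiv_torusRes h x)).trans
        (naturality_torusRes g h _)
    · exact (congrArg (g.app (op circleTorus)).hom 𝓛.evalEquiv_coordinate).trans hg

/-! ### The left Kan extension property. -/

section KanExtension

variable {G : AbCompactLieGroupᵒᵖ ⥤ CommRingCat.{u}}
  (γ : torusInclusion ⋙ 𝓛.L ⟶ torusInclusion ⋙ G)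

variable (T) in
/-- A natural transformation on tori, as a map on the initial global group law. -/
def torusMap : lazardFunctor.{u}.obj (op T) →+* G.obj (op T.obj) :=
  (γ.app (op T)).hom.comp (𝓛.evalTorus T)

theorem torusMap_torusRes (f : T.obj →ₜ* T'.obj) (x : lazardFunctor.{u}.obj (op T')) :
    𝓛.torusMap T γ (torusRes _ f x) = groupRes G f (𝓛.torusMap T' γ x) :=
  (congrArg (γ.app (op T)).hom (𝓛.evalEquiv_torusRes f x)).trans (naturality_torusRes γ f _)

/-- If `V` is trivial on `A`, then `V ∘ δ` factors through the trivial torus, where the Euler class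
of the trivial character is zero. No exactness of `G` is needed. -/
theorem groupRes_torusMap_eulerClass {δ : A →ₜ* T.obj} {V : T.Chars} (hV : torusChar δ V = 1) :
    groupRes G δ (𝓛.torusMap T γ (eulerClass _ lazardCoordinate V)) = 0 := by
  have h₁ := 𝓛.torusMap_torusRes γ V lazardCoordinate
  have h₂ := 𝓛.torusMap_torusRes γ (1 : Torus.unit.Chars) lazardCoordinate
  have h₃ : 𝓛.torusMap _ γ (eulerClass _ lazardCoordinate (1 : Torus.unit.Chars)) = 0 :=
    (congrArg _ (isCoordinate_lazardFunctor.eulerClass_one _)).trans (map_zero _)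
  have h₄ : (1 : Torus.unit.Chars).comp (1 : A →ₜ* Torus.unit.obj) = V.comp δ := hV.symm
  rw [eulerClass, h₁, groupRes_groupRes, ← h₄, ← groupRes_groupRes, ← h₂]
  exact (congrArg _ h₃).trans (map_zero _)

theorem ker_eval_toHull_le (A : AbCompactLieGroup) :
    RingHom.ker (𝓛.eval A.toHull) ≤
      RingHom.ker ((groupRes G A.toHull).comp (𝓛.torusMap A.hull γ)) := fun x hx => by
  have h := mem_span_of_augEval_eq_zero (𝓛.isUniversal A) A.torusChar_toHull_surjective
    (RingHom.mem_ker.1 hx)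
  refine Ideal.span_le.2 ?_ h
  rintro _ ⟨V, hV, rfl⟩
  exact 𝓛.groupRes_torusMap_eulerClass γ hV

variable (A) in
/-- The extension of a natural transformation from tori to all groups. -/
def kanMap : 𝓛.L.obj (op A) →+* G.obj (op A) :=
  (𝓛.eval A.toHull).liftOfRightInverse
    (Function.surjInv (𝓛.eval_surjective A.torusChar_toHull_surjective))
    (Function.rightInverse_surjInv _)
    ⟨(groupRes G A.toHull).comp (𝓛.torusMap A.hull γ), 𝓛.ker_eval_toHull_le γ A⟩

/-- Every homomorphism to a torus factors through the hull, so the formula defining the extension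
there holds for all of them; naturality in `A` follows. -/
theorem kanMap_eval (δ : A →ₜ* T.obj) (x : lazardFunctor.{u}.obj (op T)) :
    𝓛.kanMap A γ (𝓛.eval δ x) = groupRes G δ (𝓛.torusMap T γ x) := by
  obtain ⟨δ', rfl⟩ := exists_comp_eq A.torusChar_toHull_surjective δ
  rw [← eval_torusRes, ← groupRes_groupRes, ← torusMap_torusRes]
  exact (𝓛.eval A.toHull).liftOfRightInverse_comp_apply _ _ _ _

/-- The extension of a natural transformation from tori to all groups. -/
def kanDesc : 𝓛.L ⟶ G where
  app A := CommRingCat.ofHom (𝓛.kanMap A.unop γ)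
  naturality A B α := by
    ext a
    obtain ⟨x, rfl⟩ := 𝓛.eval_surjective A.unop.torusChar_toHull_surjective a
    change 𝓛.kanMap B.unop γ (groupRes 𝓛.L α.unop (𝓛.eval A.unop.toHull x)) =
      groupRes G α.unop (𝓛.kanMap A.unop γ (𝓛.eval A.unop.toHull x))
    rw [groupRes_eval, kanMap_eval, kanMap_eval, groupRes_groupRes]

theorem whiskerLeft_kanDesc : Functor.whiskerLeft torusInclusion (𝓛.kanDesc γ) = γ := by
  ext T a
  obtain ⟨x, rfl⟩ := (𝓛.evalTorus_bijective T.unop).2 a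
  exact (𝓛.kanMap_eval γ _ x).trans (groupRes_id G _)

/-- Every element of `L_A` is restricted from the hull, which is a torus. -/
theorem hom_ext_of_whiskerLeft {η η' : 𝓛.L ⟶ G}
    (h : Functor.whiskerLeft torusInclusion η = Functor.whiskerLeft torusInclusion η') :
    η = η' := by
  ext A a
  obtain ⟨x, rfl⟩ := 𝓛.eval_surjective A.unop.torusChar_toHull_surjective a
  rw [← groupRes_evalTorus]
  have hη := naturality_groupRes η A.unop.toHull (𝓛.evalTorus _ x)
  have hη' := naturality_groupRes η' A.unop.toHull (𝓛.evalTorus _ x)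
  have hh : (η.app (op A.unop.hull.obj)).hom = (η'.app (op A.unop.hull.obj)).hom :=
    congrArg CommRingCat.Hom.hom (NatTrans.congr_app h (op A.unop.hull))
  rw [hh, ← hη'] at hη
  exact hη

end KanExtension

theorem isLeftKanExtension : 𝓛.L.IsLeftKanExtension (𝟙 (torusInclusion ⋙ 𝓛.L)) where
  nonempty_isUniversal := ⟨Limits.IsInitial.ofUniqueHom
    (fun E => StructuredArrow.homMk (𝓛.kanDesc E.hom)
      ((Category.id_comp _).trans (𝓛.whiskerLeft_kanDesc E.hom)))
    fun E m => StructuredArrow.ext _ _ (𝓛.hom_ext_of_whiskerLeft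
      (((Category.id_comp _).symm.trans (StructuredArrow.w m)).trans
        (𝓛.whiskerLeft_kanDesc E.hom).symm))⟩

theorem euler_mem_nonZeroDivisors (hA : A.IsTorus) {V : A.Char} (hV : IsSplit V) :
    𝓛.euler V ∈ nonZeroDivisors (𝓛.L.obj (op A)) := by
  obtain ⟨s, hs⟩ := hV
  let T : Torus := ⟨A, hA⟩
  have h := 𝓛.isCoordinate.eulerClass_mem_nonZeroDivisors (A := T) (V := V) (s := s)
    (ContinuousMonoidHom.ext hs)
  have h' : eulerClass (torusInclusion ⋙ 𝓛.L) 𝓛.e (A := T) V = 𝓛.euler V := by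
    have h₁ := 𝓛.evalEquiv_torusRes (T := T) (T' := circleTorus) V lazardCoordinate
    rw [evalEquiv_coordinate] at h₁
    exact h₁.symm.trans (𝓛.eval_eulerClass (T := T) _ V)
  rwa [h'] at h

end GlobalLazardRing

/-! ### Uniqueness and the main theorem. -/

/-- Universal global group laws are unique up to isomorphism. -/
theorem IsUniversalGlobalGroupLaw.exists_iso {X Y : Torusᵒᵖ ⥤ CommRingCat.{u}}
    {e : X.obj (op circleTorus)} {e' : Y.obj (op circleTorus)}
    (hX : IsUniversalGlobalGroupLaw X e) (hY : IsUniversalGlobalGroupLaw Y e') :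
    ∃ σ : X ≅ Y, (σ.hom.app (op circleTorus)).hom e = e' := by
  obtain ⟨f, hf, -⟩ := hX.2 Y e' hY.1
  obtain ⟨g, hg, -⟩ := hY.2 X e hX.1
  refine ⟨⟨f, g, (hX.2 X e hX.1).unique ?_ rfl, (hY.2 Y e' hY.1).unique ?_ rfl⟩, hf⟩
  · change (g.app (op circleTorus)).hom ((f.app (op circleTorus)).hom e) = e
    rw [hf, hg]
  · change (f.app (op circleTorus)).hom ((g.app (op circleTorus)).hom e') = e'
    rw [hg, hf]

theorem mainTheorem6 :
    -- the global Lazard ring exists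
    Nonempty GlobalLazardRing.{u} ∧
    -- the universal global group law exists, together with its extension to an `Ab`-algebra
    (∃ (X : Torusᵒᵖ ⥤ CommRingCat.{u}) (e : X.obj (op circleTorus)),
      IsUniversalGlobalGroupLaw X e ∧ torusInclusion.HasLeftKanExtension X) ∧
    ∀ 𝓛 : GlobalLazardRing.{u},
      -- the global Lazard ring is isomorphic to the universal global group law
      (∀ (X : Torusᵒᵖ ⥤ CommRingCat.{u}) (e : X.obj (op circleTorus)),
        IsUniversalGlobalGroupLaw X e →
        ∀ (X' : AbCompactLieGroupᵒᵖ ⥤ CommRingCat.{u}) (η : X ⟶ torusInclusion ⋙ X'),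
          X'.IsLeftKanExtension η →
          ∃ φ : 𝓛.L ≅ X',
            (φ.hom.app (op AbCompactLieGroup.circle)).hom 𝓛.e = (η.app (op circleTorus)).hom e) ∧
      -- hence `(𝓛, e_τ)` is the universal global group law
      (IsUniversalGlobalGroupLaw (torusInclusion ⋙ 𝓛.L) 𝓛.e ∧
        𝓛.L.IsLeftKanExtension (𝟙 (torusInclusion ⋙ 𝓛.L))) ∧
      -- Euler classes of split characters of tori are regular
      ∀ (A : AbCompactLieGroup), A.IsTorus → ∀ V : A.Char, AbCompactLieGroup.IsSplit V →
        𝓛.euler V ∈ nonZeroDivisors (𝓛.L.obj (op A)) := by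
  refine ⟨⟨globalLazardRing⟩, ⟨_, _, globalLazardRing.isUniversalGlobalGroupLaw, ?_⟩,
    fun 𝓛 => ⟨fun X e hX X' η hη => ?_, ⟨𝓛.isUniversalGlobalGroupLaw, 𝓛.isLeftKanExtension⟩,
      fun A hA V hV => 𝓛.euler_mem_nonZeroDivisors hA hV⟩⟩
  · have := globalLazardRing.{u}.isLeftKanExtension
    exact Functor.HasLeftKanExtension.mk _ (𝟙 (torusInclusion ⋙ globalLazardRing.{u}.L))
  · have := 𝓛.isLeftKanExtension
    obtain ⟨σ, hσ⟩ := 𝓛.isUniversalGlobalGroupLaw.exists_iso hX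
    -- Both are left Kan extensions, along the same inclusion, of initial global group laws. The
    -- coordinate-preserving isomorphism `σ` of the latter induces the isomorphism, whose value on
    -- the Euler class is computed from the unit.
    refine ⟨Functor.leftKanExtensionUniqueOfIso 𝓛.L (𝟙 (torusInclusion ⋙ 𝓛.L)) σ X' η, ?_⟩
    have h := Functor.descOfIsLeftKanExtension_fac_app 𝓛.L (𝟙 (torusInclusion ⋙ 𝓛.L)) X'
      (σ.hom ≫ η) (op circleTorus)
    refine (DFunLike.congr_fun (congrArg CommRingCat.Hom.hom h) 𝓛.e).trans ?_
    exact congrArg (η.app (op circleTorus)).hom hσ
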